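/- For $\alpha>0$ and $z$ in the upper half-plane $\mathbb{H}=\{z\in\mathbb{C}:\Im z>0\}$ let $$M(\alpha,z)=\sum_{(m,n)\in\mathbb{Z}^2}\frac{|mz+n|^2}{\Im(z)}\,e^{-\pi\alpha\frac{|mz+n|^2}{\Im(z)}}.$$ Let $\mathcal{D}_{\mathcal{G}}=\{z\in\mathbb{H}:|z|>1,\ 0<\Re z<\tfrac12\}$, with closure $\overline{\mathcal{D}_{\mathcal{G}}}$ in $\mathbb{H}$, and let $$\Gamma_a=\{iy: y\ge 1\},\qquad \Gamma_b=\{e^{i\theta}:\theta\in[\tfrac{\pi}{3},\tfrac{\pi}{2}]\},\qquad \Gamma=\Gamma_a\cup\Gamma_b.$$ Then, for every $\alpha\in(0,1]$, the series defining $M(\alpha,z)$ converges for every $z\in\mathbb{H}$, each of the following three minima is attained, and $$\min_{z\in\mathbb{H}}M(\alpha,z)=\min_{z\in\overline{\mathcal{D}_{\mathcal{G}}}}M(\alpha,z)=\min_{z\in\Gamma}M(\alpha,z).$$ -/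

import Mathlib

open UpperHalfPlane

noncomputable section

namespace LatticeEnergy

/-- `|m z + n|² / Im z`: the squared length `|P|²` of the point `P` with coordinates `(m, n)` in the
unit-density lattice `L = (Im z)^(-1/2) (ℤ ⊕ z ℤ)`. -/
def normSqPt (z : ℍ) (p : ℤ × ℤ) : ℝ :=
  ‖(p.1 : ℂ) * (z : ℂ) + (p.2 : ℂ)‖ ^ 2 / z.im

/-- `M(α, z) = ∑_{(m, n) ∈ ℤ²} |P|² exp (-π α |P|²)`. -/
def M (α : ℝ) (z : ℍ) : ℝ :=
  ∑' p : ℤ × ℤ, normSqPt z p * Real.exp (-Real.pi * α * normSqPt z p)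

/-- The open right half `{|z| > 1, 0 < Re z < 1/2}` of the modular fundamental domain. -/
def halfDomain : Set ℍ :=
  {z | 1 < ‖(z : ℂ)‖ ∧ 0 < z.re ∧ z.re < 1 / 2}

/-- The half-line `{i y : y ≥ 1}`. -/
def GammaA : Set ℍ :=
  {z | ∃ y : ℝ, 1 ≤ y ∧ (z : ℂ) = Complex.I * (y : ℂ)}

/-- The arc `{e^{i t} : π/3 ≤ t ≤ π/2}`. -/
def GammaB : Set ℍ :=
  {z | ∃ t ∈ Set.Icc (Real.pi / 3) (Real.pi / 2), (z : ℂ) = Complex.exp (Complex.I * (t : ℂ))}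

/-- `Γ = Γ_a ∪ Γ_b`. -/
def Gamma : Set ℍ := GammaA ∪ GammaB

end LatticeEnergy

end

namespace LatticeEnergy

/-! With A = παy and B = πy/α, Poisson summation in n turns M(α, x + iy) into a positive factor
times the sum over (m, l) of e^{-Am² - Bl²}(Am² + 1/2 - Bl²) cos(2πmlx), so x enters only through
cosines. The dominant x-dependent term is a negative multiple of (B - A - 1/2) cos 2πx.
Heuristically, at fixed height the energy drops when the point moves left to Re = 0 if B - A > 1/2,
and right to Re = 1/2 if B - A < 1/2; α ≤ 1 gives B ≥ A. The work is to make this rigorous and to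
end on Γ after a modular map.

By `M_smul` and the reflection x ↦ -x one may take z in the closed half domain, so y ≥ √3/2;
`exists_onGamma_le` then finds a point of Γ with no larger energy. If B - A ≥ 0.54, move left
(`energy_zero_le`); an inversion brings the imaginary axis to Γ_a. Otherwise α ≥ 0.9, and usually
one passes to the equivalent point w, the inversion (with reflection) of 1 - x + iy, whose height is
at most √3/2 so that B - A is smaller there. Moving w to Re = 1/2 lowers the energy, and the
relevant part of that line is equivalent to the arc Γ_b (`exists_onGamma_of_slope_nonpos`). If y is
also large, the energy already exceeds that at i (`energy_I_le`).

The delicate range is α in [0.9, 0.918], where B - A is close to 1/2 at the hexagonal point e^{iπ/3}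
and no crude estimate decides the direction. Differences of energy at equal height equal, up to a
positive factor, a difference of cosines times `slope`, a double series of divided differences of
Chebyshev polynomials, which are bounded by k². At the hexagonal point `slope` degenerates to the
series H with k² in their place. Only the sign of H is used: if H ≥ 0 the slope is nonnegative at
heights above √3/2 in the domain, so z moves left until it meets Γ (`slope_nonneg_of_critical`); if
H ≤ 0 the slope is nonpositive just below √3/2, so w moves right (`slope_zero_nonpos_of_critical`).
Both follow from expanding `slope` around H (`abs_slope_sub_harmonicSum_sq_le`), the linear growth
of B - A in y beating every error.

Finally the energy is lower semicontinuous and tends to infinity along Γ_a, so it has a minimum on Γ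
(`exists_min_onGamma`), which is then the minimum over ℍ and over the intermediate closure. -/

/-- The quadratic form `|m z + n|² / Im z` for `z = x + i y`. -/
noncomputable def quadForm (x y : ℝ) (p : ℤ × ℤ) : ℝ :=
  (((p.1 : ℝ) * x + p.2) ^ 2 + ((p.1 : ℝ) * y) ^ 2) / y

/-- `M(α, x + i y)` as a function of two real variables. -/
noncomputable def energy (α x y : ℝ) : ℝ :=
  ∑' p : ℤ × ℤ, quadForm x y p * Real.exp (-Real.pi * α * quadForm x y p)

theorem normSqPt_eq_quadForm (z : ℍ) (p : ℤ × ℤ) :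
    normSqPt z p = quadForm z.re z.im p := by
  unfold normSqPt quadForm
  congr 1
  rw [← Complex.normSq_eq_norm_sq, Complex.normSq_apply]
  simp
  ring

theorem M_eq_energy (α : ℝ) (z : ℍ) : M α z = energy α z.re z.im := by
  unfold M energy
  simp_rw [normSqPt_eq_quadForm]

theorem quadForm_nonneg {x y : ℝ} (hy : 0 < y) (p : ℤ × ℤ) : 0 ≤ quadForm x y p := by
  unfold quadForm; positivity

/-! ### Convergence of the series -/

theorem summable_exp_neg_mul_int_sq {a : ℝ} (ha : 0 < a) :
    Summable fun m : ℤ => Real.exp (-a * (m : ℝ) ^ 2) := by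
  have h : Summable fun n : ℕ => Real.exp (-a * (n : ℝ) ^ 2) := by
    refine Summable.of_nonneg_of_le (fun n => (Real.exp_pos _).le) (fun n => ?_)
      (Real.summable_exp_nat_mul_iff.mpr (neg_lt_zero.mpr ha))
    apply Real.exp_le_exp.mpr
    have : (n : ℝ) ≤ (n : ℝ) ^ 2 := by exact_mod_cast Nat.le_self_pow two_ne_zero n
    nlinarith
  refine Summable.of_nat_of_neg ?_ ?_
  · simpa using h
  · simpa using h

theorem summable_exp_neg_int_prod {a b : ℝ} (ha : 0 < a) (hb : 0 < b) :
    Summable fun p : ℤ × ℤ => Real.exp (-a * (p.1 : ℝ) ^ 2 - b * (p.2 : ℝ) ^ 2) := by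
  have := (summable_exp_neg_mul_int_sq ha).mul_of_nonneg (summable_exp_neg_mul_int_sq hb)
    (fun _ => (Real.exp_pos _).le) (fun _ => (Real.exp_pos _).le)
  refine this.congr fun p => ?_
  rw [← Real.exp_add]; congr 1; ring

theorem exists_quadForm_ge {x y : ℝ} (hy : 0 < y) :
    ∃ c > 0, ∀ p : ℤ × ℤ, c * ((p.1 : ℝ) ^ 2 + (p.2 : ℝ) ^ 2) ≤ quadForm x y p := by
  -- The constant comes from n² ≤ 2(mx + n)² + 2x²m², which holds because the difference is (2mx +
  -- n)², together with m² = (my)²/y².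
  refine ⟨1 / (y * (2 + (2 * x ^ 2 + 1) / y ^ 2)), by positivity, fun p => ?_⟩
  unfold quadForm
  rw [div_mul_eq_mul_div, one_mul, div_le_div_iff₀ (by positivity) hy]
  have e : (((p.1 : ℝ) * x + p.2) ^ 2 + ((p.1 : ℝ) * y) ^ 2) * (y * (2 + (2 * x ^ 2 + 1) / y ^ 2))
      = y * (2 * ((p.1 : ℝ) * x + p.2) ^ 2 + 2 * ((p.1 : ℝ) * y) ^ 2
        + (2 * x ^ 2 + 1) * (p.1 : ℝ) ^ 2
        + (2 * x ^ 2 + 1) / y ^ 2 * ((p.1 : ℝ) * x + p.2) ^ 2) := by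
    field_simp; ring
  rw [e, mul_comm]
  apply mul_le_mul_of_nonneg_left _ hy.le
  have h1 : 0 ≤ (2 * x ^ 2 + 1) / y ^ 2 * ((p.1 : ℝ) * x + p.2) ^ 2 := by positivity
  have h2 : 0 ≤ 2 * ((p.1 : ℝ) * y) ^ 2 := by positivity
  nlinarith [sq_nonneg (2 * (p.1 : ℝ) * x + p.2)]

theorem mul_exp_neg_le (t : ℝ) : t * Real.exp (-t) ≤ 2 * Real.exp (-t / 2) := by
  have h := Real.add_one_le_exp (t / 2)
  have e : Real.exp (-t / 2) = Real.exp (-t) * Real.exp (t / 2) := by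
    rw [← Real.exp_add]; congr 1; ring
  rw [e]
  nlinarith [Real.exp_pos (-t)]

theorem summable_energy {α x y : ℝ} (hα : 0 < α) (hy : 0 < y) :
    Summable fun p : ℤ × ℤ => quadForm x y p * Real.exp (-Real.pi * α * quadForm x y p) := by
  obtain ⟨c, hc, h⟩ := exists_quadForm_ge (x := x) hy
  have hπ := Real.pi_pos
  have hs := (summable_exp_neg_int_prod (a := Real.pi * α * c / 2) (b := Real.pi * α * c / 2)
    (by positivity) (by positivity)).mul_left (2 / (Real.pi * α))
  refine Summable.of_nonneg_of_le
    (fun p => mul_nonneg (quadForm_nonneg hy p) (Real.exp_pos _).le) (fun p => ?_) hs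
  have h1 := mul_exp_neg_le (Real.pi * α * quadForm x y p)
  have h2 : Real.exp (-(Real.pi * α * quadForm x y p) / 2) ≤
      Real.exp (-(Real.pi * α * c / 2) * (p.1 : ℝ) ^ 2 - Real.pi * α * c / 2 * (p.2 : ℝ) ^ 2) := by
    apply Real.exp_le_exp.mpr
    nlinarith [mul_le_mul_of_nonneg_left (h p) (mul_pos hπ hα).le]
  rw [div_mul_eq_mul_div, le_div_iff₀ (by positivity)]
  calc _ = Real.pi * α * quadForm x y p * Real.exp (-(Real.pi * α * quadForm x y p)) := by
        rw [← neg_mul, ← neg_mul]; ring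
    _ ≤ _ := h1.trans (by linarith)

/-! ### Symmetries -/

theorem energy_congr_equiv {α x y x' y' : ℝ} (e : ℤ × ℤ ≃ ℤ × ℤ)
    (h : ∀ p, quadForm x y (e p) = quadForm x' y' p) : energy α x y = energy α x' y' := by
  unfold energy
  rw [← e.tsum_eq]
  simp_rw [h]

theorem energy_neg (α x y : ℝ) : energy α (-x) y = energy α x y := by
  refine energy_congr_equiv ((Equiv.neg ℤ).prodCongr (Equiv.refl ℤ)) fun p => ?_
  simp [quadForm]

theorem energy_abs (α x y : ℝ) : energy α |x| y = energy α x y := by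
  rcases abs_choice x with h | h <;> rw [h]
  exact energy_neg α x y

theorem energy_add_one (α x y : ℝ) : energy α (x + 1) y = energy α x y := by
  refine energy_congr_equiv
    ⟨fun p => (p.1, p.2 - p.1), fun p => (p.1, p.2 + p.1), fun p => by simp, fun p => by simp⟩
    fun p => ?_
  simp only [quadForm, Equiv.coe_fn_mk]
  push_cast
  congr 2; ring

theorem energy_one_sub (α x y : ℝ) : energy α (1 - x) y = energy α x y := by
  rw [← energy_neg α x y, ← energy_add_one α (-x) y]; congr 1; ring

theorem energy_inv {x y : ℝ} (α : ℝ) (hy : y ≠ 0) :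
    energy α (x / (x ^ 2 + y ^ 2)) (y / (x ^ 2 + y ^ 2)) = energy α x y := by
  have h0 : x ^ 2 + y ^ 2 ≠ 0 := by positivity
  refine energy_congr_equiv (Equiv.prodComm ℤ ℤ) fun p => ?_
  simp only [quadForm, Equiv.prodComm_apply, Prod.fst_swap, Prod.snd_swap]
  field_simp
  ring

/-- SL₂(ℤ) is generated by S and T, which act as an inversion followed by a reflection and as a unit
translation; each only permutes the lattice indices. -/
theorem M_smul (α : ℝ) (g : Matrix.SpecialLinearGroup (Fin 2) ℤ) (z : ℍ) :
    M α (g • z) = M α z := by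
  have hg : g ∈ Subgroup.closure {ModularGroup.S, ModularGroup.T} := by
    simp [SpecialLinearGroup.SL2Z_generators]
  revert z
  induction hg using Subgroup.closure_induction with
  | mem g hg =>
    intro z
    rcases hg with rfl | rfl
    · rw [M_eq_energy, M_eq_energy, UpperHalfPlane.modular_S_smul, ← energy_inv α z.im_ne_zero,
        ← energy_neg]
      have h2 : z.re ^ 2 + z.im ^ 2 = Complex.normSq (z : ℂ) := by
        rw [Complex.normSq_apply]; simp; ring
      rw [h2]
      congr 1
      · simp [← UpperHalfPlane.coe_re, Complex.inv_re, neg_div]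
      · simp [← UpperHalfPlane.coe_im, Complex.inv_im, neg_div]
    · rw [M_eq_energy, M_eq_energy, UpperHalfPlane.modular_T_smul,
        ← energy_add_one α z.re]
      congr 1
      · simp [add_comm]
      · simp
  | one => simp
  | mul g h _ _ hg hh => intro z; rw [mul_smul, hg, hh]
  | inv g _ hg => intro z; rw [← hg, smul_inv_smul]

/-! ### Poisson summation in one of the two lattice directions -/

theorem tsum_exp_neg_sq_shift {c : ℝ} (hc : 0 < c) (ω : ℝ) :
    ∑' n : ℤ, Real.exp (-Real.pi * c * ((n : ℝ) + ω) ^ 2) =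
      (√c)⁻¹ * ∑' l : ℤ, Real.exp (-Real.pi / c * (l : ℝ) ^ 2) *
        Real.cos (2 * Real.pi * l * ω) := by
  -- The library formula has a quadratic and a linear term; a = 1/c and the purely imaginary b = -iω
  -- turn its dual side into the shifted Gaussian sum.
  have key := Complex.tsum_exp_neg_quadratic (a := ((c⁻¹ : ℝ) : ℂ))
    (by simpa using hc) (-Complex.I * ω)
  have hR : ∀ n : ℤ, Complex.exp (-Real.pi / ((c⁻¹ : ℝ) : ℂ) *
      (n + Complex.I * (-Complex.I * ω)) ^ 2) =
        ((Real.exp (-Real.pi * c * ((n : ℝ) + ω) ^ 2) : ℝ) : ℂ) := by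
    intro n
    push_cast
    congr 1
    have : Complex.I * (-Complex.I * (ω : ℂ)) = ω := by
      rw [← mul_assoc, mul_neg, Complex.I_mul_I]; ring
    rw [this]
    field_simp
  have hL : ∀ l : ℤ, Complex.exp (-Real.pi * ((c⁻¹ : ℝ) : ℂ) * (l : ℂ) ^ 2 +
      2 * Real.pi * (-Complex.I * ω) * l) =
        ((Real.exp (-Real.pi / c * (l : ℝ) ^ 2) : ℝ) : ℂ) *
          Complex.exp (((-(2 * Real.pi * l * ω) : ℝ) : ℂ) * Complex.I) := by
    intro l
    push_cast
    rw [← Complex.exp_add]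
    congr 1
    field_simp
  simp_rw [hR, hL] at key
  have hsum : Summable fun l : ℤ => ((Real.exp (-Real.pi / c * (l : ℝ) ^ 2) : ℝ) : ℂ) *
      Complex.exp (((-(2 * Real.pi * l * ω) : ℝ) : ℂ) * Complex.I) := by
    refine Summable.of_norm ?_
    simp_rw [norm_mul, Complex.norm_exp_ofReal_mul_I, mul_one, Complex.norm_real,
      Real.norm_eq_abs, Real.abs_exp]
    have := summable_exp_neg_mul_int_sq (a := Real.pi / c) (by positivity)
    simpa [neg_div] using this
  have hre := congrArg Complex.re key
  rw [Complex.re_tsum hsum] at hre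
  have h1 : (1 / ((c⁻¹ : ℝ) : ℂ) ^ (1 / 2 : ℂ)) = ((√c : ℝ) : ℂ) := by
    have : ((1 : ℂ) / 2) = (((1 / 2 : ℝ)) : ℂ) := by push_cast; rfl
    rw [this, ← Complex.ofReal_cpow (by positivity), ← Real.sqrt_eq_rpow, Real.sqrt_inv]
    push_cast
    simp
  rw [h1, ← Complex.ofReal_tsum, ← Complex.ofReal_mul, Complex.ofReal_re] at hre
  simp_rw [Complex.re_ofReal_mul, Complex.exp_ofReal_mul_I_re, Real.cos_neg] at hre
  rw [hre, inv_mul_cancel_left₀]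
  positivity

theorem summable_exp_neg_sq_shift {a : ℝ} (ha : 0 < a) (ω : ℝ) :
    Summable fun n : ℤ => Real.exp (-a * ((n : ℝ) + ω) ^ 2) := by
  have h := (summable_exp_neg_mul_int_sq (a := a / 2) (by positivity)).mul_left
    (Real.exp (a * ω ^ 2))
  refine Summable.of_nonneg_of_le (fun n => (Real.exp_pos _).le) (fun n => ?_) h
  rw [← Real.exp_add]
  apply Real.exp_le_exp.mpr
  nlinarith [mul_nonneg ha.le (sq_nonneg ((n : ℝ) + 2 * ω))]

theorem mul_exp_neg_mul_le {a s : ℝ} (ha : 0 < a) :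
    s * Real.exp (-a * s) ≤ 2 / a * Real.exp (-(a / 2) * s) := by
  have h := mul_exp_neg_le (a * s)
  rw [div_mul_eq_mul_div, le_div_iff₀ ha]
  have e1 : -(a * s) = -a * s := by ring
  have e2 : -(a * s) / 2 = -(a / 2) * s := by ring
  rw [e1] at h
  rw [show -a * s / 2 = -(a / 2) * s by ring] at h
  linarith

theorem hasDerivAt_tsum_exp_neg_sq_shift {c : ℝ} (hc : 0 < c) (ω : ℝ) :
    HasDerivAt (fun c => ∑' n : ℤ, Real.exp (-Real.pi * c * ((n : ℝ) + ω) ^ 2))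
      (∑' n : ℤ, -Real.pi * ((n : ℝ) + ω) ^ 2 * Real.exp (-Real.pi * c * ((n : ℝ) + ω) ^ 2)) c := by
  have hπ := Real.pi_pos
  have hu := (summable_exp_neg_sq_shift (a := Real.pi * (c / 2) / 2) (by positivity) ω).mul_left
    (Real.pi * (2 / (Real.pi * (c / 2))))
  have hm : c ∈ Set.Ioi (c / 2) := half_lt_self hc
  refine hasDerivAt_tsum_of_isPreconnected
    (g := fun (n : ℤ) c => Real.exp (-Real.pi * c * ((n : ℝ) + ω) ^ 2))
    (g' := fun (n : ℤ) c => -Real.pi * ((n : ℝ) + ω) ^ 2 *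
      Real.exp (-Real.pi * c * ((n : ℝ) + ω) ^ 2))
    hu isOpen_Ioi isPreconnected_Ioi
    (fun n y _ => ?_) (fun n y hy => ?_) hm ?_ hm
  · have := ((((hasDerivAt_id y).const_mul (-Real.pi)).mul_const (((n : ℝ) + ω) ^ 2))).exp
    exact this.congr_deriv (by simp only [id]; ring)
  · have hy' : c / 2 < y := hy
    rw [norm_mul, Real.norm_eq_abs, Real.norm_eq_abs, Real.abs_exp, neg_mul, abs_neg,
      abs_of_nonneg (by positivity)]
    have h1 : Real.exp (-Real.pi * y * ((n : ℝ) + ω) ^ 2) ≤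
        Real.exp (-(Real.pi * (c / 2)) * ((n : ℝ) + ω) ^ 2) := by
      apply Real.exp_le_exp.mpr
      nlinarith [mul_nonneg hπ.le (sq_nonneg ((n : ℝ) + ω)),
        mul_le_mul_of_nonneg_left hy'.le (mul_nonneg hπ.le (sq_nonneg ((n : ℝ) + ω)))]
    have h2 := mul_exp_neg_mul_le (a := Real.pi * (c / 2)) (s := ((n : ℝ) + ω) ^ 2) (by positivity)
    calc _ ≤ Real.pi * (((n : ℝ) + ω) ^ 2 *
          Real.exp (-(Real.pi * (c / 2)) * ((n : ℝ) + ω) ^ 2)) := by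
            rw [mul_assoc]; gcongr
      _ ≤ _ := by
        rw [mul_assoc]
        exact mul_le_mul_of_nonneg_left h2 hπ.le
  · have := summable_exp_neg_sq_shift (a := Real.pi * c) (by positivity) ω
    simpa using this

theorem hasDerivAt_tsum_exp_neg_div_cos {c : ℝ} (hc : 0 < c) (ω : ℝ) :
    HasDerivAt (fun c => ∑' l : ℤ, Real.exp (-Real.pi / c * (l : ℝ) ^ 2) *
        Real.cos (2 * Real.pi * l * ω))
      (∑' l : ℤ, Real.pi / c ^ 2 * (l : ℝ) ^ 2 * Real.exp (-Real.pi / c * (l : ℝ) ^ 2) *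
        Real.cos (2 * Real.pi * l * ω)) c := by
  have hπ := Real.pi_pos
  have hu := (summable_exp_neg_mul_int_sq (a := Real.pi / (2 * c) / 2) (by positivity)).mul_left
    (Real.pi / (c / 2) ^ 2 * (2 / (Real.pi / (2 * c))))
  -- The parameter must also be bounded above here: the decay of exp(-πl²/c) weakens as c grows, so
  -- the majorant is taken at 2c.
  have hm : c ∈ Set.Ioo (c / 2) (2 * c) := ⟨half_lt_self hc, by linarith⟩
  refine hasDerivAt_tsum_of_isPreconnected
    (g := fun (l : ℤ) c => Real.exp (-Real.pi / c * (l : ℝ) ^ 2) *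
        Real.cos (2 * Real.pi * l * ω))
    (g' := fun (l : ℤ) c => Real.pi / c ^ 2 * (l : ℝ) ^ 2 *
      Real.exp (-Real.pi / c * (l : ℝ) ^ 2) * Real.cos (2 * Real.pi * l * ω))
    hu isOpen_Ioo isPreconnected_Ioo
    (fun l y hy => ?_) (fun l y hy => ?_) hm ?_ hm
  · have hy0 : y ≠ 0 := by have := hy.1; linarith
    have := ((((hasDerivAt_inv hy0).const_mul (-Real.pi)).mul_const ((l : ℝ) ^ 2))).exp.mul_const
      (Real.cos (2 * Real.pi * l * ω))
    simp only [div_eq_mul_inv]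
    exact this.congr_deriv (by ring)
  · have hy0 : 0 < y := by have := hy.1; linarith
    rw [norm_mul, norm_mul, Real.norm_eq_abs, Real.norm_eq_abs, Real.norm_eq_abs, Real.abs_exp,
      abs_of_nonneg (by positivity)]
    have hy1 := hy.1
    have hy2 := hy.2
    have h1 : Real.exp (-Real.pi / y * (l : ℝ) ^ 2) ≤
        Real.exp (-(Real.pi / (2 * c)) * (l : ℝ) ^ 2) := by
      apply Real.exp_le_exp.mpr
      apply mul_le_mul_of_nonneg_right _ (sq_nonneg _)
      rw [neg_div]
      apply neg_le_neg
      gcongr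
    have h2 := mul_exp_neg_mul_le (a := Real.pi / (2 * c)) (s := (l : ℝ) ^ 2) (by positivity)
    calc _ ≤ Real.pi / y ^ 2 * (l : ℝ) ^ 2 * Real.exp (-Real.pi / y * (l : ℝ) ^ 2) * 1 := by
          gcongr; exact Real.abs_cos_le_one _
      _ ≤ Real.pi / (c / 2) ^ 2 * ((l : ℝ) ^ 2 *
          Real.exp (-(Real.pi / (2 * c)) * (l : ℝ) ^ 2)) := by
            rw [mul_one, mul_assoc]; gcongr
      _ ≤ _ := by
        rw [mul_assoc]
        gcongr
  · have := summable_exp_neg_mul_int_sq (a := Real.pi / c) (by positivity)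
    refine Summable.of_norm_bounded this fun l => ?_
    rw [norm_mul, Real.norm_eq_abs, Real.norm_eq_abs, Real.abs_exp, neg_div]
    exact mul_le_of_le_one_right (Real.exp_pos _).le (Real.abs_cos_le_one _)

/-- Differentiating both sides of the Poisson identity in c brings down the factor -π(n + ω)² on the
left; on the right, the derivative of c^{-1/2} gives the first sum and that of the dual Gaussian the
second. -/
theorem tsum_sq_mul_exp_neg_sq_shift {c : ℝ} (hc : 0 < c) (ω : ℝ) :
    ∑' n : ℤ, ((n : ℝ) + ω) ^ 2 * Real.exp (-Real.pi * c * ((n : ℝ) + ω) ^ 2) =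
      (√c)⁻¹ * (1 / (2 * Real.pi * c) * (∑' l : ℤ, Real.exp (-Real.pi / c * (l : ℝ) ^ 2) *
        Real.cos (2 * Real.pi * l * ω)) -
        (1 / c ^ 2) * ∑' l : ℤ, (l : ℝ) ^ 2 * Real.exp (-Real.pi / c * (l : ℝ) ^ 2) *
        Real.cos (2 * Real.pi * l * ω)) := by
  have hπ := Real.pi_pos
  have h1 := hasDerivAt_tsum_exp_neg_sq_shift hc ω
  have h2 := ((Real.hasDerivAt_sqrt hc.ne').inv (by positivity)).mul
    (hasDerivAt_tsum_exp_neg_div_cos hc ω)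
  have h3 : (fun c : ℝ => ∑' n : ℤ, Real.exp (-Real.pi * c * ((n : ℝ) + ω) ^ 2)) =ᶠ[nhds c]
      ((fun c => √c)⁻¹ * fun c => ∑' l : ℤ, Real.exp (-Real.pi / c * (l : ℝ) ^ 2) *
        Real.cos (2 * Real.pi * l * ω)) := by
    filter_upwards [lt_mem_nhds hc] with d hd
    simpa using tsum_exp_neg_sq_shift hd ω
  have h4 := h1.unique (h2.congr_of_eventuallyEq h3)
  have e1 : ∑' n : ℤ, -Real.pi * ((n : ℝ) + ω) ^ 2 * Real.exp (-Real.pi * c * ((n : ℝ) + ω) ^ 2)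
      = -Real.pi * ∑' n : ℤ, ((n : ℝ) + ω) ^ 2 * Real.exp (-Real.pi * c * ((n : ℝ) + ω) ^ 2) := by
    rw [← tsum_mul_left]; simp_rw [mul_assoc]
  have e2 : ∑' l : ℤ, Real.pi / c ^ 2 * (l : ℝ) ^ 2 * Real.exp (-Real.pi / c * (l : ℝ) ^ 2) *
        Real.cos (2 * Real.pi * l * ω) = Real.pi / c ^ 2 *
          ∑' l : ℤ, (l : ℝ) ^ 2 * Real.exp (-Real.pi / c * (l : ℝ) ^ 2) *
        Real.cos (2 * Real.pi * l * ω) := by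
    rw [← tsum_mul_left]; simp_rw [mul_assoc]
  rw [e1, e2] at h4
  have hsq : √c ^ 2 = c := Real.sq_sqrt hc.le
  have hs : 0 < √c := Real.sqrt_pos.mpr hc
  apply mul_left_cancel₀ (neg_ne_zero.mpr hπ.ne')
  rw [h4]
  simp only [Pi.inv_apply, hsq]
  generalize (∑' l : ℤ, (l : ℝ) ^ 2 * Real.exp (-Real.pi / c * (l : ℝ) ^ 2) *
        Real.cos (2 * Real.pi * l * ω)) = S₂
  generalize (∑' l : ℤ, Real.exp (-Real.pi / c * (l : ℝ) ^ 2) *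
        Real.cos (2 * Real.pi * l * ω)) = S₁
  field_simp
  ring

/-- The summand of the partially Poisson-summed energy. -/
noncomputable def kernel (A B : ℝ) (p : ℤ × ℤ) : ℝ :=
  Real.exp (-A * (p.1 : ℝ) ^ 2 - B * (p.2 : ℝ) ^ 2) *
    (A * (p.1 : ℝ) ^ 2 + 1 / 2 - B * (p.2 : ℝ) ^ 2)

theorem abs_kernel_le {A B : ℝ} (hA : 0 < A) (hB : 0 < B) (p : ℤ × ℤ) :
    |kernel A B p| ≤ 3 * Real.exp (-(A / 2) * (p.1 : ℝ) ^ 2 - (B / 2) * (p.2 : ℝ) ^ 2) := by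
  unfold kernel
  rw [abs_mul, Real.abs_exp]
  set t := A * (p.1 : ℝ) ^ 2 + B * (p.2 : ℝ) ^ 2 with ht
  have h0 : 0 ≤ A * (p.1 : ℝ) ^ 2 := by positivity
  have h0' : 0 ≤ B * (p.2 : ℝ) ^ 2 := by positivity
  have h1 : |A * (p.1 : ℝ) ^ 2 + 1 / 2 - B * (p.2 : ℝ) ^ 2| ≤ t + 1 := by
    rw [abs_le]; constructor <;> linarith
  have h2 := mul_exp_neg_le t
  have e1 : -A * (p.1 : ℝ) ^ 2 - B * (p.2 : ℝ) ^ 2 = -t := by rw [ht]; ring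
  have e2 : -(A / 2) * (p.1 : ℝ) ^ 2 - (B / 2) * (p.2 : ℝ) ^ 2 = -t / 2 := by rw [ht]; ring
  rw [e1, e2]
  have h3 : Real.exp (-t) ≤ Real.exp (-t / 2) := Real.exp_le_exp.mpr (by linarith)
  nlinarith [Real.exp_pos (-t)]

theorem summable_kernel {A B : ℝ} (hA : 0 < A) (hB : 0 < B) :
    Summable fun p : ℤ × ℤ => |kernel A B p| :=
  Summable.of_nonneg_of_le (fun _ => abs_nonneg _) (abs_kernel_le hA hB)
    ((summable_exp_neg_int_prod (half_pos hA) (half_pos hB)).mul_left 3)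

theorem summable_kernel_mul_cos {A B : ℝ} (hA : 0 < A) (hB : 0 < B) (x : ℝ) :
    Summable fun p : ℤ × ℤ => kernel A B p * Real.cos (2 * Real.pi * (p.1 * p.2) * x) := by
  refine Summable.of_norm_bounded (summable_kernel hA hB) fun p => ?_
  rw [norm_mul, Real.norm_eq_abs, Real.norm_eq_abs]
  exact mul_le_of_le_one_right (abs_nonneg _) (Real.abs_cos_le_one _)

/-- For fixed m the summand is a Gaussian in n + mx, with and without the factor (n + mx)². Poisson
summation with c = α/y and shift mx produces the phases 2πmlx, and the two contributions combine
into `kernel`. -/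
theorem energy_eq_tsum_kernel {α x y : ℝ} (hα : 0 < α) (hy : 0 < y) :
    energy α x y = √(y / α) / (Real.pi * α) * ∑' p : ℤ × ℤ,
      kernel (Real.pi * α * y) (Real.pi * y / α) p *
        Real.cos (2 * Real.pi * (p.1 * p.2) * x) := by
  have hπ := Real.pi_pos
  unfold energy
  rw [(summable_energy hα hy).tsum_prod,
    (summable_kernel_mul_cos (by positivity) (by positivity) x).tsum_prod, ← tsum_mul_left]
  congr 1
  ext m
  have hc : 0 < α / y := by positivity
  have p1 := tsum_exp_neg_sq_shift hc (m * x)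
  have p2 := tsum_sq_mul_exp_neg_sq_shift hc (m * x)
  set c := α / y with hcdef
  have hcy : c * y = α := by rw [hcdef]; field_simp
  have s1 : Summable fun n : ℤ => Real.exp (-Real.pi * c * ((n : ℝ) + m * x) ^ 2) := by
    have := summable_exp_neg_sq_shift (a := Real.pi * c) (by positivity) (m * x)
    simpa using this
  have s2 : Summable fun n : ℤ => ((n : ℝ) + m * x) ^ 2 *
      Real.exp (-Real.pi * c * ((n : ℝ) + m * x) ^ 2) := by
    have := (summable_exp_neg_sq_shift (a := Real.pi * c / 2) (by positivity) (m * x)).mul_left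
      (2 / (Real.pi * c))
    refine Summable.of_nonneg_of_le (fun n => by positivity) (fun n => ?_) this
    have := mul_exp_neg_mul_le (a := Real.pi * c) (s := ((n : ℝ) + m * x) ^ 2) (by positivity)
    simpa using this
  have s3 : Summable fun l : ℤ => Real.exp (-Real.pi / c * (l : ℝ) ^ 2) *
        Real.cos (2 * Real.pi * l * (m * x)) := by
    have := summable_exp_neg_mul_int_sq (a := Real.pi / c) (by positivity)
    refine Summable.of_norm_bounded this fun l => ?_
    rw [norm_mul, Real.norm_eq_abs, Real.norm_eq_abs, Real.abs_exp, neg_div]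
    exact mul_le_of_le_one_right (Real.exp_pos _).le (Real.abs_cos_le_one _)
  have s4 : Summable fun l : ℤ => (l : ℝ) ^ 2 * Real.exp (-Real.pi / c * (l : ℝ) ^ 2) *
        Real.cos (2 * Real.pi * l * (m * x)) := by
    have := (summable_exp_neg_mul_int_sq (a := Real.pi / c / 2) (by positivity)).mul_left
      (2 / (Real.pi / c))
    refine Summable.of_norm_bounded this fun l => ?_
    rw [norm_mul, norm_mul, Real.norm_eq_abs, Real.norm_eq_abs, Real.norm_eq_abs, Real.abs_exp,
      abs_of_nonneg (sq_nonneg _), neg_div]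
    have := mul_exp_neg_mul_le (a := Real.pi / c) (s := (l : ℝ) ^ 2) (by positivity)
    exact (mul_le_of_le_one_right (by positivity) (Real.abs_cos_le_one _)).trans this
  have lhs : ∀ n : ℤ, quadForm x y (m, n) * Real.exp (-Real.pi * α * quadForm x y (m, n)) =
      Real.exp (-(Real.pi * α * y) * (m : ℝ) ^ 2) *
      ((1 / y) * (((n : ℝ) + m * x) ^ 2 * Real.exp (-Real.pi * c * ((n : ℝ) + m * x) ^ 2)) +
        (m : ℝ) ^ 2 * y * Real.exp (-Real.pi * c * ((n : ℝ) + m * x) ^ 2)) := by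
    intro n
    have e : Real.exp (-Real.pi * α * quadForm x y (m, n)) =
        Real.exp (-(Real.pi * α * y) * (m : ℝ) ^ 2) *
          Real.exp (-Real.pi * c * ((n : ℝ) + m * x) ^ 2) := by
      rw [← Real.exp_add]; congr 1
      rw [hcdef]; unfold quadForm; field_simp; ring
    rw [e]
    unfold quadForm
    field_simp
    ring
  have rhs : ∀ l : ℤ, kernel (Real.pi * α * y) (Real.pi * y / α) (m, l) *
        Real.cos (2 * Real.pi * ((m : ℝ) * l) * x) =
      Real.exp (-(Real.pi * α * y) * (m : ℝ) ^ 2) *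
      ((Real.pi * α * y * (m : ℝ) ^ 2 + 1 / 2) * (Real.exp (-Real.pi / c * (l : ℝ) ^ 2) *
        Real.cos (2 * Real.pi * l * (m * x))) -
        Real.pi * y / α * ((l : ℝ) ^ 2 * Real.exp (-Real.pi / c * (l : ℝ) ^ 2) *
        Real.cos (2 * Real.pi * l * (m * x)))) := by
    intro l
    have e : Real.exp (-(Real.pi * α * y) * (m : ℝ) ^ 2 - Real.pi * y / α * (l : ℝ) ^ 2) =
        Real.exp (-(Real.pi * α * y) * (m : ℝ) ^ 2) * Real.exp (-Real.pi / c * (l : ℝ) ^ 2) := by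
      rw [← Real.exp_add]; congr 1
      rw [hcdef]; field_simp; ring
    unfold kernel
    simp only
    rw [e, show 2 * Real.pi * ((m : ℝ) * l) * x = 2 * Real.pi * l * (m * x) by ring]
    ring
  simp_rw [lhs, rhs]
  rw [tsum_mul_left, (s2.mul_left _).tsum_add (s1.mul_left _), tsum_mul_left, tsum_mul_left,
    tsum_mul_left, (s3.mul_left _).tsum_sub (s4.mul_left _), tsum_mul_left, tsum_mul_left, p1, p2]
  have hs : √(y / α) = (√c)⁻¹ := by rw [hcdef, ← Real.sqrt_inv, inv_div]
  rw [hs]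
  generalize (∑' l : ℤ, (l : ℝ) ^ 2 * Real.exp (-Real.pi / c * (l : ℝ) ^ 2) *
        Real.cos (2 * Real.pi * l * (m * x))) = S₂
  generalize (∑' l : ℤ, Real.exp (-Real.pi / c * (l : ℝ) ^ 2) *
        Real.cos (2 * Real.pi * l * (m * x))) = S₁
  rw [hcdef]
  field_simp
  ring

/-! ### Reduction to positive indices -/

theorem tsum_int_of_even {f : ℤ → ℝ} (hf : f.Even) (hs : Summable f) :
    ∑' n, f n = f 0 + 2 * ∑' n : ℕ, f (n + 1) := by
  rw [tsum_int_eq_zero_add_two_mul_tsum_pnat hf hs,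
    tsum_pnat_eq_tsum_succ (f := fun n : ℕ => f n)]
  simp

theorem tsum_int_prod_of_even {g : ℤ × ℤ → ℝ} (h1 : ∀ m l, g (-m, l) = g (m, l))
    (h2 : ∀ m l, g (m, -l) = g (m, l)) (hs : Summable g) :
    ∑' p, g p = g (0, 0) + 2 * (∑' j : ℕ, g (0, (j : ℤ) + 1)) +
      2 * (∑' i : ℕ, g ((i : ℤ) + 1, 0)) +
      4 * ∑' q : ℕ × ℕ, g ((q.1 : ℤ) + 1, (q.2 : ℤ) + 1) := by
  have hrow : ∀ m, Summable fun l => g (m, l) := fun m => hs.prod_factor m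
  have hout : Summable fun m => ∑' l, g (m, l) := hs.prod
  have hinj : Function.Injective fun i : ℕ => (i : ℤ) + 1 := fun a b h => by simpa using h
  have hQ : Summable fun q : ℕ × ℕ => g ((q.1 : ℤ) + 1, (q.2 : ℤ) + 1) :=
    hs.comp_injective (hinj.prodMap hinj)
  have hA : Summable fun i : ℕ => g ((i : ℤ) + 1, 0) :=
    hs.comp_injective (i := fun i : ℕ => ((i : ℤ) + 1, (0 : ℤ))) fun a b h => by simpa using h
  rw [hs.tsum_prod, tsum_int_of_even (fun m => by simp_rw [h1]) hout, hQ.tsum_prod]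
  have hr : ∀ m, ∑' l, g (m, l) = g (m, 0) + 2 * ∑' j : ℕ, g (m, (j : ℤ) + 1) := fun m =>
    tsum_int_of_even (fun l => h2 m l) (hrow m)
  simp_rw [hr]
  rw [hA.tsum_add (hQ.prod.mul_left 2), tsum_mul_left]
  ring

/-- The normalised coefficient of `cos (2 π (i + 1) (j + 1) x)` in the energy. -/
noncomputable def coeff (A B : ℝ) (q : ℕ × ℕ) : ℝ :=
  Real.exp (-(A * (((q.1 : ℝ) + 1) ^ 2 - 1)) - B * (((q.2 : ℝ) + 1) ^ 2 - 1)) *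
    (B * ((q.2 : ℝ) + 1) ^ 2 - A * ((q.1 : ℝ) + 1) ^ 2 - 1 / 2)

theorem kernel_succ (A B : ℝ) (q : ℕ × ℕ) :
    kernel A B ((q.1 : ℤ) + 1, (q.2 : ℤ) + 1) = -(Real.exp (-A - B) * coeff A B q) := by
  unfold kernel coeff
  rw [← mul_assoc, ← Real.exp_add, ← mul_neg]
  push_cast
  congr 2 <;> ring

/-- The frequency `(i + 1) (j + 1)` attached to a pair of indices. -/
def freq (q : ℕ × ℕ) : ℕ := (q.1 + 1) * (q.2 + 1)

theorem freq_cast (q : ℕ × ℕ) : (freq q : ℝ) = ((q.1 : ℝ) + 1) * ((q.2 : ℝ) + 1) := by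
  unfold freq; push_cast; ring

theorem summable_coeff {A B : ℝ} (hA : 0 < A) (hB : 0 < B) :
    Summable fun q : ℕ × ℕ => |coeff A B q| := by
  have hinj : Function.Injective fun i : ℕ => (i : ℤ) + 1 := fun a b h => by simpa using h
  have := ((summable_kernel hA hB).comp_injective (hinj.prodMap hinj)).mul_left (Real.exp (A + B))
  refine this.congr fun q => ?_
  simp only [Function.comp, Prod.map]
  rw [kernel_succ A B q, abs_neg, abs_mul, Real.abs_exp, ← mul_assoc, ← Real.exp_add]
  ring_nf
  simp

theorem summable_coeff_mul_of_bounded {A B C : ℝ} (hA : 0 < A) (hB : 0 < B) {u : ℕ × ℕ → ℝ}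
    (hu : ∀ q, |u q| ≤ C) : Summable fun q => coeff A B q * u q := by
  refine Summable.of_norm_bounded ((summable_coeff hA hB).mul_right C) fun q => ?_
  rw [norm_mul, Real.norm_eq_abs, Real.norm_eq_abs]
  exact mul_le_mul_of_nonneg_left (hu q) (abs_nonneg _)

theorem tsum_kernel_eq {A B : ℝ} (hA : 0 < A) (hB : 0 < B) (x : ℝ) :
    ∑' p : ℤ × ℤ, kernel A B p * Real.cos (2 * Real.pi * (p.1 * p.2) * x) =
      1 / 2 + 2 * (∑' j : ℕ, kernel A B (0, (j : ℤ) + 1)) +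
        2 * (∑' i : ℕ, kernel A B ((i : ℤ) + 1, 0)) -
        4 * Real.exp (-A - B) *
          ∑' q : ℕ × ℕ, coeff A B q * Real.cos (2 * Real.pi * freq q * x) := by
  rw [tsum_int_prod_of_even _ _ (summable_kernel_mul_cos hA hB x)]
  · have h : ∀ q : ℕ × ℕ, kernel A B ((q.1 : ℤ) + 1, (q.2 : ℤ) + 1) *
        Real.cos (2 * Real.pi * ((((q.1 : ℤ) + 1 : ℤ) : ℝ) * (((q.2 : ℤ) + 1 : ℤ) : ℝ)) * x) =
        -Real.exp (-A - B) * (coeff A B q * Real.cos (2 * Real.pi * freq q * x)) := by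
      intro q
      rw [kernel_succ, freq_cast]
      push_cast
      ring
    simp_rw [h]
    rw [tsum_mul_left]
    have h0 : kernel A B (0, 0) = 1 / 2 := by simp [kernel]
    simp [h0]
    ring
  · intro m l
    simp only [kernel]
    push_cast
    rw [neg_sq, show 2 * Real.pi * (-(m : ℝ) * l) * x = -(2 * Real.pi * (m * l) * x) by ring,
      Real.cos_neg]
  · intro m l
    simp only [kernel]
    push_cast
    rw [neg_sq, show 2 * Real.pi * ((m : ℝ) * -l) * x = -(2 * Real.pi * (m * l) * x) by ring,
      Real.cos_neg]

/-- The terms with m = 0 or l = 0 do not depend on x and cancel; the positive constant absorbs the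
prefactor and the normalisation e^{-A-B} of `coeff`. -/
theorem energy_sub_energy {α x x' y : ℝ} (hα : 0 < α) (hy : 0 < y) :
    ∃ C > 0, energy α x y - energy α x' y = C * ∑' q : ℕ × ℕ,
      coeff (Real.pi * α * y) (Real.pi * y / α) q *
        (Real.cos (2 * Real.pi * freq q * x') - Real.cos (2 * Real.pi * freq q * x)) := by
  have hπ := Real.pi_pos
  have hA : 0 < Real.pi * α * y := by positivity
  have hB : 0 < Real.pi * y / α := by positivity
  refine ⟨√(y / α) / (Real.pi * α) * (4 * Real.exp (-(Real.pi * α * y) - Real.pi * y / α)),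
    by positivity, ?_⟩
  rw [energy_eq_tsum_kernel hα hy, energy_eq_tsum_kernel hα hy, tsum_kernel_eq hA hB,
    tsum_kernel_eq hA hB]
  have hs : ∀ x, Summable fun q : ℕ × ℕ => coeff (Real.pi * α * y) (Real.pi * y / α) q *
      Real.cos (2 * Real.pi * freq q * x) := fun x =>
    summable_coeff_mul_of_bounded hA hB fun q => Real.abs_cos_le_one _
  simp_rw [mul_sub]
  rw [(hs x').tsum_sub (hs x)]
  ring

/-! ### Divided differences of Chebyshev polynomials -/

theorem abs_sin_nat_mul_le (k : ℕ) (s : ℝ) : |Real.sin (k * s)| ≤ k * |Real.sin s| := by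
  induction k with
  | zero => simp
  | succ k ih =>
    push_cast
    rw [add_mul, one_mul, Real.sin_add]
    calc _ ≤ |Real.sin (k * s) * Real.cos s| + |Real.cos (k * s) * Real.sin s| := abs_add_le _ _
      _ ≤ |Real.sin (k * s)| * 1 + 1 * |Real.sin s| := by
        rw [abs_mul, abs_mul]; gcongr <;> exact Real.abs_cos_le_one _
      _ ≤ _ := by linarith

/-- The product formula for a difference of cosines reduces this to |sin kθ| ≤ k |sin θ|, used
twice. -/
theorem abs_cos_nat_mul_sub_le (k : ℕ) (a b : ℝ) :
    |Real.cos (k * a) - Real.cos (k * b)| ≤ k ^ 2 * |Real.cos a - Real.cos b| := by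
  rw [Real.cos_sub_cos, Real.cos_sub_cos, ← mul_add, ← mul_sub, mul_div_assoc, mul_div_assoc,
    abs_mul, abs_mul, abs_mul, abs_mul]
  have h1 := abs_sin_nat_mul_le k ((a + b) / 2)
  have h2 := abs_sin_nat_mul_le k ((a - b) / 2)
  calc _ ≤ |(-2 : ℝ)| * (k * |Real.sin ((a + b) / 2)|) * (k * |Real.sin ((a - b) / 2)|) := by
        gcongr
    _ = _ := by ring

theorem one_sub_cos_nat_mul_le (k : ℕ) (a : ℝ) :
    1 - Real.cos (k * a) ≤ k ^ 2 * (1 - Real.cos a) := by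
  have := abs_cos_nat_mul_sub_le k 0 a
  rw [mul_zero, Real.cos_zero, abs_of_nonneg (by linarith [Real.cos_le_one (k * a)]),
    abs_of_nonneg (by linarith [Real.cos_le_one a])] at this
  exact this

/-- The divided difference of the `k`-th Chebyshev polynomial at `cos a`, `cos b`. -/
noncomputable def chebDiff (k : ℕ) (a b : ℝ) : ℝ :=
  (Real.cos (k * a) - Real.cos (k * b)) / (Real.cos a - Real.cos b)

/-- This is the bound |T_k'| ≤ k² on [-1, 1] in divided form. No hypothesis on a, b is needed, since
the quotient is 0 when the cosines agree. -/
theorem abs_chebDiff_le (k : ℕ) (a b : ℝ) : |chebDiff k a b| ≤ k ^ 2 := by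
  unfold chebDiff
  rw [abs_div]
  exact div_le_of_le_mul₀ (abs_nonneg _) (by positivity) (abs_cos_nat_mul_sub_le k a b)

theorem chebDiff_rec (k : ℕ) {a b : ℝ} (h : Real.cos a ≠ Real.cos b) :
    chebDiff (k + 2) a b =
      2 * Real.cos b * chebDiff (k + 1) a b + 2 * Real.cos ((k + 1 : ℕ) * a) - chebDiff k a b := by
  have h' : Real.cos a - Real.cos b ≠ 0 := sub_ne_zero.mpr h
  have e : ∀ t : ℝ, Real.cos ((k + 2 : ℕ) * t) =
      2 * Real.cos t * Real.cos ((k + 1 : ℕ) * t) - Real.cos (k * t) := by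
    intro t
    have h1 : ((k + 2 : ℕ) : ℝ) * t = (k + 1 : ℕ) * t + t := by push_cast; ring
    have h2 : (k : ℝ) * t = (k + 1 : ℕ) * t - t := by push_cast; ring
    rw [h1, h2, Real.cos_add, Real.cos_sub]; ring
  unfold chebDiff
  rw [e, e]
  field_simp
  ring

theorem chebDiff_one {a b : ℝ} (h : Real.cos a ≠ Real.cos b) : chebDiff 1 a b = 1 := by
  simp [chebDiff, div_self (sub_ne_zero.mpr h)]

theorem chebDiff_two {a b : ℝ} (h : Real.cos a ≠ Real.cos b) :
    chebDiff 2 a b = 2 * (Real.cos a + Real.cos b) := by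
  have := chebDiff_rec 0 h
  rw [zero_add, zero_add, chebDiff_one h] at this
  rw [this]; simp [chebDiff]; ring

/-- Quantifies how far the divided difference is from its value k² at the confluent point cos a =
cos b = 1. By the three-term recursion, the second difference of the defect is 2(1 - cos((k+1)a)) +
2(1 - cos b) D_{k+1} ≤ 2(k+1)²Δ, where D is the divided difference; summing twice gives k²(k² -
1)Δ/6. -/
theorem sq_sub_chebDiff_le {a b : ℝ} (h : Real.cos a ≠ Real.cos b) (k : ℕ) :
    (k : ℝ) ^ 2 - chebDiff k a b ≤ (k : ℝ) ^ 4 / 6 * (2 - Real.cos a - Real.cos b) := by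
  set Δ := 2 - Real.cos a - Real.cos b with hΔ
  have hb : 0 ≤ 1 - Real.cos b := by linarith [Real.cos_le_one b]
  have hΔ0 : 0 ≤ Δ := by linarith [Real.cos_le_one a]
  have step : ∀ k : ℕ, ((k + 1 : ℝ) ^ 2 - chebDiff (k + 1) a b) - ((k : ℝ) ^ 2 - chebDiff k a b) ≤
      (k : ℝ) * (k + 1) * (2 * k + 1) / 3 * Δ := by
    intro k
    induction k with
    | zero =>
      have h0 : chebDiff 0 a b = 0 := by simp [chebDiff]
      simp [chebDiff_one h, h0]
    | succ k ih =>
      rw [chebDiff_rec k h]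
      have h1 := one_sub_cos_nat_mul_le (k + 1) a
      have h2 := (abs_le.mp (abs_chebDiff_le (k + 1) a b)).2
      have h3 := mul_le_mul_of_nonneg_left h2 hb
      push_cast at h1 h2 h3 ⊢
      nlinarith
  have main : (k : ℝ) ^ 2 - chebDiff k a b ≤ (k : ℝ) ^ 2 * (k ^ 2 - 1) / 6 * Δ := by
    induction k with
    | zero => simp [chebDiff]
    | succ k ih =>
      have := step k
      push_cast
      nlinarith
  refine main.trans (mul_le_mul_of_nonneg_right ?_ hΔ0)
  nlinarith [sq_nonneg (k : ℝ)]

/-! ### Gaussian tails and splitting of double series -/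

theorem exp_ge_sum_range {x : ℝ} (hx : 0 ≤ x) (n : ℕ) {c : ℝ}
    (h : c ≤ ∑ i ∈ Finset.range n, x ^ i / i.factorial) : c ≤ Real.exp x :=
  h.trans (Real.sum_le_exp_of_nonneg hx n)

/-- If `c` is below a Taylor polynomial of `exp x`, then `exp (-t) ≤ c⁻¹` for all `t ≥ x`. -/
theorem exp_neg_le_of_le {x t c : ℝ} (n : ℕ) (hx : 0 ≤ x) (hc : 0 < c) (ht : x ≤ t)
    (h : c ≤ ∑ i ∈ Finset.range n, x ^ i / i.factorial) : Real.exp (-t) ≤ c⁻¹ := by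
  rw [Real.exp_neg]
  exact inv_anti₀ hc ((exp_ge_sum_range hx n h).trans (Real.exp_le_exp.mpr ht))

/-- Since (i + 3)² - 1 ≥ 8 + 7i and e^{-7P} ≤ 1/3600, while the power grows by a factor at most 6
per step, the tail is dominated by its first term times a geometric series of ratio 6/3600. -/
theorem gaussian_term_le {P : ℝ} (hP : 6 / 5 ≤ P) {n : ℕ} (hn : n ≤ 6) (i : ℕ) :
    ((i : ℝ) + 3) ^ n * Real.exp (-(P * (((i : ℝ) + 3) ^ 2 - 1))) ≤
      3 ^ n * Real.exp (-(8 * P)) * (1 / 600 : ℝ) ^ i := by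
  have h1 : ((i : ℝ) + 3) ^ n ≤ 3 ^ n * 6 ^ i := by
    have h6 : (1 + (i : ℝ) / 3) ^ 6 ≤ 6 ^ i := by
      induction i with
      | zero => simp
      | succ i ih =>
        -- The first step needs (4/3)⁶ < 6; afterwards successive ratios are at most 5/4.
        rcases Nat.eq_zero_or_pos i with rfl | hi
        · norm_num
        · have hi1 : (1 : ℝ) ≤ i := by exact_mod_cast hi
          have : 1 + ((i + 1 : ℕ) : ℝ) / 3 ≤ (5 / 4) * (1 + (i : ℝ) / 3) := by
            push_cast; linarith
          calc (1 + ((i + 1 : ℕ) : ℝ) / 3) ^ 6 ≤ ((5 / 4) * (1 + (i : ℝ) / 3)) ^ 6 := by gcongr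
            _ = (5 / 4) ^ 6 * (1 + (i : ℝ) / 3) ^ 6 := by rw [mul_pow]
            _ ≤ 6 * 6 ^ i := by gcongr; norm_num
            _ = _ := by ring
    have h7 : (1 + (i : ℝ) / 3) ^ n ≤ (1 + (i : ℝ) / 3) ^ 6 :=
      pow_le_pow_right₀ (by have : (0 : ℝ) ≤ i := by positivity
                            linarith) hn
    calc ((i : ℝ) + 3) ^ n = 3 ^ n * (1 + (i : ℝ) / 3) ^ n := by rw [← mul_pow]; congr 1; ring
      _ ≤ _ := by gcongr; exact h7.trans h6
  have h2 : Real.exp (-(P * (((i : ℝ) + 3) ^ 2 - 1))) ≤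
      Real.exp (-(8 * P)) * (1 / 3600 : ℝ) ^ i := by
    have h3 : Real.exp (-(7 * P)) ≤ 1 / 3600 := by
      have := exp_neg_le_of_le (x := 42 / 5) (t := 7 * P) (c := 3600) 14 (by norm_num)
        (by norm_num) (by linarith) (by norm_num [Finset.sum_range_succ, Nat.factorial])
      simpa using this
    calc _ ≤ Real.exp (-(8 * P) + i * (-(7 * P))) := by
          apply Real.exp_le_exp.mpr
          have : (i : ℝ) ≤ (i : ℝ) ^ 2 := by exact_mod_cast Nat.le_self_pow two_ne_zero i
          nlinarith
      _ = Real.exp (-(8 * P)) * Real.exp (-(7 * P)) ^ i := by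
          rw [Real.exp_add, Real.exp_nat_mul]
      _ ≤ _ := by gcongr
  calc _ ≤ (3 ^ n * 6 ^ i) * (Real.exp (-(8 * P)) * (1 / 3600 : ℝ) ^ i) := by gcongr
    _ = 3 ^ n * Real.exp (-(8 * P)) * (6 * (1 / 3600) : ℝ) ^ i := by rw [mul_pow]; ring
    _ = _ := by norm_num

theorem summable_gaussian_tail {P : ℝ} (hP : 6 / 5 ≤ P) {n : ℕ} (hn : n ≤ 6) :
    Summable fun i : ℕ => ((i : ℝ) + 3) ^ n * Real.exp (-(P * (((i : ℝ) + 3) ^ 2 - 1))) :=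
  Summable.of_nonneg_of_le (fun i => by positivity) (gaussian_term_le hP hn)
    ((summable_geometric_of_lt_one (by norm_num) (by norm_num)).mul_left _)

theorem tsum_gaussian_tail_le {P : ℝ} (hP : 6 / 5 ≤ P) {n : ℕ} (hn : n ≤ 6) :
    ∑' i : ℕ, ((i : ℝ) + 3) ^ n * Real.exp (-(P * (((i : ℝ) + 3) ^ 2 - 1))) ≤
      501 / 500 * 3 ^ n * Real.exp (-(8 * P)) := by
  have hg := summable_geometric_of_lt_one (r := (1 / 600 : ℝ)) (by norm_num) (by norm_num)
  refine ((summable_gaussian_tail hP hn).tsum_le_tsum (gaussian_term_le hP hn)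
    (hg.mul_left _)).trans ?_
  rw [tsum_mul_left, tsum_geometric_of_lt_one (by norm_num) (by norm_num)]
  have : 0 < 3 ^ n * Real.exp (-(8 * P)) := by positivity
  linarith

theorem summable_gaussian_two {P : ℝ} (hP : 6 / 5 ≤ P) {n : ℕ} (hn : n ≤ 6) :
    Summable fun i : ℕ => ((i : ℝ) + 2) ^ n * Real.exp (-(P * (((i : ℝ) + 2) ^ 2 - 1))) := by
  rw [← summable_nat_add_iff 1]
  refine (summable_gaussian_tail hP hn).congr fun i => ?_
  push_cast
  rw [show (i : ℝ) + 1 + 2 = i + 3 by ring]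

theorem tsum_gaussian_two_le {P : ℝ} (hP : 6 / 5 ≤ P) {n : ℕ} (hn : n ≤ 6) :
    ∑' i : ℕ, ((i : ℝ) + 2) ^ n * Real.exp (-(P * (((i : ℝ) + 2) ^ 2 - 1))) ≤
      2 ^ n * Real.exp (-(3 * P)) + 501 / 500 * 3 ^ n * Real.exp (-(8 * P)) := by
  rw [(summable_gaussian_two hP hn).tsum_eq_zero_add]
  have h := tsum_gaussian_tail_le hP hn
  have e : ∀ i : ℕ, ((i : ℝ) + 3) = ((i + 1 : ℕ) : ℝ) + 2 := fun i => by push_cast; ring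
  simp_rw [e] at h
  have e2 : -(P * (((0 : ℕ) + 2 : ℝ) ^ 2 - 1)) = -(3 * P) := by push_cast; ring
  rw [e2]
  push_cast at h ⊢
  rw [zero_add]
  linarith

/-- Splitting off the three leading terms of a double series. -/
theorem abs_tsum_sub_leading_le {a : ℕ × ℕ → ℝ} (ha : Summable a) {U V W₁ W₂ : ℕ → ℝ}
    (hU : Summable U) (hV : Summable V) (hW₁ : Summable W₁) (hW₂ : Summable W₂)
    (h1 : ∀ i : ℕ, |a (i + 2, 0)| ≤ U i) (h2 : ∀ j : ℕ, |a (0, j + 2)| ≤ V j)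
    (h3 : ∀ i j : ℕ, |a (i + 1, j + 1)| ≤ W₁ i * W₂ j)
    (hW₁0 : ∀ i, 0 ≤ W₁ i) (hW₂0 : ∀ i, 0 ≤ W₂ i) :
    |∑' q, a q - a (0, 0) - (a (1, 0) + a (0, 1))| ≤
      ∑' i, U i + ∑' j, V j + (∑' i, W₁ i) * ∑' j, W₂ j := by
  have hcol0 : Summable fun i : ℕ => a (i, 0) :=
    ha.comp_injective (i := fun i : ℕ => (i, 0)) fun x y h => by simpa using h
  have hrow0 : Summable fun j : ℕ => a (0, j) := ha.prod_factor 0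
  have hsh : Summable fun q : ℕ × ℕ => a (q.1 + 1, q.2 + 1) :=
    ha.comp_injective (i := fun q : ℕ × ℕ => (q.1 + 1, q.2 + 1)) fun x y h => by
      simpa [Prod.ext_iff] using h
  have hcol1 : Summable fun i : ℕ => a (i + 1, 0) := (summable_nat_add_iff 1).mpr hcol0
  have hWW : Summable fun q : ℕ × ℕ => W₁ q.1 * W₂ q.2 := hW₁.mul_of_nonneg hW₂ hW₁0 hW₂0
  have e1 : ∑' q, a q = ∑' j, a (0, j) + (∑' i, a (i + 1, 0) +
      ∑' q : ℕ × ℕ, a (q.1 + 1, q.2 + 1)) := by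
    rw [ha.tsum_prod, ha.prod.tsum_eq_zero_add]
    congr 1
    rw [hsh.tsum_prod, ← hcol1.tsum_add hsh.prod]
    congr 1
    ext i
    exact (ha.prod_factor (i + 1)).tsum_eq_zero_add
  have e2 : ∑' j, a (0, j) = a (0, 0) + (a (0, 1) + ∑' j, a (0, j + 2)) := by
    rw [hrow0.tsum_eq_zero_add, ((summable_nat_add_iff 1).mpr hrow0).tsum_eq_zero_add]
  have e3 : ∑' i, a (i + 1, 0) = a (1, 0) + ∑' i, a (i + 2, 0) := hcol1.tsum_eq_zero_add
  have b1 : |∑' i, a (i + 2, 0)| ≤ ∑' i, U i := by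
    exact tsum_of_norm_bounded (f := fun i => a (i + 2, 0)) hU.hasSum h1
  have b2 : |∑' j, a (0, j + 2)| ≤ ∑' j, V j := by
    exact tsum_of_norm_bounded (f := fun j => a (0, j + 2)) hV.hasSum h2
  have b3 : |∑' q : ℕ × ℕ, a (q.1 + 1, q.2 + 1)| ≤ (∑' i, W₁ i) * ∑' j, W₂ j := by
    rw [hW₁.tsum_mul_tsum hW₂ hWW]
    exact tsum_of_norm_bounded (f := fun q : ℕ × ℕ => a (q.1 + 1, q.2 + 1)) hWW.hasSum
      fun q => h3 q.1 q.2
  rw [e1, e2, e3]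
  calc _ = |∑' i, a (i + 2, 0) + ∑' j, a (0, j + 2) +
        ∑' q : ℕ × ℕ, a (q.1 + 1, q.2 + 1)| := by congr 1; ring
    _ ≤ |∑' i, a (i + 2, 0)| + |∑' j, a (0, j + 2)| +
        |∑' q : ℕ × ℕ, a (q.1 + 1, q.2 + 1)| := abs_add_three _ _ _
    _ ≤ _ := by linarith

/-! ### The slope of the energy in the horizontal direction -/

/-- The alternating double series `∑ (-1) ^ (k + 1) τ k * coeff`, `k = (i + 1) (j + 1)`. -/
noncomputable def harmonicSum (A B : ℝ) (τ : ℕ → ℝ) : ℝ :=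
  ∑' q : ℕ × ℕ, coeff A B q * ((-1) ^ (freq q + 1) * τ (freq q))

/-- Up to a positive factor, the difference quotient of the energy with respect to
`cos (2 π x)` between the abscissae `1 / 2 - a / (2 π)` and `1 / 2 - b / (2 π)`. -/
noncomputable def slope (A B a b : ℝ) : ℝ :=
  harmonicSum A B fun k => chebDiff k a b

theorem energy_half_sub {α q q' y : ℝ} (hα : 0 < α) (hy : 0 < y)
    (h : Real.cos (2 * Real.pi * q) ≠ Real.cos (2 * Real.pi * q')) :
    ∃ C > 0, energy α (1 / 2 - q) y - energy α (1 / 2 - q') y =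
      C * ((Real.cos (2 * Real.pi * q) - Real.cos (2 * Real.pi * q')) *
        slope (Real.pi * α * y) (Real.pi * y / α) (2 * Real.pi * q) (2 * Real.pi * q')) := by
  obtain ⟨C, hC, e⟩ := energy_sub_energy (x := 1 / 2 - q) (x' := 1 / 2 - q') hα hy
  refine ⟨C, hC, ?_⟩
  rw [e]
  congr 1
  unfold slope harmonicSum
  rw [← tsum_mul_left]
  congr 1
  ext p
  have h' : Real.cos (2 * Real.pi * q) - Real.cos (2 * Real.pi * q') ≠ 0 := sub_ne_zero.mpr h
  -- Measuring abscissae from 1/2 produces the alternating signs (-1)^k in `harmonicSum`.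
  have hc : ∀ t, Real.cos (2 * Real.pi * freq p * (1 / 2 - t)) =
      (-1) ^ freq p * Real.cos (freq p * (2 * Real.pi * t)) := by
    intro t
    rw [← Real.cos_nat_mul_pi_sub]; congr 1; ring
  rw [hc, hc]
  have e2 : (Real.cos (2 * Real.pi * q) - Real.cos (2 * Real.pi * q')) *
      chebDiff (freq p) (2 * Real.pi * q) (2 * Real.pi * q') =
      Real.cos (freq p * (2 * Real.pi * q)) - Real.cos (freq p * (2 * Real.pi * q')) :=
    mul_div_cancel₀ _ h'
  rw [← mul_sub, ← neg_sub (Real.cos (freq p * (2 * Real.pi * q))), ← e2]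
  ring

theorem abs_coeff_mul_le (A B : ℝ) {τ : ℕ → ℝ} (hτ : ∀ k, |τ k| ≤ (k : ℝ) ^ 2) (q : ℕ × ℕ) :
    |coeff A B q * ((-1) ^ (freq q + 1) * τ (freq q))| ≤ (freq q : ℝ) ^ 2 * |coeff A B q| := by
  rw [abs_mul, abs_mul, abs_pow, abs_neg, abs_one, one_pow, one_mul, mul_comm]
  exact mul_le_mul_of_nonneg_right (hτ _) (abs_nonneg _)

theorem summable_gaussian {P : ℝ} (hP : 6 / 5 ≤ P) {n : ℕ} (hn : n ≤ 6) :
    Summable fun i : ℕ => ((i : ℝ) + 1) ^ n * Real.exp (-(P * (((i : ℝ) + 1) ^ 2 - 1))) := by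
  rw [← summable_nat_add_iff 1]
  refine (summable_gaussian_two hP hn).congr fun i => ?_
  push_cast
  rw [show (i : ℝ) + 1 + 1 = i + 2 by ring]

theorem summable_harmonicSum {A B : ℝ} (hA : 6 / 5 ≤ A) (hB : 6 / 5 ≤ B) {τ : ℕ → ℝ}
    (hτ : ∀ k, |τ k| ≤ (k : ℝ) ^ 2) :
    Summable fun q : ℕ × ℕ => coeff A B q * ((-1) ^ (freq q + 1) * τ (freq q)) := by
  have hs := ((summable_gaussian hA (n := 4) (by norm_num)).mul_of_nonneg
    (summable_gaussian hB (n := 4) (by norm_num)) (fun i => by positivity)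
    (fun i => by positivity)).mul_left (A + B + 1)
  refine Summable.of_norm_bounded hs fun q => (abs_coeff_mul_le A B hτ q).trans ?_
  rw [freq_cast]
  unfold coeff
  rw [abs_mul, Real.abs_exp, sub_eq_add_neg (-(A * _)), Real.exp_add]
  have hm : (1 : ℝ) ≤ ((q.1 : ℝ) + 1) ^ 2 := by
    have : (0 : ℝ) ≤ q.1 := by positivity
    nlinarith
  have hl : (1 : ℝ) ≤ ((q.2 : ℝ) + 1) ^ 2 := by
    have : (0 : ℝ) ≤ q.2 := by positivity
    nlinarith
  generalize (q.1 : ℝ) + 1 = m at *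
  generalize (q.2 : ℝ) + 1 = l at *
  have hb : |B * l ^ 2 - A * m ^ 2 - 1 / 2| ≤ (A + B + 1) * (m ^ 2 * l ^ 2) := by
    have h1 : A * m ^ 2 ≤ A * (m ^ 2 * l ^ 2) := by
      have : m ^ 2 * 1 ≤ m ^ 2 * l ^ 2 := by gcongr
      exact mul_le_mul_of_nonneg_left (by linarith) (by linarith)
    have h2 : B * l ^ 2 ≤ B * (m ^ 2 * l ^ 2) := by
      have : 1 * l ^ 2 ≤ m ^ 2 * l ^ 2 := by gcongr
      exact mul_le_mul_of_nonneg_left (by linarith) (by linarith)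
    have h3 : 1 ≤ m ^ 2 * l ^ 2 := one_le_mul_of_one_le_of_one_le hm hl
    have h4 : 0 ≤ A * m ^ 2 := mul_nonneg (by linarith) (sq_nonneg m)
    have h5 : 0 ≤ B * l ^ 2 := mul_nonneg (by linarith) (sq_nonneg l)
    rw [abs_le]
    constructor <;> linarith
  calc _ ≤ (m * l) ^ 2 * (Real.exp (-(A * (m ^ 2 - 1))) * Real.exp (-(B * (l ^ 2 - 1))) *
        ((A + B + 1) * (m ^ 2 * l ^ 2))) := by gcongr
    _ = _ := by ring

/-- The index pairs (0,0), (1,0), (0,1), of frequencies 1, 2, 2, are kept exactly. The two axes and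
the quadrant of indices at least 1 are majorised by Gaussian sums with rate A only, which is
legitimate since B ≥ A. -/
theorem abs_harmonicSum_sub_le {A B : ℝ} (hA : 6 / 5 ≤ A) (hAB : A ≤ B) {τ : ℕ → ℝ}
    (hτ : ∀ k, |τ k| ≤ (k : ℝ) ^ 2) :
    |harmonicSum A B τ - (B - A - 1 / 2) * τ 1 -
      (Real.exp (-(3 * A)) * (4 * A + 1 / 2 - B) - Real.exp (-(3 * B)) * (4 * B - A - 1 / 2)) *
        τ 2| ≤
      B * (2 * (501 / 500 * 3 ^ 4 * Real.exp (-(8 * A))) +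
        1 / 4 * (2 ^ 4 * Real.exp (-(3 * A)) + 501 / 500 * 3 ^ 4 * Real.exp (-(8 * A))) ^ 2) := by
  have hA0 : 0 < A := by linarith
  have hB0 : 0 < B := by linarith
  set T := ∑' i : ℕ, ((i : ℝ) + 3) ^ 4 * Real.exp (-(A * (((i : ℝ) + 3) ^ 2 - 1))) with hT
  set W := ∑' i : ℕ, ((i : ℝ) + 2) ^ 4 * Real.exp (-(A * (((i : ℝ) + 2) ^ 2 - 1))) with hW
  have hTle : T ≤ 501 / 500 * 3 ^ 4 * Real.exp (-(8 * A)) := tsum_gaussian_tail_le hA (by norm_num)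
  have hWle : W ≤ 2 ^ 4 * Real.exp (-(3 * A)) + 501 / 500 * 3 ^ 4 * Real.exp (-(8 * A)) :=
    tsum_gaussian_two_le hA (by norm_num)
  have hW0 : 0 ≤ W := tsum_nonneg fun i => by positivity
  have sT := summable_gaussian_tail hA (n := 4) (by norm_num)
  have sW := summable_gaussian_two hA (n := 4) (by norm_num)
  have key := abs_tsum_sub_leading_le (summable_harmonicSum hA (hA.trans hAB) hτ)
    (sT.mul_left B) (sT.mul_left B) (sW.mul_left (B / 4)) sW ?_ ?_ ?_ (fun i => by positivity) (fun i => by positivity)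
  · rw [tsum_mul_left, tsum_mul_left, ← hT, ← hW] at key
    have e00 : coeff A B (0, 0) = B - A - 1 / 2 := by simp [coeff]
    have e10 : coeff A B (1, 0) = -(Real.exp (-(3 * A)) * (4 * A + 1 / 2 - B)) := by
      simp only [coeff]
      push_cast
      rw [show -(A * ((1 + 1) ^ 2 - 1)) - B * ((0 + 1) ^ 2 - 1) = -(3 * A) by ring]
      ring
    have e01 : coeff A B (0, 1) = Real.exp (-(3 * B)) * (4 * B - A - 1 / 2) := by
      simp only [coeff]
      push_cast
      congr 2 <;> ring
    have f00 : freq (0, 0) = 1 := rfl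
    have f10 : freq (1, 0) = 2 := rfl
    have f01 : freq (0, 1) = 2 := rfl
    rw [e00, e10, e01, f00, f10, f01] at key
    have e : harmonicSum A B τ - (B - A - 1 / 2) * τ 1 -
        (Real.exp (-(3 * A)) * (4 * A + 1 / 2 - B) - Real.exp (-(3 * B)) * (4 * B - A - 1 / 2)) *
        τ 2 = harmonicSum A B τ -
        (B - A - 1 / 2) * ((-1) ^ (1 + 1) * τ 1) -
        (-(Real.exp (-(3 * A)) * (4 * A + 1 / 2 - B)) *
          ((-1) ^ (2 + 1) * τ 2) +
        Real.exp (-(3 * B)) * (4 * B - A - 1 / 2) *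
          ((-1) ^ (2 + 1) * τ 2)) := by ring
    rw [e]
    refine key.trans ?_
    have h1 : W * W ≤ (2 ^ 4 * Real.exp (-(3 * A)) + 501 / 500 * 3 ^ 4 * Real.exp (-(8 * A))) ^ 2 := by
      rw [sq]; gcongr
    have h2 : B * T ≤ B * (501 / 500 * 3 ^ 4 * Real.exp (-(8 * A))) := by gcongr
    have h3 : B / 4 * W * W ≤ B / 4 *
        (2 ^ 4 * Real.exp (-(3 * A)) + 501 / 500 * 3 ^ 4 * Real.exp (-(8 * A))) ^ 2 := by
      rw [mul_assoc]; gcongr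
    linarith
  · intro i
    refine (abs_coeff_mul_le A B hτ _).trans ?_
    rw [freq_cast]
    simp only [coeff]
    rw [abs_mul, Real.abs_exp]
    push_cast
    have hi : (0 : ℝ) ≤ i := by positivity
    rw [show (i : ℝ) + 2 + 1 = i + 3 by ring]
    have hs : 9 ≤ ((i : ℝ) + 3) ^ 2 := by nlinarith
    have p1 := mul_nonneg (sub_nonneg.mpr hAB) (by linarith : 0 ≤ ((i : ℝ) + 3) ^ 2 - 1)
    have p2 := mul_nonneg hA0.le (by linarith : 0 ≤ ((i : ℝ) + 3) ^ 2 - 1)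
    have hb : |B * ((0 : ℝ) + 1) ^ 2 - A * ((i : ℝ) + 3) ^ 2 - 1 / 2| ≤ B * ((i : ℝ) + 3) ^ 2 := by
      rw [abs_le]; constructor <;> nlinarith
    calc _ ≤ (((i : ℝ) + 3) * (0 + 1)) ^ 2 * (Real.exp (-(A * (((i : ℝ) + 3) ^ 2 - 1)) -
          B * ((0 + 1) ^ 2 - 1)) * (B * ((i : ℝ) + 3) ^ 2)) := by gcongr
      _ = _ := by
        rw [show -(A * (((i : ℝ) + 3) ^ 2 - 1)) - B * ((0 + 1) ^ 2 - 1) =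
          -(A * (((i : ℝ) + 3) ^ 2 - 1)) by ring]
        ring
  · intro i
    refine (abs_coeff_mul_le A B hτ _).trans ?_
    rw [freq_cast]
    simp only [coeff]
    rw [abs_mul, Real.abs_exp]
    push_cast
    have hi : (0 : ℝ) ≤ i := by positivity
    rw [show (i : ℝ) + 2 + 1 = i + 3 by ring]
    have hs : 9 ≤ ((i : ℝ) + 3) ^ 2 := by nlinarith
    have p1 := mul_nonneg (sub_nonneg.mpr hAB) (by linarith : 0 ≤ ((i : ℝ) + 3) ^ 2 - 1)
    have p2 := mul_nonneg hA0.le (by linarith : 0 ≤ ((i : ℝ) + 3) ^ 2 - 1)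
    have hb : |B * ((i : ℝ) + 3) ^ 2 - A * ((0 : ℝ) + 1) ^ 2 - 1 / 2| ≤ B * ((i : ℝ) + 3) ^ 2 := by
      rw [abs_le]; constructor <;> nlinarith
    have hexp : Real.exp (-(A * ((0 + 1) ^ 2 - 1)) - B * (((i : ℝ) + 3) ^ 2 - 1)) ≤
        Real.exp (-(A * (((i : ℝ) + 3) ^ 2 - 1))) := by
      apply Real.exp_le_exp.mpr; nlinarith
    calc _ ≤ ((0 + 1) * ((i : ℝ) + 3)) ^ 2 * (Real.exp (-(A * (((i : ℝ) + 3) ^ 2 - 1))) *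
          (B * ((i : ℝ) + 3) ^ 2)) := by gcongr
      _ = _ := by ring
  · intro i j
    refine (abs_coeff_mul_le A B hτ _).trans ?_
    rw [freq_cast]
    simp only [coeff]
    rw [abs_mul, Real.abs_exp]
    push_cast
    rw [show (i : ℝ) + 1 + 1 = i + 2 by ring, show (j : ℝ) + 1 + 1 = j + 2 by ring]
    have hi : (4 : ℝ) ≤ ((i : ℝ) + 2) ^ 2 := by
      have : (0 : ℝ) ≤ i := by positivity
      nlinarith
    have hj : (4 : ℝ) ≤ ((j : ℝ) + 2) ^ 2 := by
      have : (0 : ℝ) ≤ j := by positivity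
      nlinarith
    generalize hm : ((i : ℝ) + 2) = m at *
    generalize hl : ((j : ℝ) + 2) = l at *
    -- The gain of 1/4 comes from m² ≥ 4 and l² ≥ 4.
    have hb : |B * l ^ 2 - A * m ^ 2 - 1 / 2| ≤ B * (m ^ 2 * l ^ 2) / 4 := by
      have h1 : B * l ^ 2 ≤ B * (m ^ 2 * l ^ 2) / 4 := by
        nlinarith [mul_nonneg hB0.le (sq_nonneg l)]
      have h2 : B * m ^ 2 ≤ B * (m ^ 2 * l ^ 2) / 4 := by
        nlinarith [mul_nonneg hB0.le (sq_nonneg m)]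
      rw [abs_le]; constructor <;> nlinarith
    have hexp : Real.exp (-(A * (m ^ 2 - 1)) - B * (l ^ 2 - 1)) ≤
        Real.exp (-(A * (m ^ 2 - 1))) * Real.exp (-(A * (l ^ 2 - 1))) := by
      rw [← Real.exp_add]
      apply Real.exp_le_exp.mpr; nlinarith
    calc _ ≤ (m * l) ^ 2 * ((Real.exp (-(A * (m ^ 2 - 1))) * Real.exp (-(A * (l ^ 2 - 1)))) *
          (B * (m ^ 2 * l ^ 2) / 4)) := by gcongr
      _ = _ := by ring

theorem abs_slope_sub_le {A B : ℝ} (hA : 6 / 5 ≤ A) (hAB : A ≤ B) {a b : ℝ}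
    (h : Real.cos a ≠ Real.cos b) :
    |slope A B a b - (B - A - 1 / 2) -
      (Real.exp (-(3 * A)) * (4 * A + 1 / 2 - B) - Real.exp (-(3 * B)) * (4 * B - A - 1 / 2)) *
        (2 * (Real.cos a + Real.cos b))| ≤
      B * (2 * (501 / 500 * 3 ^ 4 * Real.exp (-(8 * A))) +
        1 / 4 * (2 ^ 4 * Real.exp (-(3 * A)) + 501 / 500 * 3 ^ 4 * Real.exp (-(8 * A))) ^ 2) := by
  have := abs_harmonicSum_sub_le hA hAB (fun k => abs_chebDiff_le k a b)
  rwa [chebDiff_one h, mul_one, chebDiff_two h] at this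

/-! ### Moving right: negativity of the slope -/

/-- A lower bound for `exp (-t)`, `t ≤ x ≤ 2`, from a Taylor polynomial at `x / 2`. -/
theorem le_exp_neg_of_le {x t c : ℝ} (hx0 : 0 ≤ x) (hx : x ≤ 2) (ht : t ≤ x) (hc : 0 ≤ c)
    (h : c * (∑ m ∈ Finset.range 8, (x / 2) ^ m / m.factorial +
      (x / 2) ^ 8 * (8 + 1) / (Nat.factorial 8 * 8)) ^ 2 ≤ 1) : c ≤ Real.exp (-t) := by
  have h1 := Real.exp_bound' (x := x / 2) (by linarith) (by linarith) (n := 8) (by norm_num)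
  have h2 : Real.exp x = Real.exp (x / 2) ^ 2 := by rw [← Real.exp_nat_mul]; congr 1; push_cast; ring
  have h3 : c * Real.exp x ≤ 1 := by
    rw [h2]
    refine le_trans ?_ h
    have := Real.exp_pos (x / 2)
    push_cast at h1 ⊢
    gcongr
  calc c = c * Real.exp x * Real.exp (-x) := by
        rw [mul_assoc, ← Real.exp_add, add_neg_cancel, Real.exp_zero, mul_one]
    _ ≤ 1 * Real.exp (-x) := by gcongr
    _ ≤ _ := by rw [one_mul]; exact Real.exp_le_exp.mpr (by linarith)

/-- The first condition on c₁ says that A ↦ e^{-κA}(c₀ + c₁A) has nonpositive derivative at A₀; 1 +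
u ≤ e^u propagates the decrease to the right. -/
theorem exp_neg_mul_affine_le {κ A A₀ c₀ c₁ : ℝ} (hA : A₀ ≤ A) (h : c₁ ≤ κ * (c₀ + c₁ * A₀))
    (h0 : 0 ≤ c₀ + c₁ * A₀) :
    Real.exp (-(κ * A)) * (c₀ + c₁ * A) ≤ Real.exp (-(κ * A₀)) * (c₀ + c₁ * A₀) := by
  have e : Real.exp (-(κ * A₀)) = Real.exp (-(κ * A)) * Real.exp (κ * (A - A₀)) := by
    rw [← Real.exp_add]; congr 1; ring
  rw [e, mul_assoc]
  apply mul_le_mul_of_nonneg_left _ (Real.exp_pos _).le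
  have h1 := Real.add_one_le_exp (κ * (A - A₀))
  calc c₀ + c₁ * A ≤ (κ * (A - A₀) + 1) * (c₀ + c₁ * A₀) := by nlinarith
    _ ≤ _ := by gcongr

/-- The sum in `hnum` bounds, in order, the first harmonic, the second (whose divided difference is
at most 4) and all the others. Here d, b and e are upper bounds for B - A, B and e^{-3A₀}, and ε is
a lower bound for e^{-3d}, so that e^{-3B} ≥ ε e^{-3A}. -/
theorem slope_zero_nonpos {A B A₀ d e ε b a : ℝ} (hA₀ : 6 / 5 ≤ A₀) (hA : A₀ ≤ A) (hAB : A ≤ B)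
    (hd : B - A ≤ d) (hb : B ≤ b) (he : Real.exp (-(3 * A₀)) ≤ e) (hε : ε ≤ Real.exp (-(3 * d)))
    (hε0 : 0 ≤ ε) (hε1 : ε ≤ 3 / 5) (he1 : e ≤ 1 / 16) (hd1 : d ≤ 1 / 2)
    (hnum : d - 1 / 2 + 4 * e * (3 * (1 - ε) * A₀ + (1 + ε) / 2 - (1 + 4 * ε) * d) +
      b * (e ^ 2 * (15 + (8 + 15 / 4 * e) ^ 2)) ≤ 0) (ha : Real.cos a ≠ 1) :
    slope A B a 0 ≤ 0 := by
  have hmain := abs_slope_sub_le (hA₀.trans hA) hAB (a := a) (b := 0) (by rwa [Real.cos_zero])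
  have hup := (abs_le.mp hmain).2
  rw [Real.cos_zero] at hup
  set E := Real.exp (-(3 * A)) with hE
  have hE0 : 0 < E := Real.exp_pos _
  have hEe : E ≤ e := le_trans (Real.exp_le_exp.mpr (by linarith)) he
  have h8 : Real.exp (-(8 * A)) ≤ E ^ 2 * (23 / 250) := by
    have h1 : Real.exp (-(2 * A)) ≤ 23 / 250 := by
      have := exp_neg_le_of_le (x := 12 / 5) (t := 2 * A) (c := 250 / 23) 10 (by norm_num)
        (by norm_num) (by linarith) (by norm_num [Finset.sum_range_succ, Nat.factorial])
      simpa using this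
    have h2 : Real.exp (-(8 * A)) = E ^ 2 * Real.exp (-(2 * A)) := by
      rw [hE, ← Real.exp_nat_mul, ← Real.exp_add]; congr 1; push_cast; ring
    rw [h2]; gcongr
  have hD : 0 ≤ B - A := by linarith
  have h3B : Real.exp (-(3 * B)) = E * Real.exp (-(3 * (B - A))) := by
    rw [hE, ← Real.exp_add]; congr 1; ring
  have hεD : ε ≤ Real.exp (-(3 * (B - A))) := hε.trans (Real.exp_le_exp.mpr (by linarith))
  -- the coefficient of the second harmonic
  have hφ : E * (4 * A + 1 / 2 - B) - Real.exp (-(3 * B)) * (4 * B - A - 1 / 2) ≤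
      e * (3 * (1 - ε) * A₀ + (1 + ε) / 2 - (1 + 4 * ε) * (B - A)) := by
    have hpos : 0 ≤ (1 + ε) / 2 - (1 + 4 * ε) * (B - A) + 3 * (1 - ε) * A₀ := by
      have : (1 + 4 * ε) * (B - A) ≤ (1 + 4 * ε) * (1 / 2) := by gcongr; linarith
      nlinarith
    have h1 := exp_neg_mul_affine_le (κ := 3) (c₀ := (1 + ε) / 2 - (1 + 4 * ε) * (B - A))
      (c₁ := 3 * (1 - ε)) hA (by
        have : (1 + 4 * ε) * (B - A) ≤ (1 + 4 * ε) * (1 / 2) := by gcongr; linarith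
        nlinarith) hpos
    calc _ = E * (4 * A + 1 / 2 - B) -
          E * Real.exp (-(3 * (B - A))) * (4 * B - A - 1 / 2) := by rw [h3B]
      _ ≤ E * (4 * A + 1 / 2 - B) - E * ε * (4 * B - A - 1 / 2) := by
          have : 0 ≤ 4 * B - A - 1 / 2 := by linarith
          gcongr
      _ = E * ((1 + ε) / 2 - (1 + 4 * ε) * (B - A) + 3 * (1 - ε) * A) := by ring
      _ ≤ Real.exp (-(3 * A₀)) * ((1 + ε) / 2 - (1 + 4 * ε) * (B - A) + 3 * (1 - ε) * A₀) := h1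
      _ ≤ e * ((1 + ε) / 2 - (1 + 4 * ε) * (B - A) + 3 * (1 - ε) * A₀) := by gcongr
      _ = _ := by ring
  have hφ0 : 0 ≤ e * (3 * (1 - ε) * A₀ + (1 + ε) / 2 - (1 + 4 * ε) * (B - A)) := by
    have : (1 + 4 * ε) * (B - A) ≤ (1 + 4 * ε) * (1 / 2) := by gcongr; linarith
    apply mul_nonneg (hE0.le.trans hEe)
    nlinarith
  have hc1 := Real.cos_le_one a
  have hc2 := Real.neg_one_le_cos a
  have hsecond : (E * (4 * A + 1 / 2 - B) - Real.exp (-(3 * B)) * (4 * B - A - 1 / 2)) *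
      (2 * (Real.cos a + 1)) ≤
      4 * (e * (3 * (1 - ε) * A₀ + (1 + ε) / 2 - (1 + 4 * ε) * (B - A))) := by
    refine (mul_le_mul hφ (by linarith : 2 * (Real.cos a + 1) ≤ 4) (by linarith) hφ0).trans_eq ?_
    ring
  have hrest : B * (2 * (501 / 500 * 3 ^ 4 * Real.exp (-(8 * A))) +
        1 / 4 * (2 ^ 4 * E + 501 / 500 * 3 ^ 4 * Real.exp (-(8 * A))) ^ 2) ≤
      b * (e ^ 2 * (15 + (8 + 15 / 4 * e) ^ 2)) := by
    have ht : 501 / 500 * 3 ^ 4 * Real.exp (-(8 * A)) ≤ 15 / 2 * e ^ 2 := by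
      have h1 : E ^ 2 ≤ e ^ 2 := by gcongr
      linarith [sq_nonneg e]
    have ht0 : 0 ≤ 501 / 500 * 3 ^ 4 * Real.exp (-(8 * A)) := by positivity
    have e2 : e ^ 2 * (15 + (8 + 15 / 4 * e) ^ 2) =
        2 * (15 / 2 * e ^ 2) + 1 / 4 * (2 ^ 4 * e + 15 / 2 * e ^ 2) ^ 2 := by ring
    rw [e2]
    have hb0 : 0 ≤ b := by linarith
    gcongr
  have hmono : B - A - 4 * e * ((1 + 4 * ε) * (B - A)) ≤ d - 4 * e * ((1 + 4 * ε) * d) := by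
    have h1 : 4 * e * (1 + 4 * ε) ≤ 1 := by
      have : (4 * e) * (1 + 4 * ε) ≤ (1 / 4) * 4 := by gcongr <;> linarith
      linarith
    linarith [mul_nonneg (sub_nonneg.mpr h1) (sub_nonneg.mpr hd)]
  linarith

theorem energy_half_le {α q y : ℝ} (hα : 0 < α) (hy : 0 < y)
    (h : Real.cos (2 * Real.pi * q) ≠ 1 →
      slope (Real.pi * α * y) (Real.pi * y / α) (2 * Real.pi * q) 0 ≤ 0) :
    energy α (1 / 2) y ≤ energy α (1 / 2 - q) y := by
  by_cases hq : Real.cos (2 * Real.pi * q) = 1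
  · obtain ⟨C, -, e⟩ := energy_sub_energy (x := 1 / 2 - q) (x' := 1 / 2) hα hy
    obtain ⟨n, hn⟩ := (Real.cos_eq_one_iff _).mp hq
    have hqn : q = n := by
      have := Real.pi_pos
      have h2 : (2 * Real.pi) * (n - q) = 0 := by linarith
      rcases mul_eq_zero.mp h2 with h | h <;> linarith
    have e0 : ∑' p : ℕ × ℕ, coeff (Real.pi * α * y) (Real.pi * y / α) p *
        (Real.cos (2 * Real.pi * freq p * (1 / 2)) -
          Real.cos (2 * Real.pi * freq p * (1 / 2 - q))) = 0 := by
      rw [← tsum_zero (α := ℝ) (β := ℕ × ℕ)]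
      congr 1
      ext p
      have : 2 * Real.pi * freq p * (1 / 2 - q) =
          2 * Real.pi * freq p * (1 / 2) - ((freq p * n : ℤ) : ℝ) * (2 * Real.pi) := by
        rw [hqn]; push_cast; ring
      rw [this, Real.cos_sub_int_mul_two_pi, sub_self, mul_zero]
    rw [e0, mul_zero] at e
    linarith
  · obtain ⟨C, hC, e⟩ := energy_half_sub (q := q) (q' := 0) hα hy (by simpa using hq)
    rw [mul_zero, Real.cos_zero, sub_zero] at e
    have h1 := h hq
    have h2 := Real.cos_le_one (2 * Real.pi * q)
    have : 0 ≤ C * ((Real.cos (2 * Real.pi * q) - 1) *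
        slope (Real.pi * α * y) (Real.pi * y / α) (2 * Real.pi * q) 0) :=
      mul_nonneg hC.le (mul_nonneg_of_nonpos_of_nonpos (by linarith) h1)
    linarith

/-- `slope_zero_nonpos` on a strip `l ≤ y ≤ u` with `α₀ ≤ α ≤ 1`. -/
theorem slope_zero_nonpos_of_strip {α y a : ℝ} (l u α₀ κ e ε : ℝ) (hα₀ : 0 < α₀)
    (hα : α₀ ≤ α) (hα1 : α ≤ 1)
    (hκ : Real.pi / α - Real.pi * α ≤ κ) (hl : l ≤ y) (hu : y ≤ u) (hl0 : 0 < l)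
    (hA₀ : 6 / 5 ≤ 3.1415 * α₀ * l) (he : 1 / e ≤ ∑ i ∈ Finset.range 24,
      (3 * (3.1415 * α₀ * l)) ^ i / i.factorial) (he0 : 0 < e)
    (hε : ε * (∑ m ∈ Finset.range 8, (3 * (κ * u) / 2) ^ m / m.factorial +
      (3 * (κ * u) / 2) ^ 8 * (8 + 1) / (Nat.factorial 8 * 8)) ^ 2 ≤ 1)
    (hε0 : 0 ≤ ε) (hε1 : ε ≤ 3 / 5) (he1 : e ≤ 1 / 16) (hd1 : κ * u ≤ 1 / 2)
    (hnum : κ * u - 1 / 2 + 4 * e * (3 * (1 - ε) * (3.1415 * α₀ * l) + (1 + ε) / 2 -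
      (1 + 4 * ε) * (κ * u)) +
      (3.1416 * u / α₀) * (e ^ 2 * (15 + (8 + 15 / 4 * e) ^ 2)) ≤ 0) (ha : Real.cos a ≠ 1) :
    slope (Real.pi * α * y) (Real.pi * y / α) a 0 ≤ 0 := by
  have hπ := Real.pi_pos
  have hπ1 := Real.pi_gt_d4
  have hπ2 := Real.pi_lt_d4
  have hα0 : 0 < α := by linarith
  have hy0 : 0 < y := by linarith
  have hD : Real.pi * y / α - Real.pi * α * y = (Real.pi / α - Real.pi * α) * y := by ring
  have hpos : 0 ≤ Real.pi / α - Real.pi * α := by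
    rw [sub_nonneg, le_div_iff₀ hα0, mul_assoc]
    exact mul_le_of_le_one_right hπ.le (by nlinarith)
  have hκ0 : 0 ≤ κ := hpos.trans hκ
  have hd0 : 0 ≤ κ * u := mul_nonneg hκ0 (by linarith)
  refine slope_zero_nonpos (A₀ := 3.1415 * α₀ * l) (d := κ * u) (e := e) (ε := ε)
    (b := 3.1416 * u / α₀) hA₀ ?_ ?_ ?_ ?_ ?_ ?_ hε0 hε1 he1 hd1 hnum ha
  · gcongr
  · rw [← sub_nonneg, hD]; positivity
  · rw [hD]; gcongr
  · have : 0 ≤ u := by linarith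
    gcongr
  · have := exp_neg_le_of_le (x := 3 * (3.1415 * α₀ * l)) (c := 1 / e) 24 (by positivity)
      (by positivity) le_rfl he
    simpa using this
  · exact le_exp_neg_of_le (x := 3 * (κ * u)) (by linarith) (by linarith) le_rfl hε0 hε

theorem pi_div_sub_le {α α₀ : ℝ} (h0 : 0 < α₀) (h : α₀ ≤ α) :
    Real.pi / α - Real.pi * α ≤ 3.1416 * (1 / α₀ - α₀) ∨ 1 < α := by
  rcases lt_or_ge 1 α with h1 | h1
  · exact Or.inr h1
  left
  have hα : 0 < α := by linarith
  have e1 : 1 / α ≤ 1 / α₀ := by gcongr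
  have h2 : 0 ≤ 1 / α - α := by
    rw [sub_nonneg, le_div_iff₀ hα]; nlinarith
  calc Real.pi / α - Real.pi * α = Real.pi * (1 / α - α) := by ring
    _ ≤ 3.1416 * (1 / α - α) := by gcongr; exact Real.pi_lt_d4.le
    _ ≤ _ := by linarith

/-! ### Numerical certificates for the slope on horizontal strips -/

theorem slope_zero_nonpos_low {α y a : ℝ} (hα : 0.936 ≤ α) (hα1 : α ≤ 1) (hl : 0.43 ≤ y)
    (hu : y ≤ 0.49) (ha : Real.cos a ≠ 1) :
    slope (Real.pi * α * y) (Real.pi * y / α) a 0 ≤ 0 := by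
  refine slope_zero_nonpos_of_strip 0.43 0.49 0.936 0.4159 0.02253 0.542 (by norm_num) hα hα1
    (((pi_div_sub_le (by norm_num) hα).resolve_right hα1.not_gt).trans (by norm_num)) hl hu
    ?_ ?_ ?_ ?_ ?_ ?_ ?_ ?_ ?_ ?_ ha <;> norm_num [Finset.sum_range_succ, Nat.factorial]

theorem slope_zero_nonpos_mid_low {α y a : ℝ} (hα : 0.918 ≤ α) (hα1 : α ≤ 1) (hl : 0.48 ≤ y)
    (hu : y ≤ 0.5) (ha : Real.cos a ≠ 1) :
    slope (Real.pi * α * y) (Real.pi * y / α) a 0 ≤ 0 := by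
  refine slope_zero_nonpos_of_strip 0.48 0.5 0.918 0.5383 0.01573 0.445 (by norm_num) hα hα1
    (((pi_div_sub_le (by norm_num) hα).resolve_right hα1.not_gt).trans (by norm_num)) hl hu
    ?_ ?_ ?_ ?_ ?_ ?_ ?_ ?_ ?_ ?_ ha <;> norm_num [Finset.sum_range_succ, Nat.factorial]

theorem slope_zero_nonpos_high {α y a : ℝ} (hα : 0.918 ≤ α) (hα1 : α ≤ 1) (hl : 0.8 ≤ y)
    (hu : y ≤ 0.8661) (ha : Real.cos a ≠ 1) :
    slope (Real.pi * α * y) (Real.pi * y / α) a 0 ≤ 0 := by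
  refine slope_zero_nonpos_of_strip 0.8 0.8661 0.918 0.5383 0.00099 0.246 (by norm_num) hα hα1
    (((pi_div_sub_le (by norm_num) hα).resolve_right hα1.not_gt).trans (by norm_num)) hl hu
    ?_ ?_ ?_ ?_ ?_ ?_ ?_ ?_ ?_ ?_ ha <;> norm_num [Finset.sum_range_succ, Nat.factorial]

/-- The bound on π/α - πα is a separate hypothesis because α ≥ 0.9 alone gives a value too large for
these strips. The number 0.5774 is just above 1/√3, where B - A = 1/2 at height √3/2; in the
critical range it is supplied by `gap_le_of_harmonicSum_nonpos`. -/
theorem slope_zero_nonpos_mid {α y a : ℝ} (hα : 0.9 ≤ α) (hα1 : α ≤ 1)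
    (hκ : Real.pi / α - Real.pi * α ≤ 0.5774) (hl : 0.499 ≤ y)
    (hu : y ≤ 0.8) (ha : Real.cos a ≠ 1) :
    slope (Real.pi * α * y) (Real.pi * y / α) a 0 ≤ 0 := by
  rcases le_total y 0.552 with h1 | h1
  · refine slope_zero_nonpos_of_strip 0.499 0.552 0.9 0.5774 0.01452 0.384 (by norm_num) hα hα1
      hκ hl h1 ?_ ?_ ?_ ?_ ?_ ?_ ?_ ?_ ?_ ?_ ha <;> norm_num [Finset.sum_range_succ, Nat.factorial]
  rcases le_total y 0.643 with h2 | h2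
  · refine slope_zero_nonpos_of_strip 0.552 0.643 0.9 0.5774 0.00926 0.328 (by norm_num) hα hα1
      hκ h1 h2 ?_ ?_ ?_ ?_ ?_ ?_ ?_ ?_ ?_ ?_ ha <;> norm_num [Finset.sum_range_succ, Nat.factorial]
  rcases le_total y 0.743 with h3 | h3
  · refine slope_zero_nonpos_of_strip 0.643 0.743 0.9 0.5774 0.00428 0.276 (by norm_num) hα hα1
      hκ h2 h3 ?_ ?_ ?_ ?_ ?_ ?_ ?_ ?_ ?_ ?_ ha <;> norm_num [Finset.sum_range_succ, Nat.factorial]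
  · refine slope_zero_nonpos_of_strip 0.743 0.8 0.9 0.5774 0.00184 0.25 (by norm_num) hα hα1
      hκ h3 hu ?_ ?_ ?_ ?_ ?_ ?_ ?_ ?_ ?_ ?_ ha <;> norm_num [Finset.sum_range_succ, Nat.factorial]

/-! ### Moving left to the imaginary axis -/

/-- Write δ = B - A - 1/2. The leading term contributes δ(1 - cos 2πx). A negative coefficient
satisfies Bl² - Am² - 1/2 ≥ δ - A(m² - 1), and 1 - cos kθ ≤ k²(1 - cos θ) with k = ml, so the
negative part is at most (1 - cos 2πx) times a product of a series in m, majorised by U, and a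
Gaussian series in l, at most 501/500. -/
theorem energy_zero_le_of_dominated {α x y : ℝ} (hα : 0 < α) (hy : 0 < y) {U : ℕ → ℝ}
    (hU : Summable U) (hU0 : ∀ i, 0 ≤ U i)
    (hdom : ∀ i : ℕ, ((i : ℝ) + 1) ^ 2 * (Real.exp (-(Real.pi * α * y * (((i : ℝ) + 1) ^ 2 - 1))) *
      max (Real.pi * α * y * (((i : ℝ) + 1) ^ 2 - 1) -
        (Real.pi * y / α - Real.pi * α * y - 1 / 2)) 0) ≤ U i)
    (hB : 27 / 10 ≤ Real.pi * y / α)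
    (hsum : (∑' i, U i) * (501 / 500) + U 0 ≤ Real.pi * y / α - Real.pi * α * y - 1 / 2) :
    energy α 0 y ≤ energy α x y := by
  obtain ⟨C, hC, e⟩ := energy_sub_energy (x := x) (x' := 0) hα hy
  have hπ := Real.pi_pos
  have hA0 : 0 < Real.pi * α * y := by positivity
  set A := Real.pi * α * y with hA
  set B := Real.pi * y / α with hBdef
  set δ := B - A - 1 / 2 with hδ
  have hB0 : 0 < B := by linarith
  set s := 1 - Real.cos (2 * Real.pi * x) with hs
  have hs0 : 0 ≤ s := by linarith [Real.cos_le_one (2 * Real.pi * x)]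
  set w : ℕ × ℕ → ℝ := fun q => Real.cos (2 * Real.pi * freq q * 0) -
    Real.cos (2 * Real.pi * freq q * x) with hw
  have hw0 : ∀ q, 0 ≤ w q := fun q => by
    simp only [hw, mul_zero, Real.cos_zero]
    linarith [Real.cos_le_one (2 * Real.pi * freq q * x)]
  have hwle : ∀ q, w q ≤ (freq q : ℝ) ^ 2 * s := fun q => by
    have := one_sub_cos_nat_mul_le (freq q) (2 * Real.pi * x)
    simp only [hw, mul_zero, Real.cos_zero]
    rw [show 2 * Real.pi * (freq q : ℝ) * x = freq q * (2 * Real.pi * x) by ring]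
    exact this
  set V : ℕ → ℝ := fun j => ((j : ℝ) + 1) ^ 2 * Real.exp (-(B * (((j : ℝ) + 1) ^ 2 - 1))) with hV
  have hV0 : ∀ j, 0 ≤ V j := fun j => by positivity
  have hVs1 : Summable fun j => V (j + 1) := by
    refine (summable_gaussian_two (P := B) (n := 2) (by linarith) (by norm_num)).congr fun j => ?_
    simp only [hV]
    push_cast
    rw [show (j : ℝ) + 1 + 1 = j + 2 by ring]
  have hVs : Summable V := (summable_nat_add_iff 1).mp hVs1
  have hVle : ∑' j, V j ≤ 501 / 500 := by
    rw [hVs.tsum_eq_zero_add]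
    have h1 := tsum_gaussian_two_le (P := B) (n := 2) (by linarith) (by norm_num)
    have h2 : ∑' j, V (j + 1) ≤
        2 ^ 2 * Real.exp (-(3 * B)) + 501 / 500 * 3 ^ 2 * Real.exp (-(8 * B)) := by
      refine le_trans (le_of_eq ?_) h1
      congr 1
      ext j
      simp only [hV]
      push_cast
      rw [show (j : ℝ) + 1 + 1 = j + 2 by ring]
    have h3 : Real.exp (-(3 * B)) ≤ 1 / 3000 := by
      have := exp_neg_le_of_le (x := 81 / 10) (t := 3 * B) (c := 3000) 16 (by norm_num)
        (by norm_num) (by linarith) (by norm_num [Finset.sum_range_succ, Nat.factorial])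
      simpa using this
    have h4 : Real.exp (-(8 * B)) ≤ 1 / 3000 * (1 / 1000) := by
      have h5 : Real.exp (-(8 * B)) ≤ Real.exp (-(3 * B)) * Real.exp (-(3 * B)) := by
        rw [← Real.exp_add]; exact Real.exp_le_exp.mpr (by linarith)
      have h6 := Real.exp_pos (-(3 * B))
      nlinarith
    have h0 : V 0 = 1 := by simp [hV]
    rw [h0]
    linarith
  have hcw : Summable fun q => coeff A B q * w q := by
    refine summable_coeff_mul_of_bounded (C := 2) hA0 hB0 fun q => ?_
    rw [abs_of_nonneg (hw0 q)]
    simp only [hw, mul_zero, Real.cos_zero]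
    linarith [Real.neg_one_le_cos (2 * Real.pi * freq q * x)]
  have hUV : Summable fun q : ℕ × ℕ => U q.1 * V q.2 := hU.mul_of_nonneg hVs hU0 hV0
  have hterm : ∀ q, 0 ≤ coeff A B q * w q + s * (U q.1 * V q.2) := by
    intro q
    have hd := hdom q.1
    set m := (q.1 : ℝ) + 1 with hm
    set l := (q.2 : ℝ) + 1 with hl
    have hl1 : 1 ≤ l ^ 2 := by
      have : (0 : ℝ) ≤ q.2 := by positivity
      nlinarith
    have hm1 : 1 ≤ m ^ 2 := by
      have : (0 : ℝ) ≤ q.1 := by positivity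
      nlinarith
    set μ := max (A * (m ^ 2 - 1) - δ) 0 with hμ
    have hμ0 : 0 ≤ μ := le_max_right _ _
    have h1 : -(Real.exp (-(A * (m ^ 2 - 1))) * Real.exp (-(B * (l ^ 2 - 1))) * μ) ≤
        coeff A B q := by
      have e1 : coeff A B q = Real.exp (-(A * (m ^ 2 - 1))) * Real.exp (-(B * (l ^ 2 - 1))) *
          (B * l ^ 2 - A * m ^ 2 - 1 / 2) := by
        unfold coeff
        rw [← Real.exp_add]
        congr 2
      rw [e1, ← mul_neg]
      apply mul_le_mul_of_nonneg_left _ (by positivity)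
      have h2 : A * (m ^ 2 - 1) - δ ≤ μ := le_max_left _ _
      nlinarith
    have h2 : (freq q : ℝ) = m * l := freq_cast q
    have h3 := hwle q
    rw [h2] at h3
    have h4 : -(Real.exp (-(A * (m ^ 2 - 1))) * Real.exp (-(B * (l ^ 2 - 1))) * μ) * w q ≤
        coeff A B q * w q := mul_le_mul_of_nonneg_right h1 (hw0 q)
    have h5 : Real.exp (-(A * (m ^ 2 - 1))) * Real.exp (-(B * (l ^ 2 - 1))) * μ * w q ≤
        s * (U q.1 * V q.2) := by
      calc _ ≤ Real.exp (-(A * (m ^ 2 - 1))) * Real.exp (-(B * (l ^ 2 - 1))) * μ *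
            ((m * l) ^ 2 * s) := by gcongr
        _ = s * ((m ^ 2 * (Real.exp (-(A * (m ^ 2 - 1))) * μ)) *
            (l ^ 2 * Real.exp (-(B * (l ^ 2 - 1))))) := by ring
        _ ≤ _ := by
          apply mul_le_mul_of_nonneg_left _ hs0
          exact mul_le_mul_of_nonneg_right hd (hV0 q.2)
    linarith
  -- After adding the majorant every term is nonnegative, so the whole sum is at least its leading
  -- term.
  have htot : coeff A B (0, 0) * w (0, 0) ≤
      ∑' q, (coeff A B q * w q + s * (U q.1 * V q.2)) := by
    refine le_trans ?_ ((hcw.add (hUV.mul_left s)).le_tsum (0, 0) fun q _ => hterm q)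
    have := mul_nonneg hs0 (mul_nonneg (hU0 0) (hV0 0))
    simpa using this
  rw [hcw.tsum_add (hUV.mul_left s), tsum_mul_left,
    ← hU.tsum_mul_tsum hVs hUV] at htot
  have hU00 := hU0 0
  have h00 : coeff A B (0, 0) * w (0, 0) = δ * s := by
    simp [coeff, hw, freq, hδ, hs]
  rw [h00] at htot
  have hprod : (∑' i, U i) * ∑' j, V j ≤ δ := by
    have hnn : 0 ≤ ∑' i, U i := tsum_nonneg hU0
    calc _ ≤ (∑' i, U i) * (501 / 500) := by gcongr
      _ ≤ _ := by linarith
  have hfin : 0 ≤ ∑' q, coeff A B q * w q := by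
    have := mul_le_mul_of_nonneg_left hprod hs0
    linarith
  have := mul_nonneg hC.le hfin
  linarith

/-- The maximum is at t = 4, with value 256 e^{-4} ≈ 4.689. -/
theorem pow_four_mul_exp_neg_le {t : ℝ} (ht : 0 ≤ t) : t ^ 4 * Real.exp (-t) ≤ 469 / 100 := by
  have h1 : t / 4 ≤ Real.exp (t / 4 - 1) := by linarith [Real.add_one_le_exp (t / 4 - 1)]
  have h2 : (t / 4) ^ 4 ≤ Real.exp (t - 4) := by
    calc (t / 4) ^ 4 ≤ Real.exp (t / 4 - 1) ^ 4 := by gcongr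
      _ = _ := by rw [← Real.exp_nat_mul]; congr 1; push_cast; ring
  have h3 : Real.exp (t - 4) = Real.exp t * Real.exp (-4) := by rw [← Real.exp_add]; congr 1
  have h4 : Real.exp (-4) ≤ 469 / 25600 := by
    have := exp_neg_le_of_le (x := 4) (t := 4) (c := 25600 / 469) 20 (by norm_num)
      (by norm_num) le_rfl (by norm_num [Finset.sum_range_succ, Nat.factorial])
    simpa using this
  have h5 : Real.exp t * Real.exp (-t) = 1 := by rw [← Real.exp_add]; simp
  have h6 := Real.exp_pos (-t)
  calc t ^ 4 * Real.exp (-t) = 256 * (t / 4) ^ 4 * Real.exp (-t) := by ring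
    _ ≤ 256 * (Real.exp t * Real.exp (-4)) * Real.exp (-t) := by rw [← h3]; gcongr
    _ = 256 * Real.exp (-4) * (Real.exp t * Real.exp (-t)) := by ring
    _ ≤ _ := by rw [h5]; linarith

theorem summable_inv_sq_tail :
    Summable (fun i : ℕ => if i = 0 then (0 : ℝ) else 1 / ((i : ℝ) + 1) ^ 2) ∧
    ∑' i : ℕ, (if i = 0 then (0 : ℝ) else 1 / ((i : ℝ) + 1) ^ 2) ≤ 645 / 1000 := by
  have hz := hasSum_zeta_two
  have h2 : Summable fun i : ℕ => 1 / (((i + 2 : ℕ) : ℝ)) ^ 2 :=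
    (summable_nat_add_iff 2).mpr hz.summable
  have hS : Summable (fun i : ℕ => if i = 0 then (0 : ℝ) else 1 / ((i : ℝ) + 1) ^ 2) := by
    rw [← summable_nat_add_iff 1]
    refine h2.congr fun i => ?_
    simp only [Nat.succ_ne_zero, if_false]
    push_cast
    congr 2; ring
  refine ⟨hS, ?_⟩
  rw [hS.tsum_eq_zero_add]
  have h3 := hz.summable.sum_add_tsum_nat_add 2
  rw [hz.tsum_eq] at h3
  have h4 : ∑' i : ℕ, (if i + 1 = 0 then (0 : ℝ) else 1 / (((i + 1 : ℕ) : ℝ) + 1) ^ 2) =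
      ∑' i : ℕ, 1 / (((i + 2 : ℕ) : ℝ)) ^ 2 := by
    congr 1
    ext i
    simp only [Nat.succ_ne_zero, if_false]
    push_cast
    congr 2; ring
  rw [h4]
  simp only [if_true, zero_add]
  rw [Finset.sum_range_succ, Finset.sum_range_succ] at h3
  norm_num at h3
  have hπ := Real.pi_lt_d4
  have hπ0 := Real.pi_pos
  norm_num
  nlinarith

/-- Here A may tend to 0, so Gaussian decay in m is not uniform and is traded for a power: the terms
are O(1/(δA²m²)) with δ = B - A - 1/2. What remains is a lower bound for δA, which AB = π²y²
provides without assuming a gap. -/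
theorem energy_zero_le_of_small {α x y : ℝ} (hα : 0 < α) (hα1 : α ≤ 1) (hy : 0 < y)
    (hy2 : 3 / 4 ≤ y ^ 2) (hA : Real.pi * α * y ≤ 9 / 4) : energy α 0 y ≤ energy α x y := by
  have hπ := Real.pi_pos
  have hπ4 := Real.pi_gt_d4
  have hA0 : 0 < Real.pi * α * y := by positivity
  have hAB : Real.pi * α * y * (Real.pi * y / α) = Real.pi ^ 2 * y ^ 2 := by field_simp
  have hle : Real.pi * α * y ≤ Real.pi * y / α := by
    rw [le_div_iff₀ hα]
    have : α * α ≤ 1 := by nlinarith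
    nlinarith [mul_pos hπ hy]
  have hAB' : 7.4 ≤ Real.pi * α * y * (Real.pi * y / α) := by
    rw [hAB]
    have : 9.869 ≤ Real.pi ^ 2 := by nlinarith
    nlinarith
  obtain ⟨hS, hSle⟩ := summable_inv_sq_tail
  set A := Real.pi * α * y with hAdef
  set B := Real.pi * y / α with hBdef
  have hB0 : 0 < B := by linarith
  -- δA = AB - A² - A/2 ≥ 7.4 - (9/4)² - 9/8.
  have hδA : 1.2 ≤ (B - A - 1 / 2) * A := by nlinarith
  have hδ0 : 0 < B - A - 1 / 2 := by
    by_contra h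
    push Not at h
    nlinarith
  set δ := B - A - 1 / 2 with hδ
  refine energy_zero_le_of_dominated (U := fun i => 2.085 / (δ * A ^ 2) *
    (if i = 0 then (0 : ℝ) else 1 / ((i : ℝ) + 1) ^ 2)) hα hy (hS.mul_left _) ?_ ?_ ?_ ?_
  · intro i
    split_ifs <;> positivity
  · intro i
    rcases Nat.eq_zero_or_pos i with rfl | hi
    · have : max (A * (((0 : ℕ) + 1 : ℝ) ^ 2 - 1) - δ) 0 = 0 := by
        apply max_eq_right; push_cast; linarith
      simp only [← hAdef, ← hBdef, ← hδ, this]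
      simp
    · have hi1 : (1 : ℝ) ≤ i := by exact_mod_cast hi
      rw [if_neg hi.ne']
      simp only [← hAdef, ← hBdef, ← hδ]
      set m := (i : ℝ) + 1 with hm
      have hm2 : 4 ≤ m ^ 2 := by nlinarith
      set t := A * (m ^ 2 - 1) with ht
      have htge : 3 / 4 * (A * m ^ 2) ≤ t := by nlinarith
      have ht0 : 0 < t := lt_of_lt_of_le (by positivity) htge
      -- This is (t - 2δ)² ≥ 0; the resulting t² e^{-t} is bounded by 4.69/t² through the
      -- fourth-power estimate.
      have h1 : max (t - δ) 0 ≤ t ^ 2 / (4 * δ) := by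
        apply max_le
        · rw [le_div_iff₀ (by positivity)]; nlinarith [sq_nonneg (t - 2 * δ)]
        · positivity
      have h2 := pow_four_mul_exp_neg_le ht0.le
      have h3 : t ^ 2 * Real.exp (-t) ≤ 4.69 / t ^ 2 := by
        rw [le_div_iff₀ (by positivity)]
        calc _ = t ^ 4 * Real.exp (-t) := by ring
          _ ≤ _ := by linarith
      have h4 : 4.69 / t ^ 2 ≤ 4.69 / (3 / 4 * (A * m ^ 2)) ^ 2 := by gcongr
      calc m ^ 2 * (Real.exp (-t) * max (t - δ) 0) ≤
            m ^ 2 * (Real.exp (-t) * (t ^ 2 / (4 * δ))) := by gcongr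
        _ = m ^ 2 / (4 * δ) * (t ^ 2 * Real.exp (-t)) := by ring
        _ ≤ m ^ 2 / (4 * δ) * (4.69 / (3 / 4 * (A * m ^ 2)) ^ 2) := by
          gcongr; exact h3.trans h4
        _ = (4.69 * 16 / 36) / (δ * A ^ 2) * (1 / m ^ 2) := by field_simp; norm_num
        _ ≤ _ := by gcongr; norm_num
  · nlinarith
  · rw [tsum_mul_left]
    simp only [if_true, mul_zero, add_zero]
    calc _ ≤ 2.085 / (δ * A ^ 2) * (645 / 1000) * (501 / 500) := by gcongr
      _ ≤ δ := by
        rw [div_mul_eq_mul_div, div_mul_eq_mul_div, div_le_iff₀ (by positivity)]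
        have : 1.2 ^ 2 ≤ (δ * A) ^ 2 := by gcongr
        nlinarith

theorem mul_exp_neg_anti {s t : ℝ} (hs : 1 ≤ s) (hst : s ≤ t) :
    t * Real.exp (-t) ≤ s * Real.exp (-s) := by
  have e : Real.exp (-s) = Real.exp (-t) * Real.exp (t - s) := by
    rw [← Real.exp_add]; congr 1; ring
  rw [e]
  have h := Real.add_one_le_exp (t - s)
  have h2 : t ≤ s * Real.exp (t - s) := by nlinarith
  calc t * Real.exp (-t) ≤ s * Real.exp (t - s) * Real.exp (-t) := by gcongr
    _ = _ := by ring

/-- For A ≥ 9/4 the function te^{-t} is already decreasing at t = A(m² - 1), so A is replaced by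
9/4. The majorant sums to about 27e^{-27/4} ≈ 0.032, below the available 0.54 - 1/2 = 0.04. -/
theorem energy_zero_le_of_large {α x y : ℝ} (hα : 0 < α) (hy : 0 < y)
    (hA : 9 / 4 ≤ Real.pi * α * y) (hδ : 0.54 ≤ Real.pi * y / α - Real.pi * α * y) :
    energy α 0 y ≤ energy α x y := by
  have hs3 := summable_gaussian_tail (P := 9 / 4) (n := 4) (by norm_num) (by norm_num)
  have ht3 := tsum_gaussian_tail_le (P := 9 / 4) (n := 4) (by norm_num) (by norm_num)
  set U : ℕ → ℝ := fun i => ((i : ℝ) + 1) ^ 2 * (9 / 4 * (((i : ℝ) + 1) ^ 2 - 1) *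
    Real.exp (-(9 / 4 * (((i : ℝ) + 1) ^ 2 - 1)))) with hU
  have hle : ∀ i : ℕ, U (i + 2) ≤ 9 / 4 * (((i : ℝ) + 3) ^ 4 *
      Real.exp (-(9 / 4 * (((i : ℝ) + 3) ^ 2 - 1)))) := by
    intro i
    simp only [hU]
    push_cast
    rw [show (i : ℝ) + 2 + 1 = i + 3 by ring]
    have h0 := Real.exp_pos (-(9 / 4 * (((i : ℝ) + 3) ^ 2 - 1)))
    have h1 : 0 ≤ ((i : ℝ) + 3) ^ 2 * Real.exp (-(9 / 4 * (((i : ℝ) + 3) ^ 2 - 1))) := by positivity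
    nlinarith
  have hU0 : ∀ i, 0 ≤ U i := by
    intro i
    have : 0 ≤ ((i : ℝ) + 1) ^ 2 - 1 := by
      have : (0 : ℝ) ≤ i := by positivity
      nlinarith
    simp only [hU]
    positivity
  have hS2 : Summable fun i => U (i + 2) :=
    Summable.of_nonneg_of_le (fun i => hU0 _) hle (hs3.mul_left _)
  have hS : Summable U := (summable_nat_add_iff 2).mp hS2
  refine energy_zero_le_of_dominated hα hy hS hU0 (fun i => ?_) (by linarith) ?_
  · set A := Real.pi * α * y
    set m := (i : ℝ) + 1 with hm
    rcases Nat.eq_zero_or_pos i with rfl | hi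
    · have : max (A * (m ^ 2 - 1) - (Real.pi * y / α - A - 1 / 2)) 0 = 0 := by
        apply max_eq_right
        rw [hm]; push_cast; linarith
      rw [this]
      simpa using hU0 0
    · have hi1 : (1 : ℝ) ≤ i := by exact_mod_cast hi
      have hm2 : 4 ≤ m ^ 2 := by nlinarith
      have h1 : max (A * (m ^ 2 - 1) - (Real.pi * y / α - A - 1 / 2)) 0 ≤ A * (m ^ 2 - 1) := by
        apply max_le <;> nlinarith
      have h2 := mul_exp_neg_anti (s := 9 / 4 * (m ^ 2 - 1)) (t := A * (m ^ 2 - 1))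
        (by nlinarith) (by nlinarith)
      calc _ ≤ m ^ 2 * (Real.exp (-(A * (m ^ 2 - 1))) * (A * (m ^ 2 - 1))) := by gcongr
        _ = m ^ 2 * (A * (m ^ 2 - 1) * Real.exp (-(A * (m ^ 2 - 1)))) := by ring
        _ ≤ _ := mul_le_mul_of_nonneg_left h2 (sq_nonneg _)
  · have h0 : U 0 = 0 := by simp [hU]
    have h1 : U 1 = 27 * Real.exp (-(27 / 4)) := by simp only [hU]; norm_num; ring
    rw [h0, hS.tsum_eq_zero_add, ((summable_nat_add_iff 1).mpr hS).tsum_eq_zero_add, h0,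
      zero_add, h1]
    have h2 : ∑' i, U (i + 1 + 1) ≤ 9 / 4 * (501 / 500 * 3 ^ 4 * Real.exp (-(8 * (9 / 4)))) := by
      refine (hS2.tsum_le_tsum hle (hs3.mul_left _)).trans ?_
      rw [tsum_mul_left]
      gcongr
    have h3 : Real.exp (-(27 / 4)) ≤ 1 / 850 := by
      have := exp_neg_le_of_le (x := 27 / 4) (t := 27 / 4) (c := 850) 20 (by norm_num)
        (by norm_num) le_rfl (by norm_num [Finset.sum_range_succ, Nat.factorial])
      simpa using this
    have h4 : Real.exp (-(8 * (9 / 4))) ≤ 1 / 850 * (1 / 850) := by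
      calc Real.exp (-(8 * (9 / 4))) ≤ Real.exp (-(27 / 4)) * Real.exp (-(27 / 4)) := by
            rw [← Real.exp_add]; exact Real.exp_le_exp.mpr (by norm_num)
        _ ≤ _ := by gcongr
    linarith

/-- If `B - A ≥ 0.54` then moving horizontally to the imaginary axis lowers the energy. -/
theorem energy_zero_le {α x y : ℝ} (hα : 0 < α) (hα1 : α ≤ 1) (hy : 0 < y)
    (hy2 : 3 / 4 ≤ y ^ 2) (hδ : 0.54 ≤ Real.pi * y / α - Real.pi * α * y) :
    energy α 0 y ≤ energy α x y := by
  rcases le_total (Real.pi * α * y) (9 / 4) with h | h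
  · exact energy_zero_le_of_small hα hα1 hy hy2 h
  · exact energy_zero_le_of_large hα hy h hδ

/-! ### Comparison with the hexagonal point -/

/-- A Lipschitz estimate in the height, obtained from 1 - κ(z - y) ≤ e^{-κ(z - y)} ≤ 1. With A = ay
and B = by, every `coeff` has this exponential-affine form in y. -/
theorem abs_exp_mul_affine_sub_le {κ lam y z : ℝ} (hκ : 0 ≤ κ) (hy : 0 ≤ y) (hyz : y ≤ z) :
    |Real.exp (-(κ * z)) * (lam * z - 1 / 2) - Real.exp (-(κ * y)) * (lam * y - 1 / 2)| ≤
      (z - y) * (Real.exp (-(κ * y)) * (|lam| + κ * (|lam| * z + 1 / 2))) := by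
  set r := Real.exp (-(κ * (z - y))) with hr
  have e : Real.exp (-(κ * z)) = Real.exp (-(κ * y)) * r := by
    rw [hr, ← Real.exp_add]; congr 1; ring
  have hr1 : r ≤ 1 := Real.exp_le_one_iff.mpr (by nlinarith [mul_nonneg hκ (sub_nonneg.mpr hyz)])
  have hr2 : 1 - κ * (z - y) ≤ r := by linarith [Real.add_one_le_exp (-(κ * (z - y)))]
  have hz : 0 ≤ z := hy.trans hyz
  have e2 : Real.exp (-(κ * z)) * (lam * z - 1 / 2) - Real.exp (-(κ * y)) * (lam * y - 1 / 2) =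
      Real.exp (-(κ * y)) * (lam * (z - y) - (1 - r) * (lam * z - 1 / 2)) := by
    rw [e]; ring
  rw [e2, abs_mul, Real.abs_exp]
  have h1 : |lam * (z - y) - (1 - r) * (lam * z - 1 / 2)| ≤
      (z - y) * (|lam| + κ * (|lam| * z + 1 / 2)) := by
    have h2 : |lam * (z - y)| = |lam| * (z - y) := by rw [abs_mul, abs_of_nonneg (sub_nonneg.mpr hyz)]
    have h3 : |(1 - r) * (lam * z - 1 / 2)| ≤ κ * (z - y) * (|lam| * z + 1 / 2) := by
      rw [abs_mul, abs_of_nonneg (by linarith : 0 ≤ 1 - r)]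
      have h4 : |lam * z - 1 / 2| ≤ |lam| * z + 1 / 2 := by
        calc _ ≤ |lam * z| + |(1 / 2 : ℝ)| := abs_sub _ _
          _ = _ := by rw [abs_mul, abs_of_nonneg hz]; norm_num
      have h5 : 0 ≤ κ * (z - y) := mul_nonneg hκ (by linarith)
      exact mul_le_mul (by linarith) h4 (abs_nonneg _) h5
    calc _ ≤ |lam * (z - y)| + |(1 - r) * (lam * z - 1 / 2)| := abs_sub _ _
      _ ≤ _ := by rw [h2]; linarith
  calc _ ≤ Real.exp (-(κ * y)) * ((z - y) * (|lam| + κ * (|lam| * z + 1 / 2))) := by gcongr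
    _ = _ := by ring

/-- The Gaussian weight dominating the terms of frequency `k ≥ 3`. -/
noncomputable def weight (P Q : ℝ) (q : ℕ × ℕ) : ℝ :=
  Real.exp (-(P * (((q.1 : ℝ) + 1) ^ 2 - 1)) - Q * (((q.2 : ℝ) + 1) ^ 2 - 1))

theorem coeff_eq_exp_mul_affine (a b y : ℝ) (q : ℕ × ℕ) :
    coeff (a * y) (b * y) q =
      Real.exp (-((a * (((q.1 : ℝ) + 1) ^ 2 - 1) + b * (((q.2 : ℝ) + 1) ^ 2 - 1)) * y)) *
        ((b * ((q.2 : ℝ) + 1) ^ 2 - a * ((q.1 : ℝ) + 1) ^ 2) * y - 1 / 2) := by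
  unfold coeff
  congr 1
  · congr 1; ring
  · ring

theorem one_le_succ_sq (i : ℕ) : 1 ≤ ((i : ℝ) + 1) ^ 2 := by
  have : (0 : ℝ) ≤ i := by positivity
  nlinarith

theorem one_le_freq (q : ℕ × ℕ) : (1 : ℝ) ≤ freq q := by
  have : 1 ≤ freq q := Nat.one_le_iff_ne_zero.mpr (by unfold freq; positivity)
  exact_mod_cast this

theorem abs_frequency_weight_le {a b : ℝ} (ha : 0 ≤ a) (hab : a ≤ b) (hb : b ≤ 7 / 2)
    (q : ℕ × ℕ) :
    |b * ((q.2 : ℝ) + 1) ^ 2 - a * ((q.1 : ℝ) + 1) ^ 2| ≤ 7 / 2 * (freq q : ℝ) ^ 2 ∧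
    0 ≤ a * (((q.1 : ℝ) + 1) ^ 2 - 1) + b * (((q.2 : ℝ) + 1) ^ 2 - 1) ∧
    a * (((q.1 : ℝ) + 1) ^ 2 - 1) + b * (((q.2 : ℝ) + 1) ^ 2 - 1) ≤ 7 / 2 * (freq q : ℝ) ^ 2 := by
  rw [freq_cast, mul_pow]
  have hm := one_le_succ_sq q.1
  have hl := one_le_succ_sq q.2
  generalize ((q.1 : ℝ) + 1) ^ 2 = m at *
  generalize ((q.2 : ℝ) + 1) ^ 2 = l at *
  have hml : m + l - 1 ≤ m * l := by nlinarith
  have h1 : a * m ≤ 7 / 2 * m := by nlinarith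
  have h2 : b * l ≤ 7 / 2 * l := by nlinarith
  have h3 : 0 ≤ a * m := by positivity
  have h4 : 0 ≤ b * l := by
    have : 0 ≤ b := ha.trans hab
    positivity
  have h5 : 0 ≤ a * (m - 1) := mul_nonneg ha (by linarith)
  have h6 : 0 ≤ b * (l - 1) := mul_nonneg (ha.trans hab) (by linarith)
  have h7 : a * (m - 1) ≤ 7 / 2 * (m - 1) := by nlinarith
  have h8 : b * (l - 1) ≤ 7 / 2 * (l - 1) := by nlinarith
  refine ⟨?_, by linarith, by linarith⟩
  rw [abs_le]; constructor <;> linarith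

theorem exp_neg_le_weight {a b y P Q : ℝ} (hP : P ≤ a * y) (hQ : Q ≤ b * y) (q : ℕ × ℕ) :
    Real.exp (-((a * (((q.1 : ℝ) + 1) ^ 2 - 1) + b * (((q.2 : ℝ) + 1) ^ 2 - 1)) * y)) ≤
      weight P Q q := by
  unfold weight
  apply Real.exp_le_exp.mpr
  have hm := one_le_succ_sq q.1
  have hl := one_le_succ_sq q.2
  nlinarith [mul_nonneg (sub_nonneg.mpr hP) (sub_nonneg.mpr hm),
    mul_nonneg (sub_nonneg.mpr hQ) (sub_nonneg.mpr hl)]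

theorem coeff_sub_le_of_le {a b y z P Q : ℝ} (ha : 0 ≤ a) (hab : a ≤ b) (hb : b ≤ 7 / 2)
    (hy : 0 ≤ y) (hyz : y ≤ z) (hz : z ≤ 1.01) (hP : P ≤ a * y) (hQ : Q ≤ b * y)
    (q : ℕ × ℕ) :
    |coeff (a * z) (b * z) q - coeff (a * y) (b * y) q| ≤
      (z - y) * (17.7 * (freq q : ℝ) ^ 4 * weight P Q q) := by
  obtain ⟨h1, h2, h3⟩ := abs_frequency_weight_le ha hab hb q
  rw [coeff_eq_exp_mul_affine, coeff_eq_exp_mul_affine]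
  refine (abs_exp_mul_affine_sub_le h2 hy hyz).trans ?_
  have hw := exp_neg_le_weight hP hQ q
  apply mul_le_mul_of_nonneg_left _ (by linarith)
  generalize b * ((q.2 : ℝ) + 1) ^ 2 - a * ((q.1 : ℝ) + 1) ^ 2 = lam at *
  generalize a * (((q.1 : ℝ) + 1) ^ 2 - 1) + b * (((q.2 : ℝ) + 1) ^ 2 - 1) = κ at *
  have hk := one_le_freq q
  have hk2 : 1 ≤ (freq q : ℝ) ^ 2 := one_le_pow₀ hk
  have h0 := abs_nonneg lam
  have hz0 : 0 ≤ z := hy.trans hyz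
  have h4 : |lam| * z ≤ 7 / 2 * (freq q : ℝ) ^ 2 * 1.01 := by gcongr
  -- 3.5 + 3.5(3.5 · 1.01 + 0.5) ≈ 17.62, using 1 ≤ k² ≤ k⁴.
  have h5 : |lam| + κ * (|lam| * z + 1 / 2) ≤ 17.7 * (freq q : ℝ) ^ 4 := by
    have h6 : κ * (|lam| * z + 1 / 2) ≤
        7 / 2 * (freq q : ℝ) ^ 2 * (7 / 2 * (freq q : ℝ) ^ 2 * 1.01 + 1 / 2) := by
      have : 0 ≤ |lam| * z + 1 / 2 := by positivity
      gcongr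
    nlinarith
  calc _ ≤ weight P Q q * (17.7 * (freq q : ℝ) ^ 4) := by
        apply mul_le_mul hw h5 _ (Real.exp_pos _).le
        have : 0 ≤ z := hy.trans hyz
        positivity
    _ = _ := by ring

theorem abs_coeff_sub_le {a b y z P Q : ℝ} (ha : 0 ≤ a) (hab : a ≤ b) (hb : b ≤ 7 / 2)
    (hy : 0 ≤ y) (hz : 0 ≤ z) (hy1 : y ≤ 1.01) (hz1 : z ≤ 1.01) (hP : P ≤ a * y)
    (hQ : Q ≤ b * y) (hP' : P ≤ a * z) (hQ' : Q ≤ b * z) (q : ℕ × ℕ) :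
    |coeff (a * z) (b * z) q - coeff (a * y) (b * y) q| ≤
      |z - y| * (17.7 * (freq q : ℝ) ^ 4 * weight P Q q) := by
  rcases le_total y z with h | h
  · rw [abs_of_nonneg (sub_nonneg.mpr h)]
    exact coeff_sub_le_of_le ha hab hb hy h hz1 hP hQ q
  · rw [abs_sub_comm, abs_sub_comm z, abs_of_nonneg (sub_nonneg.mpr h)]
    exact coeff_sub_le_of_le ha hab hb hz h hy1 hP' hQ' q

theorem abs_coeff_le_weight {a b y P Q : ℝ} (ha : 0 ≤ a) (hab : a ≤ b) (hb : b ≤ 7 / 2)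
    (hy : 0 ≤ y) (hy1 : y ≤ 1.01) (hP : P ≤ a * y) (hQ : Q ≤ b * y) (q : ℕ × ℕ) :
    |coeff (a * y) (b * y) q| ≤ 4.08 * (freq q : ℝ) ^ 2 * weight P Q q := by
  obtain ⟨h1, h2, h3⟩ := abs_frequency_weight_le ha hab hb q
  rw [coeff_eq_exp_mul_affine, abs_mul, Real.abs_exp]
  have hw := exp_neg_le_weight hP hQ q
  have hk2 : 1 ≤ (freq q : ℝ) ^ 2 := one_le_pow₀ (one_le_freq q)
  generalize b * ((q.2 : ℝ) + 1) ^ 2 - a * ((q.1 : ℝ) + 1) ^ 2 = lam at *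
  have h4 : |lam * y - 1 / 2| ≤ 4.08 * (freq q : ℝ) ^ 2 := by
    calc _ ≤ |lam * y| + |(1 / 2 : ℝ)| := abs_sub _ _
      _ = |lam| * y + 1 / 2 := by rw [abs_mul, abs_of_nonneg hy]; norm_num
      _ ≤ 7 / 2 * (freq q : ℝ) ^ 2 * 1.01 + 1 / 2 := by gcongr
      _ ≤ _ := by linarith
  calc _ ≤ weight P Q q * (4.08 * (freq q : ℝ) ^ 2) :=
        mul_le_mul hw h4 (abs_nonneg _) (Real.exp_pos _).le
    _ = _ := by ring

/-- Minus the coefficient of the second harmonic. -/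
noncomputable def secondCoeff (a b y : ℝ) : ℝ :=
  Real.exp (-(3 * (a * y))) * (4 * (a * y) + 1 / 2 - b * y) -
    Real.exp (-(3 * (b * y))) * (4 * (b * y) - a * y - 1 / 2)

/-- The sum bounding all terms of frequency at least three. -/
noncomputable def tailBound (P Q : ℝ) : ℝ :=
  501 / 500 * 3 ^ 6 * Real.exp (-(8 * P)) + 501 / 500 * 3 ^ 6 * Real.exp (-(8 * Q)) +
    (2 ^ 6 * Real.exp (-(3 * P)) + 501 / 500 * 3 ^ 6 * Real.exp (-(8 * P))) *
    (2 ^ 6 * Real.exp (-(3 * Q)) + 501 / 500 * 3 ^ 6 * Real.exp (-(8 * Q)))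

theorem leading_coeffs (A B : ℝ) : coeff A B (0, 0) = B - A - 1 / 2 ∧
    coeff A B (1, 0) + coeff A B (0, 1) = -(Real.exp (-(3 * A)) * (4 * A + 1 / 2 - B) -
      Real.exp (-(3 * B)) * (4 * B - A - 1 / 2)) := by
  refine ⟨by simp [coeff], ?_⟩
  simp only [coeff]
  push_cast
  rw [show -(A * ((1 + 1) ^ 2 - 1)) - B * ((0 + 1) ^ 2 - 1) = -(3 * A) by ring,
    show -(A * ((0 + 1) ^ 2 - 1)) - B * ((1 + 1) ^ 2 - 1) = -(3 * B) by ring]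
  ring

/-- An expansion around the confluent point at reference height y₀. Each summand changes through its
coefficient (Lipschitz in y) and through the divided difference leaving k² (at most k⁴Δ/6, Δ = 2 -
cos s - cos t). The first three terms are computed exactly; the others carry weight k⁶, with 0.68 =
4.08/6. -/
theorem abs_slope_sub_harmonicSum_sq_le {a b y y₀ P Q s t : ℝ} (ha : 0 ≤ a) (hab : a ≤ b)
    (hb : b ≤ 7 / 2) (hy : 0 ≤ y) (hy₀ : 0 ≤ y₀) (hy1 : y ≤ 1.01) (hy₀1 : y₀ ≤ 1.01)
    (hP : P ≤ a * y) (hQ : Q ≤ b * y) (hP' : P ≤ a * y₀) (hQ' : Q ≤ b * y₀)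
    (hP1 : 6 / 5 ≤ P) (hQ1 : 6 / 5 ≤ Q) (hst : Real.cos s ≠ Real.cos t) :
    |slope (a * y) (b * y) s t - harmonicSum (a * y₀) (b * y₀) (fun k => (k : ℝ) ^ 2) -
      ((b - a) * (y - y₀) + 4 * (secondCoeff a b y - secondCoeff a b y₀) -
        2 * secondCoeff a b y * (2 - Real.cos s - Real.cos t))| ≤
      (17.7 * |y - y₀| + 0.68 * (2 - Real.cos s - Real.cos t)) * tailBound P Q := by
  set Δ := 2 - Real.cos s - Real.cos t with hΔ
  have hΔ0 : 0 ≤ Δ := by linarith [Real.cos_le_one s, Real.cos_le_one t]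
  set c := 17.7 * |y - y₀| + 0.68 * Δ with hc
  have hc0 : 0 ≤ c := by positivity
  have hs1 := summable_harmonicSum (A := a * y) (B := b * y) (by linarith) (by linarith)
    (fun k => abs_chebDiff_le k s t)
  have hs2 := summable_harmonicSum (A := a * y₀) (B := b * y₀) (τ := fun k => (k : ℝ) ^ 2)
    (by linarith) (by linarith) (fun k => by rw [abs_of_nonneg (by positivity)])
  set f : ℕ × ℕ → ℝ := fun q =>
    coeff (a * y) (b * y) q * ((-1) ^ (freq q + 1) * chebDiff (freq q) s t) -
      coeff (a * y₀) (b * y₀) q * ((-1) ^ (freq q + 1) * (freq q : ℝ) ^ 2) with hf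
  have hfs : Summable f := hs1.sub hs2
  have hfbound : ∀ q, |f q| ≤ c * ((freq q : ℝ) ^ 6 * weight P Q q) := by
    intro q
    have h1 := abs_coeff_sub_le ha hab hb hy₀ hy hy₀1 hy1 hP' hQ' hP hQ q
    have h2 := abs_coeff_le_weight ha hab hb hy hy1 hP hQ q
    have h3 := sq_sub_chebDiff_le hst (freq q)
    have h4 : 0 ≤ (freq q : ℝ) ^ 2 - chebDiff (freq q) s t := by
      linarith [(abs_le.mp (abs_chebDiff_le (freq q) s t)).2]
    have e : f q = (-1) ^ (freq q + 1) *
        ((coeff (a * y) (b * y) q - coeff (a * y₀) (b * y₀) q) * (freq q : ℝ) ^ 2 -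
          coeff (a * y) (b * y) q * ((freq q : ℝ) ^ 2 - chebDiff (freq q) s t)) := by
      simp only [hf]; ring
    rw [e, abs_mul, abs_pow, abs_neg, abs_one, one_pow, one_mul]
    refine (abs_sub _ _).trans ?_
    rw [abs_mul, abs_mul, abs_of_nonneg h4, abs_of_nonneg (sq_nonneg (freq q : ℝ))]
    have hw : 0 ≤ weight P Q q := (Real.exp_pos _).le
    calc _ ≤ |y - y₀| * (17.7 * (freq q : ℝ) ^ 4 * weight P Q q) * (freq q : ℝ) ^ 2 +
          4.08 * (freq q : ℝ) ^ 2 * weight P Q q * ((freq q : ℝ) ^ 4 / 6 * Δ) := by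
          gcongr
      _ = _ := by rw [hc]; ring
  have sT := summable_gaussian_tail hP1 (n := 6) le_rfl
  have sT' := summable_gaussian_tail hQ1 (n := 6) le_rfl
  have sW := summable_gaussian_two hP1 (n := 6) le_rfl
  have sW' := summable_gaussian_two hQ1 (n := 6) le_rfl
  have key := abs_tsum_sub_leading_le hfs (sT.mul_left c) (sT'.mul_left c) (sW.mul_left c) sW'
    ?_ ?_ ?_ (fun i => by positivity) (fun i => by positivity)
  · rw [tsum_mul_left, tsum_mul_left, tsum_mul_left] at key
    have e1 : ∑' q, f q = slope (a * y) (b * y) s t -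
        harmonicSum (a * y₀) (b * y₀) (fun k => (k : ℝ) ^ 2) := hs1.tsum_sub hs2
    have e2 : f (0, 0) = (b - a) * (y - y₀) := by
      simp only [hf]
      rw [(leading_coeffs _ _).1, (leading_coeffs _ _).1, show freq (0, 0) = 1 from rfl,
        chebDiff_one hst]
      push_cast; ring
    have e3 : f (1, 0) + f (0, 1) = 4 * (secondCoeff a b y - secondCoeff a b y₀) -
        2 * secondCoeff a b y * Δ := by
      have g1 := (leading_coeffs (a * y) (b * y)).2
      have g2 := (leading_coeffs (a * y₀) (b * y₀)).2
      have e4 : f (1, 0) + f (0, 1) =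
          -((coeff (a * y) (b * y) (1, 0) + coeff (a * y) (b * y) (0, 1)) *
            chebDiff 2 s t) +
          4 * (coeff (a * y₀) (b * y₀) (1, 0) + coeff (a * y₀) (b * y₀) (0, 1)) := by
        simp only [hf]
        rw [show freq (1, 0) = 2 from rfl, show freq (0, 1) = 2 from rfl]
        push_cast; ring
      rw [e4, g1, g2, chebDiff_two hst]
      unfold secondCoeff
      rw [hΔ]; ring
    rw [e1, e2, e3] at key
    have e5 : slope (a * y) (b * y) s t - harmonicSum (a * y₀) (b * y₀) (fun k => (k : ℝ) ^ 2) -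
        ((b - a) * (y - y₀) + 4 * (secondCoeff a b y - secondCoeff a b y₀) -
          2 * secondCoeff a b y * Δ) =
        slope (a * y) (b * y) s t - harmonicSum (a * y₀) (b * y₀) (fun k => (k : ℝ) ^ 2) -
        (b - a) * (y - y₀) - (4 * (secondCoeff a b y - secondCoeff a b y₀) -
          2 * secondCoeff a b y * Δ) := by ring
    rw [e5]
    refine key.trans ?_
    have b1 := tsum_gaussian_tail_le hP1 (n := 6) le_rfl
    have b2 := tsum_gaussian_tail_le hQ1 (n := 6) le_rfl
    have b3 := tsum_gaussian_two_le hP1 (n := 6) le_rfl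
    have b4 := tsum_gaussian_two_le hQ1 (n := 6) le_rfl
    have n4 : 0 ≤ ∑' i : ℕ, ((i : ℝ) + 2) ^ 6 * Real.exp (-(Q * (((i : ℝ) + 2) ^ 2 - 1))) :=
      tsum_nonneg fun i => by positivity
    unfold tailBound
    rw [mul_add, mul_add, mul_assoc c]
    gcongr
  · intro i
    refine (hfbound _).trans (le_of_eq ?_)
    rw [freq_cast]
    simp only [weight]
    push_cast
    rw [show (i : ℝ) + 2 + 1 = i + 3 by ring,
      show -(P * (((i : ℝ) + 3) ^ 2 - 1)) - Q * ((0 + 1) ^ 2 - 1) =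
        -(P * (((i : ℝ) + 3) ^ 2 - 1)) by ring]
    ring
  · intro i
    refine (hfbound _).trans (le_of_eq ?_)
    rw [freq_cast]
    simp only [weight]
    push_cast
    rw [show (i : ℝ) + 2 + 1 = i + 3 by ring,
      show -(P * ((0 + 1) ^ 2 - 1)) - Q * (((i : ℝ) + 3) ^ 2 - 1) =
        -(Q * (((i : ℝ) + 3) ^ 2 - 1)) by ring]
    ring
  · intro i j
    refine (hfbound _).trans (le_of_eq ?_)
    rw [freq_cast]
    simp only [weight]
    push_cast
    rw [show (i : ℝ) + 1 + 1 = i + 2 by ring, show (j : ℝ) + 1 + 1 = j + 2 by ring,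
      sub_eq_add_neg (-(P * _)), Real.exp_add]
    ring

/-! ### The critical range of parameters -/

/-- The critical range of `(π α, π / α)`, where `α` is close to `0.91`. -/
structure CriticalPair (a b : ℝ) : Prop where
  left_ge : 2.827 ≤ a
  left_le : a ≤ 2.885
  right_ge : 3.422 ≤ b
  right_le : b ≤ 3.491
  gap : 0.538 ≤ b - a

theorem criticalPair {α : ℝ} (h1 : 0.9 ≤ α) (h2 : α ≤ 0.918) :
    CriticalPair (Real.pi * α) (Real.pi / α) := by
  have hπ1 := Real.pi_gt_d4
  have hπ2 := Real.pi_lt_d4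
  have hα : 0 < α := by linarith
  have a1 : Real.pi * α ≤ 2.885 := by nlinarith
  have b1 : 3.422 ≤ Real.pi / α := by rw [le_div_iff₀ hα]; nlinarith
  refine ⟨by nlinarith, a1, b1, ?_, ?_⟩
  · rw [div_le_iff₀ hα]; nlinarith
  · have h3 : Real.pi * α ≤ Real.pi * 0.918 := by gcongr
    have h4 : Real.pi / 0.918 ≤ Real.pi / α := by gcongr
    have h5 : 0.538 ≤ Real.pi / 0.918 - Real.pi * 0.918 := by
      have : Real.pi / 0.918 = Real.pi * (1 / 0.918) := by ring
      rw [this]; nlinarith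
    linarith

theorem secondCoeff_eq (a b y : ℝ) : secondCoeff a b y =
    Real.exp (-(3 * a * y)) * (1 / 2 + (4 * a - b) * y) -
      Real.exp (-(3 * b * y)) * (-(1 / 2) + (4 * b - a) * y) := by
  unfold secondCoeff
  rw [show 3 * (a * y) = 3 * a * y by ring, show 3 * (b * y) = 3 * b * y by ring]
  ring

theorem exp_neg_left_le {a b y z : ℝ} (h : CriticalPair a b) (hy : 0.8 ≤ y) (hyz : y ≤ z) :
    Real.exp (-(3 * a * z)) * (1 / 2 + (4 * a - b) * z) ≤
      Real.exp (-(3 * a * y)) * (1 / 2 + (4 * a - b) * y) := by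
  obtain ⟨h1, h2, h3, h4, h5⟩ := h
  have : 0 ≤ (4 * a - b) * y := mul_nonneg (by linarith) (by linarith)
  refine exp_neg_mul_affine_le hyz ?_ (by linarith)
  have h6 : (4 * a - b) * 0.8 ≤ (4 * a - b) * y := by gcongr; linarith
  have h7 : 3 * (1 / 2 + (4 * a - b) * y) ≤ 3 * a * (1 / 2 + (4 * a - b) * y) := by
    gcongr; linarith
  linarith

theorem exp_neg_right_le {a b y z : ℝ} (h : CriticalPair a b) (hy : 0.8 ≤ y) (hyz : y ≤ z) :
    Real.exp (-(3 * b * z)) * (-(1 / 2) + (4 * b - a) * z) ≤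
      Real.exp (-(3 * b * y)) * (-(1 / 2) + (4 * b - a) * y) := by
  obtain ⟨h1, h2, h3, h4, h5⟩ := h
  have h6 : (4 * b - a) * 0.8 ≤ (4 * b - a) * y := by gcongr; linarith
  refine exp_neg_mul_affine_le hyz ?_ (by linarith)
  have h7 : 3 * (-(1 / 2) + (4 * b - a) * y) ≤ 3 * b * (-(1 / 2) + (4 * b - a) * y) := by
    gcongr <;> linarith
  linarith

/-- The second coefficient grows at most linearly when moving down. -/
theorem secondCoeff_sub_le {a b y z : ℝ} (h : CriticalPair a b) (hy : 0.8 ≤ y) (hyz : y ≤ z) :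
    secondCoeff a b y - secondCoeff a b z ≤
      (z - y) * (Real.exp (-(3 * a * y)) * (8.655 * (1 / 2 + 8.118 * z))) := by
  -- The e^{-3b} part decreases with height and enters with a minus sign, so it only helps; the
  -- constants are 8.655 = 3 · 2.885 and 8.118 = 4 · 2.885 - 3.422.
  have hr := exp_neg_right_le h hy hyz
  obtain ⟨h1, h2, h3, h4, h5⟩ := h
  rw [secondCoeff_eq, secondCoeff_eq]
  have e : Real.exp (-(3 * a * z)) = Real.exp (-(3 * a * y)) * Real.exp (-(3 * a * (z - y))) := by
    rw [← Real.exp_add]; congr 1; ring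
  have hr2 : 1 - 3 * a * (z - y) ≤ Real.exp (-(3 * a * (z - y))) := by
    linarith [Real.add_one_le_exp (-(3 * a * (z - y)))]
  have hp : 0 ≤ 1 / 2 + (4 * a - b) * z := by
    have : 0 ≤ (4 * a - b) * z := mul_nonneg (by linarith) (by linarith)
    linarith
  have hz0 : 0 ≤ z := by linarith
  have hE := Real.exp_pos (-(3 * a * y))
  have key : Real.exp (-(3 * a * y)) * (1 / 2 + (4 * a - b) * y) -
      Real.exp (-(3 * a * z)) * (1 / 2 + (4 * a - b) * z) ≤
      Real.exp (-(3 * a * y)) * ((z - y) * (8.655 * (1 / 2 + 8.118 * z))) := by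
    rw [e, mul_assoc (Real.exp (-(3 * a * y))), ← mul_sub]
    apply mul_le_mul_of_nonneg_left _ hE.le
    have h6 : (1 - 3 * a * (z - y)) * (1 / 2 + (4 * a - b) * z) ≤
      Real.exp (-(3 * a * (z - y))) * (1 / 2 + (4 * a - b) * z) := by gcongr
    have h7 : (4 * a - b) * y ≤ (4 * a - b) * z := by gcongr; linarith
    have h8 : 3 * a * (1 / 2 + (4 * a - b) * z) ≤ 8.655 * (1 / 2 + 8.118 * z) := by
      gcongr <;> linarith
    have h9 : (z - y) * (3 * a * (1 / 2 + (4 * a - b) * z)) ≤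
      (z - y) * (8.655 * (1 / 2 + 8.118 * z)) := mul_le_mul_of_nonneg_left h8 (by linarith)
    linarith
  linarith

/-- Both parts decrease with height, so the positive one is evaluated at 0.8661 and the negative one
at 0.8. -/
theorem le_secondCoeff {a b y : ℝ} (h : CriticalPair a b) (hy : 0.8 ≤ y) (hy1 : y ≤ 0.8661) :
    0.001 ≤ secondCoeff a b y := by
  have hl := exp_neg_left_le h hy hy1
  have hr := exp_neg_right_le h le_rfl hy
  obtain ⟨h1, h2, h3, h4, h5⟩ := h
  rw [secondCoeff_eq]
  have e1 : (0.0005 : ℝ) ≤ Real.exp (-(3 * a * 0.8661)) := by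
    have h0 : (0.15 : ℝ) ≤ Real.exp (-(3 * a * 0.8661 / 4)) := by
      refine le_exp_neg_of_le (x := 1.875) (by norm_num) (by norm_num) (by linarith)
        (by norm_num) ?_
      norm_num [Finset.sum_range_succ, Nat.factorial]
    calc (0.0005 : ℝ) ≤ 0.15 ^ 4 := by norm_num
      _ ≤ Real.exp (-(3 * a * 0.8661 / 4)) ^ 4 := by gcongr
      _ = _ := by rw [← Real.exp_nat_mul]; congr 1; push_cast; ring
  have e2 : Real.exp (-(3 * b * 0.8)) ≤ 0.000275 := by
    have := exp_neg_le_of_le (x := 8.2128) (t := 3 * b * 0.8) (c := 1 / 0.000275) 24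
      (by norm_num) (by norm_num) (by linarith)
      (by norm_num [Finset.sum_range_succ, Nat.factorial])
    simpa using this
  have g1 : 0.0005 * (1 / 2 + 7.81 * 0.8661) ≤
      Real.exp (-(3 * a * 0.8661)) * (1 / 2 + (4 * a - b) * 0.8661) := by
    gcongr; linarith
  have g2 : Real.exp (-(3 * b * 0.8)) * (-(1 / 2) + (4 * b - a) * 0.8) ≤
      0.000275 * (-(1 / 2) + 11.14 * 0.8) := by
    gcongr <;> linarith
  norm_num at g1 g2
  linarith

theorem tailBound_le {P Q p r p' r' : ℝ} (h1 : Real.exp (-(3 * P)) ≤ p)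
    (h2 : Real.exp (-(3 * Q)) ≤ r) (h3 : Real.exp (-(8 * P)) ≤ p')
    (h4 : Real.exp (-(8 * Q)) ≤ r') :
    tailBound P Q ≤ 501 / 500 * 3 ^ 6 * p' + 501 / 500 * 3 ^ 6 * r' +
    (2 ^ 6 * p + 501 / 500 * 3 ^ 6 * p') * (2 ^ 6 * r + 501 / 500 * 3 ^ 6 * r') := by
  unfold tailBound
  have := (Real.exp_pos (-(3 * P))).le.trans h1
  have := (Real.exp_pos (-(8 * P))).le.trans h3
  gcongr

theorem tailBound_above : tailBound 2.448 2.963 ≤ 0.0005 := by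
  have h1 : Real.exp (-(3 * 2.448)) ≤ (1 / 1540 : ℝ) := by
    have := exp_neg_le_of_le (x := 3 * 2.448) (c := 1540) 24
      (by norm_num) (by norm_num) le_rfl (by norm_num [Finset.sum_range_succ, Nat.factorial])
    simpa using this
  have h2 : Real.exp (-(3 * 2.963)) ≤ (1 / 7200 : ℝ) := by
    have := exp_neg_le_of_le (x := 3 * 2.963) (c := 7200) 28
      (by norm_num) (by norm_num) le_rfl (by norm_num [Finset.sum_range_succ, Nat.factorial])
    simpa using this
  have h3 : Real.exp (-(8 * 2.448)) ≤ (1 / 1540 : ℝ) ^ 2 * 0.008 := by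
    have := exp_neg_le_of_le (x := 4.896) (c := 1 / 0.008) 20
      (by norm_num) (by norm_num) le_rfl (by norm_num [Finset.sum_range_succ, Nat.factorial])
    calc Real.exp (-(8 * 2.448)) = Real.exp (-(3 * 2.448)) ^ 2 * Real.exp (-4.896) := by
          rw [← Real.exp_nat_mul, ← Real.exp_add]; congr 1; norm_num
      _ ≤ _ := by gcongr; simpa using this
  have h4 : Real.exp (-(8 * 2.963)) ≤ (1 / 7200 : ℝ) ^ 2 :=
    calc Real.exp (-(8 * 2.963)) ≤ Real.exp (-(3 * 2.963)) ^ 2 := by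
          rw [← Real.exp_nat_mul]; exact Real.exp_le_exp.mpr (by norm_num)
      _ ≤ _ := by gcongr
  refine (tailBound_le h1 h2 h3 h4).trans ?_
  norm_num

theorem tailBound_below : tailBound 2.261 2.737 ≤ 0.0015 := by
  have h1 : Real.exp (-(3 * 2.261)) ≤ (1 / 880 : ℝ) := by
    have := exp_neg_le_of_le (x := 3 * 2.261) (c := 880) 24
      (by norm_num) (by norm_num) le_rfl (by norm_num [Finset.sum_range_succ, Nat.factorial])
    simpa using this
  have h2 : Real.exp (-(3 * 2.737)) ≤ (1 / 3650 : ℝ) := by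
    have := exp_neg_le_of_le (x := 3 * 2.737) (c := 3650) 28
      (by norm_num) (by norm_num) le_rfl (by norm_num [Finset.sum_range_succ, Nat.factorial])
    simpa using this
  have h3 : Real.exp (-(8 * 2.261)) ≤ (1 / 880 : ℝ) ^ 2 * 0.011 := by
    have := exp_neg_le_of_le (x := 4.522) (c := 1 / 0.011) 20
      (by norm_num) (by norm_num) le_rfl (by norm_num [Finset.sum_range_succ, Nat.factorial])
    calc Real.exp (-(8 * 2.261)) = Real.exp (-(3 * 2.261)) ^ 2 * Real.exp (-4.522) := by
          rw [← Real.exp_nat_mul, ← Real.exp_add]; congr 1; norm_num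
      _ ≤ _ := by gcongr; simpa using this
  have h4 : Real.exp (-(8 * 2.737)) ≤ (1 / 3650 : ℝ) ^ 2 :=
    calc Real.exp (-(8 * 2.737)) ≤ Real.exp (-(3 * 2.737)) ^ 2 := by
          rw [← Real.exp_nat_mul]; exact Real.exp_le_exp.mpr (by norm_num)
      _ ≤ _ := by gcongr
  refine (tailBound_le h1 h2 h3 h4).trans ?_
  norm_num

theorem sqrt_three_half_bounds : 0.866 ≤ √3 / 2 ∧ √3 / 2 ≤ 0.8661 := by
  constructor
  · have : (1.732 : ℝ) ≤ √3 := Real.le_sqrt_of_sq_le (by norm_num)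
    linarith
  · have : √3 ≤ (1.7322 : ℝ) := Real.sqrt_le_iff.mpr (by norm_num)
    linarith

/-- The bound on 1 - cos t keeps the point outside the unit disk and makes Δ = 2 - cos s - cos t of
order v = y - √3/2. Every correction to the hexagonal value is then linear in v: the gain 0.538v
exceeds the losses 4 · 0.049v and 2 · 0.0049 · 30.04v and the tail. -/
theorem slope_nonneg_of_critical {a b y s t : ℝ} (h : CriticalPair a b)
    (hhex : 0 ≤ harmonicSum (a * (√3 / 2)) (b * (√3 / 2)) (fun k => (k : ℝ) ^ 2))
    (hy : √3 / 2 ≤ y) (hy1 : y ≤ 1.01) (hst : Real.cos t < Real.cos s)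
    (ht : 1 - Real.cos t ≤ 8 * (y ^ 2 - 3 / 4)) : 0 ≤ slope (a * y) (b * y) s t := by
  have hsub := secondCoeff_sub_le h (y := √3 / 2) (z := y)
    (by linarith [sqrt_three_half_bounds.1]) hy
  have hup := exp_neg_left_le h (y := √3 / 2) (z := y)
    (by linarith [sqrt_three_half_bounds.1]) hy
  have hs3 : (√3 / 2) ^ 2 = 3 / 4 := by
    rw [div_pow, Real.sq_sqrt (by norm_num)]; norm_num
  obtain ⟨hl0, hu0⟩ := sqrt_three_half_bounds
  set y₀ := √3 / 2
  obtain ⟨h1, h2, h3, h4, h5⟩ := h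
  have hmain := abs_slope_sub_harmonicSum_sq_le (a := a) (b := b) (y := y) (y₀ := y₀)
    (P := 2.448) (Q := 2.963) (s := s) (t := t) (by linarith) (by linarith) (by linarith)
    (by linarith) (by linarith) hy1 (by linarith) (by nlinarith) (by nlinarith) (by nlinarith)
    (by nlinarith) (by norm_num) (by norm_num) hst.ne'
  have hlow := (abs_le.mp hmain).1
  have hE : Real.exp (-(3 * a * y₀)) ≤ 1 / 1540 := by
    have := exp_neg_le_of_le (x := 3 * 2.448) (t := 3 * a * y₀) (c := 1540) 24
      (by norm_num) (by norm_num) (by nlinarith)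
      (by norm_num [Finset.sum_range_succ, Nat.factorial])
    simpa using this
  have hE0 := Real.exp_pos (-(3 * a * y₀))
  set v := y - y₀ with hv
  have hv0 : 0 ≤ v := by linarith
  rw [abs_of_nonneg hv0] at hlow
  set Δ := 2 - Real.cos s - Real.cos t with hΔ
  have hΔ0 : 0 ≤ Δ := by linarith [Real.cos_le_one s, Real.cos_le_one t]
  -- Both 1 - cos s and 1 - cos t are at most 8(y² - 3/4), and 16(y + √3/2) ≤ 16(1.01 + 0.8661) <
  -- 30.04.
  have hΔ1 : Δ ≤ 30.04 * v := by
    have h6 : Δ ≤ 16 * (y ^ 2 - y₀ ^ 2) := by rw [hs3]; linarith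
    have h7 : 16 * (y ^ 2 - y₀ ^ 2) = 16 * (y + y₀) * v := by rw [hv]; ring
    have h8 : 16 * (y + y₀) * v ≤ 30.04 * v := by gcongr; linarith
    linarith
  have hy0 : 0 ≤ y := by linarith
  have hsub' : secondCoeff a b y₀ - secondCoeff a b y ≤ v * 0.049 := by
    refine hsub.trans ?_
    have h6 : Real.exp (-(3 * a * y₀)) * (8.655 * (1 / 2 + 8.118 * y)) ≤
        1 / 1540 * (8.655 * (1 / 2 + 8.118 * 1.01)) := by gcongr
    exact mul_le_mul_of_nonneg_left (h6.trans (by norm_num)) hv0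
  have hφ : secondCoeff a b y ≤ 0.0049 := by
    rw [secondCoeff_eq]
    have h6 : 0 ≤ Real.exp (-(3 * b * y)) * (-(1 / 2) + (4 * b - a) * y) := by
      apply mul_nonneg (Real.exp_pos _).le
      nlinarith
    have h7 : Real.exp (-(3 * a * y₀)) * (1 / 2 + (4 * a - b) * y₀) ≤
        1 / 1540 * (1 / 2 + 8.118 * 0.8661) := by
      have : 0 ≤ 4 * a - b := by linarith
      gcongr; linarith
    norm_num at h7
    linarith
  have hT := tailBound_above
  have hT0 : 0 ≤ tailBound 2.448 2.963 := by unfold tailBound; positivity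
  have hrest : (17.7 * v + 0.68 * Δ) * tailBound 2.448 2.963 ≤
      (17.7 * v + 0.68 * (30.04 * v)) * 0.0005 := by gcongr
  have hφΔ : secondCoeff a b y * Δ ≤ 0.0049 * (30.04 * v) := by
    calc _ ≤ 0.0049 * Δ := by gcongr
      _ ≤ _ := by gcongr
  have hgap : 0.538 * v ≤ (b - a) * v := by gcongr
  linarith

/-- Going down from √3/2, the gap costs 0.538 per unit of height, more than the second harmonic and
tail can restore. Here Δ = 1 - cos s is not small, but it enters with coefficient -2 · `secondCoeff`
≤ -0.002, which absorbs the tail's 0.68 · 0.0015. -/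
theorem slope_zero_nonpos_of_critical {a b y s : ℝ} (h : CriticalPair a b)
    (hhex : harmonicSum (a * (√3 / 2)) (b * (√3 / 2)) (fun k => (k : ℝ) ^ 2) ≤ 0)
    (hy : 0.8 ≤ y) (hy1 : y ≤ √3 / 2) (hs : Real.cos s ≠ 1) : slope (a * y) (b * y) s 0 ≤ 0 := by
  have hsub := secondCoeff_sub_le h hy hy1
  obtain ⟨hl0, hu0⟩ := sqrt_three_half_bounds
  have hφ := le_secondCoeff h hy (hy1.trans hu0)
  set y₀ := √3 / 2
  obtain ⟨h1, h2, h3, h4, h5⟩ := h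
  have hmain := abs_slope_sub_harmonicSum_sq_le (a := a) (b := b) (y := y) (y₀ := y₀)
    (P := 2.261) (Q := 2.737) (s := s) (t := 0) (by linarith) (by linarith) (by linarith)
    (by linarith) (by linarith) (by linarith) (by linarith) (by nlinarith) (by nlinarith)
    (by nlinarith) (by nlinarith) (by norm_num) (by norm_num) (by rwa [Real.cos_zero])
  have hup := (abs_le.mp hmain).2
  have hE : Real.exp (-(3 * a * y)) ≤ 1 / 880 := by
    have := exp_neg_le_of_le (x := 3 * 2.261) (t := 3 * a * y) (c := 880) 24
      (by norm_num) (by norm_num) (by nlinarith)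
      (by norm_num [Finset.sum_range_succ, Nat.factorial])
    simpa using this
  rw [abs_sub_comm y, abs_of_nonneg (sub_nonneg.mpr hy1), Real.cos_zero] at hup
  have hu : 0 ≤ y₀ - y := by linarith
  have hΔ : 0 ≤ 2 - Real.cos s - 1 := by linarith [Real.cos_le_one s]
  have hsub' : secondCoeff a b y - secondCoeff a b y₀ ≤ (y₀ - y) * 0.08 := by
    refine hsub.trans ?_
    have h6 : Real.exp (-(3 * a * y)) * (8.655 * (1 / 2 + 8.118 * y₀)) ≤
        1 / 880 * (8.655 * (1 / 2 + 8.118 * 0.8661)) := by gcongr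
    exact mul_le_mul_of_nonneg_left (h6.trans (by norm_num)) hu
  have hrest : (17.7 * (y₀ - y) + 0.68 * (2 - Real.cos s - 1)) * tailBound 2.261 2.737 ≤
      (17.7 * (y₀ - y) + 0.68 * (2 - Real.cos s - 1)) * 0.0015 := by
    gcongr
    exact tailBound_below
  have hφΔ : 0.001 * (2 - Real.cos s - 1) ≤ secondCoeff a b y * (2 - Real.cos s - 1) := by gcongr
  have hgap : 0.538 * (y₀ - y) ≤ (b - a) * (y₀ - y) := by gcongr
  linarith

/-- Otherwise the first harmonic (b - a)√3/2 - 1/2 would be positive, and the second adds at least 4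
· 0.001, more than the remainder can cancel. -/
theorem gap_le_of_harmonicSum_nonpos {a b : ℝ} (h : CriticalPair a b)
    (hhex : harmonicSum (a * (√3 / 2)) (b * (√3 / 2)) (fun k => (k : ℝ) ^ 2) ≤ 0) :
    b - a ≤ 0.5774 := by
  by_contra! hgap
  obtain ⟨hl0, hu0⟩ := sqrt_three_half_bounds
  have hφ := le_secondCoeff h (by linarith) hu0
  set y₀ := √3 / 2
  obtain ⟨h1, h2, h3, h4, h5⟩ := h
  have hA : 2.448 ≤ a * y₀ := by nlinarith
  have hmain := abs_harmonicSum_sub_le (A := a * y₀) (B := b * y₀) (τ := fun k => (k : ℝ) ^ 2)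
    (by linarith) (by gcongr; linarith) (fun k => by rw [abs_of_nonneg (by positivity)])
  have hlow := (abs_le.mp hmain).1
  have hE : Real.exp (-(3 * (a * y₀))) ≤ 1 / 1540 := by
    have := exp_neg_le_of_le (x := 3 * 2.448) (t := 3 * (a * y₀)) (c := 1540) 24
      (by norm_num) (by norm_num) (by linarith)
      (by norm_num [Finset.sum_range_succ, Nat.factorial])
    simpa using this
  have hE8 : Real.exp (-(8 * (a * y₀))) ≤ (1 / 1540) ^ 2 :=
    calc Real.exp (-(8 * (a * y₀))) ≤ Real.exp (-(3 * (a * y₀))) ^ 2 := by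
          rw [← Real.exp_nat_mul]; exact Real.exp_le_exp.mpr (by push_cast; linarith)
      _ ≤ _ := by gcongr
  have hrest : b * y₀ * (2 * (501 / 500 * 3 ^ 4 * Real.exp (-(8 * (a * y₀)))) +
      1 / 4 * (2 ^ 4 * Real.exp (-(3 * (a * y₀))) +
        501 / 500 * 3 ^ 4 * Real.exp (-(8 * (a * y₀)))) ^ 2) ≤
      3.491 * 0.8661 * (2 * (501 / 500 * 3 ^ 4 * (1 / 1540) ^ 2) +
      1 / 4 * (2 ^ 4 * (1 / 1540) + 501 / 500 * 3 ^ 4 * (1 / 1540) ^ 2) ^ 2) := by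
    gcongr
  norm_num at hrest
  have hgap' : 0.5774 * 0.866 ≤ (b - a) * y₀ := by gcongr
  unfold secondCoeff at hφ
  norm_num at hlow hgap' hφ
  linarith

/-! ### High points: comparison with the square lattice -/

theorem abs_tsum_coeff_mul_cos_le {A B : ℝ} (hA : 2.9 ≤ A) (hAB : A ≤ B) (hB : B ≤ A + 1) (x : ℝ) :
    |∑' q : ℕ × ℕ, coeff A B q * Real.cos (2 * Real.pi * freq q * x)| ≤ 0.51 := by
  -- The sign undoes the alternation in `harmonicSum`. The value 0 at k = 0 makes |τ k| ≤ k² hold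
  -- for every k; frequencies are never 0.
  set τ : ℕ → ℝ := fun k => if k = 0 then 0 else (-1) ^ (k + 1) * Real.cos (2 * Real.pi * k * x)
    with hτ
  have hτ1 : ∀ k, |τ k| ≤ 1 := by
    intro k
    simp only [hτ]
    split_ifs
    · simp
    · rw [abs_mul, abs_pow, abs_neg, abs_one, one_pow, one_mul]
      exact Real.abs_cos_le_one _
  have hτ2 : ∀ k, |τ k| ≤ (k : ℝ) ^ 2 := by
    intro k
    rcases Nat.eq_zero_or_pos k with rfl | hk
    · simp [hτ]
    · exact (hτ1 k).trans (one_le_pow₀ (by exact_mod_cast hk))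
  have e : harmonicSum A B τ =
      ∑' q : ℕ × ℕ, coeff A B q * Real.cos (2 * Real.pi * freq q * x) := by
    unfold harmonicSum
    congr 1
    ext q
    have h0 : freq q ≠ 0 := by unfold freq; positivity
    have h1 : ((-1 : ℝ) ^ (freq q + 1)) * (-1) ^ (freq q + 1) = 1 := by
      rw [← mul_pow]; norm_num
    simp only [hτ, if_neg h0]
    rw [← mul_assoc ((-1 : ℝ) ^ _), h1, one_mul]
  have hmain := abs_harmonicSum_sub_le (by linarith : 6 / 5 ≤ A) hAB hτ2
  rw [← e]
  have hu : Real.exp (-A) ≤ 1 / 18 := by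
    have := exp_neg_le_of_le (x := 2.9) (t := A) (c := 18) 16 (by norm_num) (by norm_num) hA
      (by norm_num [Finset.sum_range_succ, Nat.factorial])
    simpa using this
  have hAu : A * Real.exp (-A) ≤ 1 / 6 := by
    have := mul_exp_neg_anti (by norm_num : (1 : ℝ) ≤ 2.9) hA
    have h2 : Real.exp (-2.9) ≤ (1 / 18 : ℝ) := by
      have := exp_neg_le_of_le (x := 2.9) (t := 2.9) (c := 18) 16 (by norm_num) (by norm_num) le_rfl
        (by norm_num [Finset.sum_range_succ, Nat.factorial])
      simpa using this
    linarith
  have p3 : Real.exp (-(3 * A)) = Real.exp (-A) ^ 3 := by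
    rw [← Real.exp_nat_mul]; congr 1; push_cast; ring
  have p8 : Real.exp (-(8 * A)) = Real.exp (-A) ^ 8 := by
    rw [← Real.exp_nat_mul]; congr 1; push_cast; ring
  have q3 : Real.exp (-(3 * B)) ≤ Real.exp (-A) ^ 3 := by
    rw [← p3]; exact Real.exp_le_exp.mpr (by linarith)
  rw [p3, p8] at hmain
  have hu0 := Real.exp_pos (-A)
  have hq0 := Real.exp_pos (-(3 * B))
  set u := Real.exp (-A)
  set w := Real.exp (-(3 * B))
  have hu2 : u ^ 2 ≤ (1 / 18) ^ 2 := by gcongr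
  have hu3 : u ^ 3 ≤ (1 / 18) ^ 3 := by gcongr
  have hAu3 : A * u ^ 3 ≤ 1 / 6 * (1 / 18) ^ 2 := by
    calc A * u ^ 3 = A * u * u ^ 2 := by ring
      _ ≤ _ := by gcongr
  have hwA : w * A ≤ 1 / 6 * (1 / 18) ^ 2 :=
    le_trans (by rw [mul_comm]; gcongr) hAu3
  have hw : w ≤ (1 / 18) ^ 3 := q3.trans hu3
  have hφ : |u ^ 3 * (4 * A + 1 / 2 - B) - w * (4 * B - A - 1 / 2)| ≤ 0.006 := by
    have h1 : u ^ 3 * (4 * A + 1 / 2 - B) ≤ u ^ 3 * (3 * A + 1 / 2) := by gcongr; linarith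
    have h2 : 0 ≤ u ^ 3 * (4 * A + 1 / 2 - B) := mul_nonneg (by positivity) (by linarith)
    have h3 : w * (4 * B - A - 1 / 2) ≤ w * (3 * A + 4) := by gcongr; linarith
    have h4 : 0 ≤ w * (4 * B - A - 1 / 2) := mul_nonneg hq0.le (by linarith)
    norm_num at hwA hw hu3 hAu3
    rw [abs_le]; constructor <;> linarith
  have hrest : B * (2 * (501 / 500 * 3 ^ 4 * u ^ 8) +
      1 / 4 * (2 ^ 4 * u ^ 3 + 501 / 500 * 3 ^ 4 * u ^ 8) ^ 2) ≤ 0.004 := by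
    have h1 : u ^ 8 ≤ 0.00001 * u ^ 3 := by
      calc u ^ 8 = u ^ 5 * u ^ 3 := by ring
        _ ≤ (1 / 18) ^ 5 * u ^ 3 := by gcongr
        _ ≤ _ := by gcongr; norm_num
    have h2 : 2 * (501 / 500 * 3 ^ 4 * u ^ 8) +
      1 / 4 * (2 ^ 4 * u ^ 3 + 501 / 500 * 3 ^ 4 * u ^ 8) ^ 2 ≤ 0.03 * u ^ 3 := by
      have h3 : 501 / 500 * 3 ^ 4 * u ^ 8 ≤ 0.001 * u ^ 3 := by nlinarith [pow_pos hu0 3]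
      have h4 : (2 ^ 4 * u ^ 3 + 501 / 500 * 3 ^ 4 * u ^ 8) ^ 2 ≤ (17 * u ^ 3) ^ 2 := by
        gcongr; linarith [pow_pos hu0 3]
      have h5 : (17 * u ^ 3) ^ 2 ≤ 17 ^ 2 * (1 / 18) ^ 3 * u ^ 3 := by
        calc (17 * u ^ 3) ^ 2 = 17 ^ 2 * u ^ 3 * u ^ 3 := by ring
          _ ≤ _ := by gcongr
      norm_num at h5
      have := pow_pos hu0 3
      linarith
    calc _ ≤ B * (0.03 * u ^ 3) := by gcongr; linarith
      _ ≤ (2 * A) * (0.03 * u ^ 3) := by gcongr; linarith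
      _ ≤ _ := by norm_num at hAu3 ⊢; linarith
  have h1 : |(B - A - 1 / 2) * τ 1| ≤ 1 / 2 := by
    rw [abs_mul]
    have : |B - A - 1 / 2| ≤ 1 / 2 := by rw [abs_le]; constructor <;> linarith
    nlinarith [hτ1 1, abs_nonneg (τ 1), abs_nonneg (B - A - 1 / 2)]
  have h2 : |(u ^ 3 * (4 * A + 1 / 2 - B) - w * (4 * B - A - 1 / 2)) * τ 2| ≤ 0.006 := by
    rw [abs_mul]
    nlinarith [hτ1 2, abs_nonneg (τ 2),
      abs_nonneg (u ^ 3 * (4 * A + 1 / 2 - B) - w * (4 * B - A - 1 / 2))]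
  have h3 := abs_le.mp (hmain.trans hrest)
  rw [abs_le] at h1 h2 ⊢
  constructor <;> linarith [h1.1, h1.2, h2.1, h2.2, h3.1, h3.2]

theorem kernel_zero_succ (A B : ℝ) (j : ℕ) : kernel A B (0, (j : ℤ) + 1) =
    -(Real.exp (-(B * ((j : ℝ) + 1) ^ 2)) * (B * ((j : ℝ) + 1) ^ 2 - 1 / 2)) := by
  unfold kernel
  push_cast
  rw [← mul_neg]
  congr 1
  · congr 1; ring
  · ring

theorem kernel_succ_zero (A B : ℝ) (i : ℕ) : kernel A B ((i : ℤ) + 1, 0) =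
    Real.exp (-(A * ((i : ℝ) + 1) ^ 2)) * (A * ((i : ℝ) + 1) ^ 2 + 1 / 2) := by
  unfold kernel
  push_cast
  congr 1
  · congr 1; ring
  · ring

theorem summable_kernel_zero_succ {A B : ℝ} (hA : 0 < A) (hB : 0 < B) :
    Summable fun j : ℕ => kernel A B (0, (j : ℤ) + 1) := by
  have hinj : Function.Injective fun j : ℕ => ((0 : ℤ), (j : ℤ) + 1) := fun a b h => by
    simpa using h
  exact (summable_kernel hA hB).of_abs.comp_injective hinj

theorem summable_kernel_succ_zero {A B : ℝ} (hA : 0 < A) (hB : 0 < B) :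
    Summable fun i : ℕ => kernel A B ((i : ℤ) + 1, 0) := by
  have hinj : Function.Injective fun i : ℕ => ((i : ℤ) + 1, (0 : ℤ)) := fun a b h => by
    simpa using h
  exact (summable_kernel hA hB).of_abs.comp_injective hinj

/-- The two axes are paired index by index: with t = (B - A)n, te^{-t} ≤ 1/2 shows that each
negative term on one axis is compensated by its partner. -/
theorem tsum_kernel_axes_nonneg {A B : ℝ} (hA : 0 < A) (hAB : A ≤ B) :
    0 ≤ ∑' j : ℕ, kernel A B (0, (j : ℤ) + 1) + ∑' i : ℕ, kernel A B ((i : ℤ) + 1, 0) := by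
  have hB := hA.trans_le hAB
  rw [← (summable_kernel_zero_succ hA hB).tsum_add (summable_kernel_succ_zero hA hB)]
  refine tsum_nonneg fun i => ?_
  rw [kernel_zero_succ, kernel_succ_zero]
  set n := ((i : ℝ) + 1) ^ 2
  have hn : 0 ≤ n := by positivity
  have e : Real.exp (-(B * n)) = Real.exp (-(A * n)) * Real.exp (-((B - A) * n)) := by
    rw [← Real.exp_add]; congr 1; ring
  rw [e]
  have ht : 0 ≤ (B - A) * n := mul_nonneg (by linarith) hn
  have hX : 0 ≤ A * n := by positivity
  have hBn : B * n = A * n + (B - A) * n := by ring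
  rw [hBn]
  generalize (B - A) * n = t at *
  generalize A * n = X at *
  have h3 : Real.exp (-t) ≤ 1 := Real.exp_le_one_iff.mpr (by linarith)
  have h5 : Real.exp (-t) * t ≤ 1 / 2 := by
    have h2 : 2 * t ≤ Real.exp t := by
      have := Real.add_one_le_exp (t - 1)
      have h6 : t ≤ Real.exp (t - 1) := by linarith
      have h7 : Real.exp t = Real.exp (t - 1) * Real.exp 1 := by
        rw [← Real.exp_add]; congr 1; ring
      have h8 : (2 : ℝ) ≤ Real.exp 1 := by linarith [Real.add_one_le_exp (1 : ℝ)]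
      rw [h7]; nlinarith
    have : Real.exp (-t) * (2 * t) ≤ Real.exp (-t) * Real.exp t := by gcongr
    rw [← Real.exp_add, neg_add_cancel, Real.exp_zero] at this
    linarith
  have h4 : Real.exp (-t) * (X + t - 1 / 2) ≤ X + 1 / 2 := by
    have : Real.exp (-t) * X ≤ X := by nlinarith
    nlinarith [Real.exp_pos (-t)]
  have := mul_le_mul_of_nonneg_left h4 (Real.exp_pos (-X)).le
  linarith

theorem tsum_kernel_succ_zero_le {A B : ℝ} (hA : 6 / 5 ≤ A) (hA1 : A ≤ 3.5) (hB : 0 < B) :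
    ∑' i : ℕ, kernel A B ((i : ℤ) + 1, 0) ≤ Real.exp (-A) * (A + 1 / 2) +
      4 * Real.exp (-A) * (2 ^ 4 * Real.exp (-(3 * A)) +
        501 / 500 * 3 ^ 4 * Real.exp (-(8 * A))) := by
  have hA0 : 0 < A := by linarith
  have hs := summable_kernel_succ_zero hA0 hB
  rw [hs.tsum_eq_zero_add]
  apply add_le_add
  · rw [kernel_succ_zero]; norm_num
  · refine le_trans ?_ (mul_le_mul_of_nonneg_left (tsum_gaussian_two_le hA (n := 4) (by norm_num))
      (by positivity))
    rw [← tsum_mul_left]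
    refine Summable.tsum_le_tsum (fun i => ?_) ((summable_nat_add_iff 1).mpr hs)
      ((summable_gaussian_two hA (by norm_num)).mul_left _)
    rw [kernel_succ_zero]
    push_cast
    rw [show (i : ℝ) + 1 + 1 = i + 2 by ring]
    have hi : (2 : ℝ) ≤ (i : ℝ) + 2 := by linarith [Nat.cast_nonneg (α := ℝ) i]
    generalize (i : ℝ) + 2 = m at *
    have e : Real.exp (-(A * m ^ 2)) = Real.exp (-A) * Real.exp (-(A * (m ^ 2 - 1))) := by
      rw [← Real.exp_add]; congr 1; ring
    have hm2 : 4 ≤ m ^ 2 := by nlinarith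
    have hm4 : m ^ 2 * 4 ≤ m ^ 4 := by nlinarith
    rw [e]
    calc _ ≤ Real.exp (-A) * Real.exp (-(A * (m ^ 2 - 1))) * (4 * m ^ 4) := by
          gcongr; nlinarith
      _ = _ := by ring

theorem tsum_kernel_zero_succ_le {A B : ℝ} (hA : 0 < A) (hB : 1 / 2 ≤ B) :
    ∑' j : ℕ, kernel A B (0, (j : ℤ) + 1) ≤ -(Real.exp (-B) * (B - 1 / 2)) := by
  have hs := summable_kernel_zero_succ hA (by linarith : 0 < B)
  rw [hs.tsum_eq_zero_add]
  have h0 : kernel A B (0, ((0 : ℕ) : ℤ) + 1) = -(Real.exp (-B) * (B - 1 / 2)) := by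
    rw [kernel_zero_succ]; norm_num
  rw [h0]
  have : ∑' j : ℕ, kernel A B (0, ((j + 1 : ℕ) : ℤ) + 1) ≤ 0 := by
    refine tsum_nonpos fun j => ?_
    rw [kernel_zero_succ]
    have h1 := one_le_succ_sq (j + 1)
    have h2 : 0 ≤ B * (((j + 1 : ℕ) : ℝ) + 1) ^ 2 - 1 / 2 := by nlinarith
    have := mul_nonneg (Real.exp_pos (-(B * (((j + 1 : ℕ) : ℝ) + 1) ^ 2))).le h2
    linarith
  linarith

theorem le_tsum_kernel {A B : ℝ} (hA : 5.1 ≤ A) (hAB : A ≤ B) (hB : B ≤ A + 1) (x : ℝ) :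
    0.4998 ≤ ∑' p : ℤ × ℤ, kernel A B p * Real.cos (2 * Real.pi * (p.1 * p.2) * x) := by
  rw [tsum_kernel_eq (by linarith) (by linarith)]
  have h1 := tsum_kernel_axes_nonneg (by linarith : 0 < A) hAB
  have h2 := (abs_le.mp (abs_tsum_coeff_mul_cos_le (by linarith) hAB hB x)).2
  have h3 : Real.exp (-A - B) ≤ 1 / 20000 := by
    have := exp_neg_le_of_le (x := 10.2) (t := A + B) (c := 20000) 30 (by norm_num) (by norm_num)
      (by linarith) (by norm_num [Finset.sum_range_succ, Nat.factorial])
    rw [show -A - B = -(A + B) by ring]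
    simpa using this
  have h4 : Real.exp (-A - B) *
      (∑' q : ℕ × ℕ, coeff A B q * Real.cos (2 * Real.pi * freq q * x)) ≤
      1 / 20000 * 0.51 := by
    calc _ ≤ Real.exp (-A - B) * 0.51 := by gcongr
      _ ≤ _ := by gcongr
  norm_num at h4 ⊢
  linarith

theorem tsum_kernel_le {A B : ℝ} (hA : 2.984 ≤ A) (hA1 : A ≤ 3.1416) (hB : 3.1415 ≤ B)
    (hB1 : B ≤ 3.307) (hAB : A ≤ B) (x : ℝ) :
    ∑' p : ℤ × ℤ, kernel A B p * Real.cos (2 * Real.pi * (p.1 * p.2) * x) ≤ 0.66 := by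
  rw [tsum_kernel_eq (by linarith) (by linarith)]
  have h1 := tsum_kernel_zero_succ_le (by linarith : 0 < A) (by linarith : 1 / 2 ≤ B)
  have h2 := tsum_kernel_succ_zero_le (by linarith : 6 / 5 ≤ A) (by linarith)
    (by linarith : 0 < B)
  have h3 := (abs_le.mp (abs_tsum_coeff_mul_cos_le (by linarith) hAB (by linarith) x)).1
  have h4 : Real.exp (-A - B) ≤ 1 / 440 := by
    have := exp_neg_le_of_le (x := 6.1) (t := A + B) (c := 440) 24 (by norm_num) (by norm_num)
      (by linarith) (by norm_num [Finset.sum_range_succ, Nat.factorial])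
    rw [show -A - B = -(A + B) by ring]
    simpa using this
  have h5 : -(1 / 440 * 0.51) ≤ Real.exp (-A - B) *
      (∑' q : ℕ × ℕ, coeff A B q * Real.cos (2 * Real.pi * freq q * x)) := by
    calc _ ≤ -(Real.exp (-A - B) * 0.51) := by gcongr
      _ = Real.exp (-A - B) * -0.51 := by ring
      _ ≤ _ := by gcongr
  have hu : Real.exp (-2.984) ≤ (1 / 19.76 : ℝ) := by
    have := exp_neg_le_of_le (x := 2.984) (t := 2.984) (c := 19.76) 20 (by norm_num) (by norm_num)
      le_rfl (by norm_num [Finset.sum_range_succ, Nat.factorial])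
    simpa using this
  have h6 : Real.exp (-A) * (A + 1 / 2) ≤ 1 / 19.76 * 3.484 := by
    have := exp_neg_mul_affine_le (κ := 1) (c₀ := 1 / 2) (c₁ := 1) hA (by norm_num) (by norm_num)
    simp only [one_mul] at this
    calc _ = Real.exp (-A) * (1 / 2 + A) := by ring
      _ ≤ _ := this
      _ ≤ _ := by gcongr; norm_num
  have hw : (0.0365 : ℝ) ≤ Real.exp (-3.307) := by
    have h0 : (0.1912 : ℝ) ≤ Real.exp (-1.6535) := by
      refine le_exp_neg_of_le (x := 1.6535) (by norm_num) (by norm_num) le_rfl (by norm_num) ?_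
      norm_num [Finset.sum_range_succ, Nat.factorial]
    calc (0.0365 : ℝ) ≤ 0.1912 ^ 2 := by norm_num
      _ ≤ Real.exp (-1.6535) ^ 2 := by gcongr
      _ = _ := by rw [← Real.exp_nat_mul]; congr 1; norm_num
  have h7 : 0.0365 * 2.807 ≤ Real.exp (-B) * (B - 1 / 2) := by
    have := exp_neg_mul_affine_le (κ := 1) (c₀ := -(1 / 2)) (c₁ := 1) hB1 (by linarith)
      (by linarith)
    simp only [one_mul] at this
    calc _ ≤ Real.exp (-3.307) * (-(1 / 2) + 3.307) := by gcongr; norm_num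
      _ ≤ _ := this
      _ = _ := by ring
  have hv : Real.exp (-A) ≤ 1 / 19.76 := le_trans (Real.exp_le_exp.mpr (by linarith)) hu
  have p3 : Real.exp (-(3 * A)) = Real.exp (-A) ^ 3 := by
    rw [← Real.exp_nat_mul]; congr 1; push_cast; ring
  have p8 : Real.exp (-(8 * A)) = Real.exp (-A) ^ 8 := by
    rw [← Real.exp_nat_mul]; congr 1; push_cast; ring
  have h8 : 4 * Real.exp (-A) * (2 ^ 4 * Real.exp (-(3 * A)) +
      501 / 500 * 3 ^ 4 * Real.exp (-(8 * A))) ≤ 4 * (1 / 19.76) * (2 ^ 4 * (1 / 19.76) ^ 3 +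
      501 / 500 * 3 ^ 4 * (1 / 19.76) ^ 8) := by
    rw [p3, p8]; gcongr
  norm_num at h5 h6 h7 h8 ⊢
  linarith

/-- The Poisson prefactor grows like √y while the double series stays at least 0.4998 at height y
and at most 0.66 at i; the threshold 1.75 is chosen so that √1.75 · 0.4998 > 0.66. -/
theorem energy_I_le {α x y : ℝ} (hα : 0.95 ≤ α) (hα1 : α ≤ 1) (hy : 1.75 ≤ y)
    (hδ : Real.pi * y / α - Real.pi * α * y ≤ 1) : energy α 0 1 ≤ energy α x y := by
  have hπ := Real.pi_pos
  have hπ1 := Real.pi_gt_d4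
  have hπ2 := Real.pi_lt_d4
  have hα0 : 0 < α := by linarith
  have hAB : ∀ t : ℝ, 0 ≤ t → Real.pi * α * t ≤ Real.pi * t / α := by
    intro t ht
    rw [le_div_iff₀ hα0]
    have : α * α ≤ 1 := by nlinarith
    calc Real.pi * α * t * α = Real.pi * t * (α * α) := by ring
      _ ≤ _ := mul_le_of_le_one_right (by positivity) this
  rw [energy_eq_tsum_kernel hα0 one_pos, energy_eq_tsum_kernel hα0 (by linarith : 0 < y)]
  have hA : 5.1 ≤ Real.pi * α * y := by
    calc (5.1 : ℝ) ≤ 3.1415 * 0.95 * 1.75 := by norm_num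
      _ ≤ _ := by gcongr
  have h1 := le_tsum_kernel hA (hAB y (by linarith)) (by linarith) x
  have h2 := tsum_kernel_le (A := Real.pi * α * 1) (B := Real.pi * 1 / α) (by nlinarith)
    (by nlinarith) (by rw [le_div_iff₀ hα0]; nlinarith) (by rw [div_le_iff₀ hα0]; nlinarith)
    (hAB 1 zero_le_one) 0
  have hs : √(y / α) = √y * √(1 / α) := by
    rw [← Real.sqrt_mul (by linarith), mul_one_div]
  have hy2 : 1.3228 ≤ √y := Real.le_sqrt_of_sq_le (by norm_num at hy ⊢; linarith)
  rw [hs]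
  have hc : 0 ≤ √(1 / α) / (Real.pi * α) := by positivity
  calc _ ≤ √(1 / α) / (Real.pi * α) * 0.66 := by gcongr
    _ ≤ √(1 / α) / (Real.pi * α) * (1.3228 * 0.4998) := by gcongr; norm_num
    _ ≤ √(1 / α) / (Real.pi * α) * (√y * ∑' p : ℤ × ℤ,
          kernel (Real.pi * α * y) (Real.pi * y / α) p *
          Real.cos (2 * Real.pi * (p.1 * p.2) * x)) := by gcongr
    _ = _ := by ring

/-! ### Reduction of the fundamental domain to its boundary curve -/

/-- Coordinates of points of the curve `Γ`. -/
def OnGamma (x y : ℝ) : Prop :=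
  (x = 0 ∧ 1 ≤ y) ∨ (x ^ 2 + y ^ 2 = 1 ∧ 0 ≤ x ∧ x ≤ 1 / 2 ∧ 0 ≤ y)

theorem exists_onGamma_of_re_zero {y : ℝ} (α : ℝ) (hy : 0 < y) :
    ∃ x' y', OnGamma x' y' ∧ energy α x' y' = energy α 0 y := by
  rcases le_total 1 y with h | h
  · exact ⟨0, y, Or.inl ⟨rfl, h⟩, rfl⟩
  · have e := energy_inv (x := 0) α hy.ne'
    refine ⟨_, _, Or.inl ⟨by simp, ?_⟩, e⟩
    rw [le_div_iff₀ (by positivity)]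
    nlinarith

/-- Inversion sends the line Re = 1/2 to the circle |z - 1| = 1, and a translation to the unit
circle. The bounds on t² say that the image, after a reflection, has abscissa at most 1/2. -/
theorem exists_onGamma_of_re_half {t : ℝ} (α : ℝ) (ht : 0 < t) (h1 : 1 / 12 ≤ t ^ 2)
    (h2 : t ^ 2 ≤ 3 / 4) : ∃ x' y', OnGamma x' y' ∧ energy α x' y' = energy α (1 / 2) t := by
  have hd : 0 < t ^ 2 + 1 / 4 := by positivity
  have e := energy_inv (x := 1 / 2) α ht.ne'
  have e1 : (1 / 2 : ℝ) / ((1 / 2) ^ 2 + t ^ 2) = (1 / 4 - t ^ 2) / (t ^ 2 + 1 / 4) + 1 := by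
    field_simp; ring
  have e2 : t / ((1 / 2) ^ 2 + t ^ 2) = t / (t ^ 2 + 1 / 4) := by congr 1; ring
  rw [e1, e2, energy_add_one, ← energy_abs] at e
  refine ⟨_, _, Or.inr ⟨?_, abs_nonneg _, ?_, by positivity⟩, e⟩
  · rw [sq_abs]; field_simp; ring
  · rw [abs_le]
    constructor
    · rw [le_div_iff₀ hd]; linarith
    · rw [div_le_iff₀ hd]; linarith

/-- Moving the reflected inversion `w` of `z` to the line `Re = 1 / 2`. -/
theorem exists_onGamma_of_slope_nonpos {α x y l : ℝ} (hα : 0 < α) (hx : x ≤ 1 / 2)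
    (hy : √3 / 2 ≤ y) (hl : 3 / 10 ≤ l) (hly : l * ((1 - x) ^ 2 + y ^ 2) ≤ y)
    (h : ∀ t a, l ≤ t → t ≤ √3 / 2 → Real.cos a ≠ 1 →
      slope (Real.pi * α * t) (Real.pi * t / α) a 0 ≤ 0) :
    ∃ x' y', OnGamma x' y' ∧ energy α x' y' ≤ energy α x y := by
  have hs := sqrt_three_half_bounds
  have hs3 : (√3 / 2) ^ 2 = 3 / 4 := by
    rw [div_pow, Real.sq_sqrt (by norm_num)]; norm_num
  set s := √3 / 2
  have hy0 : 0 < y := by linarith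
  set d := (1 - x) ^ 2 + y ^ 2 with hd
  have hd0 : 0 < d := by positivity
  have e : energy α ((1 - x) / d) (y / d) = energy α x y := by
    rw [hd, energy_inv α hy0.ne', energy_one_sub]
  have ht1 : l ≤ y / d := by rwa [le_div_iff₀ hd0]
  -- Since x ≤ 1/2, the height is at most y/(1/4 + y²), which is decreasing for y ≥ 1/2 and equals
  -- √3/2 at y = √3/2.
  have ht2 : y / d ≤ s := by
    rw [div_le_iff₀ hd0]
    have h1 : 1 / 4 + y ^ 2 ≤ d := by rw [hd]; nlinarith
    have h2 : s * (1 / 4 + y ^ 2) ≤ s * d := by gcongr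
    nlinarith [mul_nonneg (sub_nonneg.mpr hy) (by nlinarith : 0 ≤ s * y - 1 / 4)]
  have ht0 : 0 < y / d := by positivity
  have key := energy_half_le (q := 1 / 2 - (1 - x) / d) hα ht0 fun hc => h _ _ ht1 ht2 hc
  rw [sub_sub_cancel, e] at key
  obtain ⟨x', y', hg, e'⟩ := exists_onGamma_of_re_half α ht0 (by nlinarith)
    (by rw [← hs3]; gcongr)
  exact ⟨x', y', hg, e'.trans_le key⟩

theorem sq_add_sq_le_two_mul {x y : ℝ} (hx0 : 0 ≤ x) (hx : x ≤ 1) (hy0 : 0 ≤ y) (hy : y ≤ 1)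
    (h : 1 ≤ x ^ 2 + y ^ 2) : (1 - x) ^ 2 + y ^ 2 ≤ 2 * y := by
  have h1 : 1 - x ≤ y := by
    by_contra! h2
    nlinarith
  nlinarith

theorem pi_gap_ge {α α₀ : ℝ} (h0 : 0 < α) (h : α ≤ α₀) (hα₀ : α₀ ≤ 1) :
    3.1415 * (1 / α₀ - α₀) ≤ Real.pi / α - Real.pi * α := by
  have hp : 0 < α₀ := h0.trans_le h
  have e1 : 1 / α₀ ≤ 1 / α := by gcongr
  have h2 : 0 ≤ 1 / α₀ - α₀ := by
    rw [sub_nonneg, le_div_iff₀ hp]; nlinarith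
  calc 3.1415 * (1 / α₀ - α₀) ≤ Real.pi * (1 / α₀ - α₀) := by gcongr; exact Real.pi_gt_d4.le
    _ ≤ Real.pi * (1 / α - α) := by gcongr
    _ = _ := by ring

theorem slope_zero_nonpos_of_large_parameter {α t a : ℝ} (hα : 0.918 ≤ α) (hα1 : α ≤ 1)
    (ht : 0.48 ≤ t) (ht1 : t ≤ √3 / 2) (ha : Real.cos a ≠ 1) :
    slope (Real.pi * α * t) (Real.pi * t / α) a 0 ≤ 0 := by
  rcases le_total t 0.5 with h | h
  · exact slope_zero_nonpos_mid_low hα hα1 ht h ha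
  rcases le_total t 0.8 with h' | h'
  · refine slope_zero_nonpos_mid (by linarith) hα1 ?_ (by linarith) h' ha
    exact ((pi_div_sub_le (by norm_num) hα).resolve_right hα1.not_gt).trans (by norm_num)
  · exact slope_zero_nonpos_high hα hα1 h' (ht1.trans sqrt_three_half_bounds.2) ha

/-- Moving left, from `x` to `x'`, in the critical range. -/
theorem energy_le_of_critical {α x x' y : ℝ} (hα : 0.9 ≤ α) (hα1 : α ≤ 0.918)
    (hhex : 0 ≤ harmonicSum (Real.pi * α * (√3 / 2)) (Real.pi / α * (√3 / 2))
      (fun k => (k : ℝ) ^ 2))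
    (hx' : 0 ≤ x') (hxx' : x' ≤ x) (hx : x ≤ 1 / 2) (hy : √3 / 2 ≤ y) (hy1 : y ≤ 1.01)
    (h : 1 ≤ x' ^ 2 + y ^ 2) : energy α x' y ≤ energy α x y := by
  rcases hxx'.eq_or_lt with rfl | hlt
  · exact le_rfl
  have hπ := Real.pi_pos
  have hs := sqrt_three_half_bounds
  have hcos : Real.cos (2 * Real.pi * (1 / 2 - x')) < Real.cos (2 * Real.pi * (1 / 2 - x)) := by
    apply Real.cos_lt_cos_of_nonneg_of_le_pi
    · nlinarith
    · nlinarith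
    · nlinarith
  obtain ⟨C, hC, e⟩ := energy_half_sub (α := α) (y := y) (by linarith) (by linarith) hcos.ne'
  rw [sub_sub_cancel, sub_sub_cancel] at e
  -- From cos u ≤ 1 - 2u²/π², the left side is at most 2 - 8x'², and x'² + y² ≥ 1 turns this into
  -- 8y² - 6.
  have ht : 1 - Real.cos (2 * Real.pi * (1 / 2 - x')) ≤ 8 * (y ^ 2 - 3 / 4) := by
    rw [show 2 * Real.pi * (1 / 2 - x') = Real.pi - 2 * Real.pi * x' by ring, Real.cos_pi_sub]
    have h1 := Real.cos_le_one_sub_mul_cos_sq (x := 2 * Real.pi * x') (by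
      rw [abs_of_nonneg (by positivity)]; nlinarith)
    have h2 : 2 / Real.pi ^ 2 * (2 * Real.pi * x') ^ 2 = 8 * x' ^ 2 := by field_simp; ring
    linarith
  have hslope := slope_nonneg_of_critical (criticalPair hα hα1) hhex hy hy1 hcos ht
  rw [div_mul_eq_mul_div] at hslope
  have : 0 ≤ C * ((Real.cos (2 * Real.pi * (1 / 2 - x)) - Real.cos (2 * Real.pi * (1 / 2 - x'))) *
      slope (Real.pi * α * y) (Real.pi * y / α) (2 * Real.pi * (1 / 2 - x))
        (2 * Real.pi * (1 / 2 - x'))) :=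
    mul_nonneg hC.le (mul_nonneg (sub_nonneg.mpr hcos.le) hslope)
  linarith

/-- The sign of the series at the hexagonal point selects the direction: leftwards until the
imaginary axis (y ≥ 1) or the unit circle (y ≤ 1) is met, or rightwards after inversion. -/
theorem exists_onGamma_of_critical {α x y : ℝ} (hα : 0.9 ≤ α) (hα1 : α ≤ 0.918) (hx0 : 0 ≤ x)
    (hx : x ≤ 1 / 2) (hy : √3 / 2 ≤ y) (hy1 : y ≤ 1.01) (h : 1 ≤ x ^ 2 + y ^ 2) :
    ∃ x' y', OnGamma x' y' ∧ energy α x' y' ≤ energy α x y := by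
  have hs := sqrt_three_half_bounds
  have hs3 : (√3 / 2) ^ 2 = 3 / 4 := by
    rw [div_pow, Real.sq_sqrt (by norm_num)]; norm_num
  rcases le_total 0 (harmonicSum (Real.pi * α * (√3 / 2)) (Real.pi / α * (√3 / 2))
      (fun k => (k : ℝ) ^ 2)) with hhex | hhex
  · rcases le_total 1 y with h1 | h1
    · exact ⟨0, y, Or.inl ⟨rfl, h1⟩, energy_le_of_critical hα hα1 hhex le_rfl hx0 hx hy hy1
        (by nlinarith)⟩
    · have hsq : √(1 - y ^ 2) ^ 2 = 1 - y ^ 2 := Real.sq_sqrt (by nlinarith)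
      have hle : √(1 - y ^ 2) ≤ x := Real.sqrt_le_iff.mpr ⟨hx0, by linarith⟩
      refine ⟨√(1 - y ^ 2), y, Or.inr ⟨by rw [hsq]; ring, Real.sqrt_nonneg _, hle.trans hx,
        by linarith⟩, energy_le_of_critical hα hα1 hhex (Real.sqrt_nonneg _) hle hx hy hy1 ?_⟩
      rw [hsq]; linarith
  · have hc := criticalPair hα hα1
    -- For 1 ≤ y ≤ 1.01 the inverted height is at least y/(1 + y²) > 0.499; for y ≤ 1 it is at least
    -- 1/2.
    refine exists_onGamma_of_slope_nonpos (l := 0.499) (by linarith) hx hy (by norm_num) ?_ ?_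
    · rcases le_total 1 y with h1 | h1
      · have h2 : (1 - x) ^ 2 ≤ 1 := by nlinarith
        nlinarith
      · have := sq_add_sq_le_two_mul hx0 (by linarith) (by linarith) h1 h
        linarith
    · intro t a h1 h2 ha
      rcases le_total t 0.8 with h3 | h3
      · exact slope_zero_nonpos_mid hα (by linarith) (gap_le_of_harmonicSum_nonpos hc hhex) h1 h3 ha
      · have := slope_zero_nonpos_of_critical hc hhex h3 h2 ha
        rwa [div_mul_eq_mul_div] at this

/-- Once B - A < 0.54, a large height forces α close to 1. This gives the cases: α ≤ 0.918 with y ≤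
1.01, and α ≥ 0.918 split at the heights 1.3 and 1.75, with better lower bounds for α as y grows. -/
theorem exists_onGamma_le {α x y : ℝ} (hα : 0 < α) (hα1 : α ≤ 1) (hx0 : 0 ≤ x) (hx : x ≤ 1 / 2)
    (hy0 : 0 < y) (h : 1 ≤ x ^ 2 + y ^ 2) :
    ∃ x' y', OnGamma x' y' ∧ energy α x' y' ≤ energy α x y := by
  have hs := sqrt_three_half_bounds
  have hy2 : 3 / 4 ≤ y ^ 2 := by nlinarith
  have hy : √3 / 2 ≤ y := by
    have : √(3 / 4) ≤ y := Real.sqrt_le_iff.mpr ⟨hy0.le, hy2⟩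
    rwa [Real.sqrt_div (by norm_num), show √(4 : ℝ) = 2 by
      rw [show (4 : ℝ) = 2 ^ 2 by norm_num, Real.sqrt_sq zero_le_two]] at this
  rcases le_or_gt 0.54 (Real.pi * y / α - Real.pi * α * y) with hδ | hδ
  · obtain ⟨x', y', hg, e⟩ := exists_onGamma_of_re_zero α hy0
    exact ⟨x', y', hg, e.trans_le (energy_zero_le hα hα1 hy0 hy2 hδ)⟩
  have hδ' : (Real.pi / α - Real.pi * α) * y < 0.54 := by
    rwa [sub_mul, div_mul_eq_mul_div]
  -- If α ≤ α₀ and y ≥ y₀, then B - A would reach 0.54; each use below yields a lower bound for α.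
  have hgap : ∀ α₀ y₀ : ℝ, α₀ ≤ 1 → 0 ≤ y₀ → 0.54 ≤ 3.1415 * (1 / α₀ - α₀) * y₀ → α ≤ α₀ →
      ¬ y₀ ≤ y := by
    intro α₀ y₀ h1 h0 h2 h3 h4
    have h5 := pi_gap_ge hα h3 h1
    have hp : 0 ≤ Real.pi / α - Real.pi * α := by
      refine le_trans ?_ (pi_gap_ge hα le_rfl hα1)
      rw [one_div]
      have := (one_le_inv₀ hα).mpr hα1
      linarith
    have : 3.1415 * (1 / α₀ - α₀) * y₀ ≤ (Real.pi / α - Real.pi * α) * y := by gcongr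
    linarith
  have hα9 : 0.9 ≤ α := by
    by_contra! h9
    exact hgap 0.9 0.866 (by norm_num) (by norm_num) (by norm_num) h9.le (by linarith)
  rcases le_total α 0.918 with h918 | h918
  · refine exists_onGamma_of_critical hα9 h918 hx0 hx hy ?_ h
    by_contra! hy1
    have := (criticalPair hα9 h918).gap
    nlinarith
  have hx1 : (1 - x) ^ 2 ≤ 1 := by nlinarith
  rcases le_total y 1.3 with h13 | h13
  -- The inverted height is at least y/(1 + y²) for y ≥ 1, about 0.483 at y = 1.3; the value 0.43
  -- below is likewise just under 1.75/(1 + 1.75²).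
  · refine exists_onGamma_of_slope_nonpos (l := 0.48) hα hx hy (by norm_num) ?_
      fun t a h1 h2 ha => slope_zero_nonpos_of_large_parameter h918 hα1 h1 h2 ha
    rcases le_total 1 y with h1 | h1
    · nlinarith
    · have := sq_add_sq_le_two_mul hx0 (by linarith) (by linarith) h1 h
      linarith
  rcases le_total y 1.75 with h175 | h175
  · have h936 : 0.936 ≤ α := by
      by_contra! h9
      exact hgap 0.936 1.3 (by norm_num) (by norm_num) (by norm_num) h9.le h13
    refine exists_onGamma_of_slope_nonpos (l := 0.43) hα hx hy (by norm_num) (by nlinarith) ?_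
    intro t a h1 h2 ha
    rcases le_total t 0.49 with h3 | h3
    · exact slope_zero_nonpos_low h936 hα1 h1 h3 ha
    · exact slope_zero_nonpos_of_large_parameter h918 hα1 (by linarith) h2 ha
  · have h95 : 0.95 ≤ α := by
      by_contra! h9
      exact hgap 0.95 1.75 (by norm_num) (by norm_num) (by norm_num) h9.le h175
    exact ⟨0, 1, Or.inl ⟨rfl, le_rfl⟩, energy_I_le h95 hα1 h175 (by linarith)⟩

/-! ### Existence of a minimizer on the curve -/

theorem OnGamma.im_pos {x y : ℝ} (h : OnGamma x y) : 0 < y := by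
  rcases h with ⟨-, h⟩ | ⟨h, h0, h1, h2⟩
  · linarith
  · by_contra! h3
    nlinarith

/-- Gives the growth of the energy at the cusp: on the row m = 0, at least √y indices n lie between
√y and 4√y, and each has n²/y in [1, 16]. -/
theorem sqrt_mul_exp_le_energy {α y : ℝ} (hα : 0 < α) (hy : 1 ≤ y) :
    √y * Real.exp (-(16 * Real.pi * α)) ≤ energy α 0 y := by
  have hy0 : 0 < y := by linarith
  have hπ := Real.pi_pos
  set N := ⌈√y⌉₊ with hN
  have hN1 : √y ≤ N := Nat.le_ceil _
  have hs1 : 1 ≤ √y := Real.one_le_sqrt.mpr hy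
  have hN2 : (N : ℝ) ≤ 2 * √y := by linarith [Nat.ceil_lt_add_one (Real.sqrt_nonneg y)]
  have hsq : √y ^ 2 = y := Real.sq_sqrt hy0.le
  let f : ℕ ↪ ℤ × ℤ := ⟨fun n => (0, n), fun a b h => by simpa using h⟩
  have hf : ∀ n, f n = (0, (n : ℤ)) := fun _ => rfl
  have hsum := (summable_energy (x := 0) hα hy0).sum_le_tsum ((Finset.Ico N (2 * N)).map f)
    fun p _ => mul_nonneg (quadForm_nonneg hy0 p) (Real.exp_pos _).le
  refine le_trans ?_ hsum
  rw [Finset.sum_map]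
  have hterm : ∀ n ∈ Finset.Ico N (2 * N), Real.exp (-(16 * Real.pi * α)) ≤
      quadForm 0 y (f n) * Real.exp (-Real.pi * α * quadForm 0 y (f n)) := by
    intro n hn
    obtain ⟨h1, h2⟩ := Finset.mem_Ico.mp hn
    have h1' : √y ≤ n := hN1.trans (by exact_mod_cast h1)
    have h2' : (n : ℝ) ≤ 4 * √y := by
      have : (n : ℝ) ≤ 2 * N := by exact_mod_cast h2.le
      linarith
    have e : quadForm 0 y (f n) = (n : ℝ) ^ 2 / y := by simp [quadForm, hf]
    rw [e]
    have h3 : 1 ≤ (n : ℝ) ^ 2 / y := by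
      rw [le_div_iff₀ hy0, one_mul, ← hsq]; gcongr
    have h4 : (n : ℝ) ^ 2 / y ≤ 16 := by
      rw [div_le_iff₀ hy0]
      calc (n : ℝ) ^ 2 ≤ (4 * √y) ^ 2 := by gcongr
        _ = 16 * y := by rw [mul_pow, hsq]; norm_num
    calc Real.exp (-(16 * Real.pi * α)) ≤ Real.exp (-Real.pi * α * ((n : ℝ) ^ 2 / y)) := by
          apply Real.exp_le_exp.mpr
          have : Real.pi * α * ((n : ℝ) ^ 2 / y) ≤ Real.pi * α * 16 := by gcongr
          linarith
      _ ≤ _ := le_mul_of_one_le_left (Real.exp_pos _).le h3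
  have hcard := Finset.card_nsmul_le_sum _ _ _ hterm
  refine le_trans ?_ hcard
  rw [Nat.card_Ico, nsmul_eq_mul]
  gcongr
  rwa [two_mul, Nat.add_sub_cancel]

/-- A sum of nonnegative continuous functions is lower semicontinuous, which suffices for attaining
minima and avoids locally uniform convergence; hence the passage to `ENNReal`. -/
theorem lowerSemicontinuousOn_energy {α : ℝ} (hα : 0 < α) :
    LowerSemicontinuousOn (fun p : ℝ × ℝ => ENNReal.ofReal (energy α p.1 p.2))
      {p | 0 < p.2} := by
  have h : LowerSemicontinuousOn (fun p : ℝ × ℝ => ∑' q : ℤ × ℤ, ENNReal.ofReal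
      (quadForm p.1 p.2 q * Real.exp (-Real.pi * α * quadForm p.1 p.2 q))) {p | 0 < p.2} := by
    refine lowerSemicontinuousOn_tsum fun q => ContinuousOn.lowerSemicontinuousOn ?_
    have hq : ContinuousOn (fun p : ℝ × ℝ => quadForm p.1 p.2 q) {p | 0 < p.2} := by
      unfold quadForm
      refine ContinuousOn.div (by fun_prop) (by fun_prop) fun p hp => ne_of_gt hp
    exact ENNReal.continuous_ofReal.comp_continuousOn
      (hq.mul (Real.continuous_exp.comp_continuousOn (continuousOn_const.mul hq)))
  intro p hp
  have e : ∀ p' ∈ {p : ℝ × ℝ | 0 < p.2}, (∑' q : ℤ × ℤ, ENNReal.ofReal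
      (quadForm p'.1 p'.2 q * Real.exp (-Real.pi * α * quadForm p'.1 p'.2 q))) =
      ENNReal.ofReal (energy α p'.1 p'.2) := fun p' hp' =>
    (ENNReal.ofReal_tsum_of_nonneg
      (fun q => mul_nonneg (quadForm_nonneg hp' q) (Real.exp_pos _).le)
      (summable_energy hα hp')).symm
  intro c hc
  have hc' : c < ENNReal.ofReal (energy α p.1 p.2) := hc
  rw [← e p hp] at hc'
  filter_upwards [h p hp c hc', self_mem_nhdsWithin] with p' h1 h2
  exact h1.trans_eq (e p' h2)

theorem isCompact_onGamma (R : ℝ) : IsCompact {p : ℝ × ℝ | OnGamma p.1 p.2 ∧ p.2 ≤ R} := by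
  apply Metric.isCompact_of_isClosed_isBounded
  · unfold OnGamma
    simp only [Set.ofPred_and, Set.ofPred_or]
    refine IsClosed.inter (IsClosed.union (IsClosed.inter ?_ ?_) (IsClosed.inter ?_
      (IsClosed.inter ?_ (IsClosed.inter ?_ ?_)))) ?_
    · exact isClosed_eq (by fun_prop) (by fun_prop)
    · exact isClosed_le (by fun_prop) (by fun_prop)
    · exact isClosed_eq (by fun_prop) (by fun_prop)
    · exact isClosed_le (by fun_prop) (by fun_prop)
    · exact isClosed_le (by fun_prop) (by fun_prop)
    · exact isClosed_le (by fun_prop) (by fun_prop)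
    · exact isClosed_le (by fun_prop) (by fun_prop)
  · refine (Metric.isBounded_Icc (0 : ℝ × ℝ) (1 / 2, R)).subset ?_
    rintro ⟨x, y⟩ ⟨h, hR⟩
    have hy := h.im_pos
    refine ⟨⟨?_, hy.le⟩, ⟨?_, hR⟩⟩
    · rcases h with ⟨h, -⟩ | ⟨-, h, -⟩
      · exact h.ge
      · exact h
    · rcases h with ⟨h, -⟩ | ⟨-, -, h, -⟩
      · simp only at h ⊢; linarith
      · exact h

theorem exists_min_onGamma {α : ℝ} (hα : 0 < α) :
    ∃ x₀ y₀, OnGamma x₀ y₀ ∧ ∀ x y, OnGamma x y → energy α x₀ y₀ ≤ energy α x y := by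
  set E := energy α 0 1 with hE
  -- Beyond height R the growth estimate forces the energy on the imaginary axis above its value at
  -- i.
  set R := max 1 ((E * Real.exp (16 * Real.pi * α)) ^ 2) with hR
  have h01 : OnGamma 0 1 := Or.inl ⟨rfl, le_rfl⟩
  have hmem : ((0, 1) : ℝ × ℝ) ∈ {p : ℝ × ℝ | OnGamma p.1 p.2 ∧ p.2 ≤ R} :=
    ⟨h01, le_max_left _ _⟩
  obtain ⟨⟨x₀, y₀⟩, ⟨hg, -⟩, hmin⟩ := LowerSemicontinuousOn.exists_isMinOn ⟨_, hmem⟩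
    (isCompact_onGamma R)
    ((lowerSemicontinuousOn_energy hα).mono fun p hp => hp.1.im_pos)
  have hnn : ∀ x y, 0 < y → 0 ≤ energy α x y := fun x y hy =>
    tsum_nonneg fun q => mul_nonneg (quadForm_nonneg hy q) (Real.exp_pos _).le
  have hle : ∀ x y, OnGamma x y → y ≤ R → energy α x₀ y₀ ≤ energy α x y := by
    intro x y h hy
    have : ENNReal.ofReal (energy α x₀ y₀) ≤ ENNReal.ofReal (energy α x y) :=
      isMinOn_iff.mp hmin (x, y) ⟨h, hy⟩
    rwa [ENNReal.ofReal_le_ofReal_iff (hnn _ _ h.im_pos)] at this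
  refine ⟨x₀, y₀, hg, fun x y h => ?_⟩
  rcases le_total y R with hy | hy
  · exact hle x y h hy
  · have hy1 : 1 ≤ y := (le_max_left _ _).trans hy
    rcases h with ⟨rfl, -⟩ | ⟨h, h0, h1, h2⟩
    · have hE0 : 0 ≤ E := hnn 0 1 one_pos
      have h3 : E * Real.exp (16 * Real.pi * α) ≤ √y :=
        Real.le_sqrt_of_sq_le ((le_max_right _ _).trans hy)
      calc energy α x₀ y₀ ≤ E := hle 0 1 h01 (le_max_left _ _)
        _ = E * Real.exp (16 * Real.pi * α) * Real.exp (-(16 * Real.pi * α)) := by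
            rw [mul_assoc, ← Real.exp_add, add_neg_cancel, Real.exp_zero, mul_one]
        _ ≤ √y * Real.exp (-(16 * Real.pi * α)) := by gcongr
        _ ≤ _ := sqrt_mul_exp_le_energy hα hy1
    · have : y ≤ 1 := by nlinarith
      exact hle x y (Or.inr ⟨h, h0, h1, h2⟩) (this.trans (le_max_left _ _))

/-! ### Points of the upper half-plane -/

theorem mem_Gamma_iff (z : ℍ) : z ∈ Gamma ↔ OnGamma z.re z.im := by
  constructor
  · rintro (⟨y, hy, h⟩ | ⟨t, ⟨ht1, ht2⟩, h⟩)
    · have h1 : z.re = 0 := by rw [← UpperHalfPlane.coe_re, h]; simp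
      have h2 : z.im = y := by rw [← UpperHalfPlane.coe_im, h]; simp
      exact Or.inl ⟨h1, h2 ▸ hy⟩
    · rw [mul_comm] at h
      have h1 : z.re = Real.cos t := by
        rw [← UpperHalfPlane.coe_re, h, Complex.exp_ofReal_mul_I_re]
      have h2 : z.im = Real.sin t := by
        rw [← UpperHalfPlane.coe_im, h, Complex.exp_ofReal_mul_I_im]
      have hπ := Real.pi_pos
      refine Or.inr ⟨?_, ?_, ?_, z.im_pos.le⟩
      · rw [h1, h2, Real.cos_sq_add_sin_sq]
      · rw [h1]; exact Real.cos_nonneg_of_mem_Icc ⟨by linarith, ht2⟩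
      · rw [h1, ← Real.cos_pi_div_three]
        exact Real.cos_le_cos_of_nonneg_of_le_pi (by linarith) (by linarith) ht1
  · rintro (⟨h1, h2⟩ | ⟨h, h0, h1, h2⟩)
    · left
      refine ⟨z.im, h2, Complex.ext ?_ ?_⟩ <;> simp [h1]
    · right
      refine ⟨Real.arccos z.re, ⟨?_, ?_⟩, ?_⟩
      · have := Real.arccos_le_arccos h1
        rwa [← Real.cos_pi_div_three, Real.arccos_cos (by positivity)
          (by linarith [Real.pi_pos])] at this
      · have := Real.arccos_le_arccos h0
        rwa [Real.arccos_zero] at this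
      · rw [mul_comm]
        apply Complex.ext
        · rw [Complex.exp_ofReal_mul_I_re, Real.cos_arccos (by linarith) (by linarith)]; rfl
        · rw [Complex.exp_ofReal_mul_I_im, Real.sin_arccos,
            show 1 - z.re ^ 2 = z.im ^ 2 by linarith, Real.sqrt_sq h2]; rfl

theorem Gamma_subset_closure_halfDomain : Gamma ⊆ closure halfDomain := by
  intro z hz
  have hg := (mem_Gamma_iff z).mp hz
  have him := z.im_pos
  rw [UpperHalfPlane.isEmbedding_coe.isInducing.closure_eq_preimage_closure_image,
    Set.mem_preimage]
  have hx : 0 ≤ z.re ∧ z.re ≤ 1 / 2 := by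
    rcases hg with ⟨h, -⟩ | ⟨-, h0, h1, -⟩
    · rw [h]; norm_num
    · exact ⟨h0, h1⟩
  have hn : 1 ≤ z.re ^ 2 + z.im ^ 2 := by
    rcases hg with ⟨h, h1⟩ | ⟨h, -⟩
    · nlinarith
    · exact h.ge
  have hy : 1 / 2 ≤ z.im := by nlinarith
  -- The path moves up and pulls the abscissa towards 1/4. Its modulus increases because y + x(1/4 -
  -- x) > 0, so all three strict inequalities hold for small ε > 0.
  let γ : ℝ → ℂ := fun ε => ⟨z.re + ε * (1 / 4 - z.re), z.im + ε⟩
  have hγ : Continuous γ := by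
    have : γ = fun ε : ℝ => ((z.re + ε * (1 / 4 - z.re) : ℝ) : ℂ) + ((z.im + ε : ℝ) : ℂ) *
        Complex.I := by
      ext ε; simp [γ, Complex.mk_eq_add_mul_I]
    rw [this]
    fun_prop
  have h0 : γ 0 = z := by
    apply Complex.ext <;> simp [γ]
  have ht : Filter.Tendsto γ (nhdsWithin 0 (Set.Ioi 0)) (nhds (z : ℂ)) := by
    rw [← h0]; exact (hγ.tendsto 0).mono_left nhdsWithin_le_nhds
  refine mem_closure_of_tendsto ht ?_
  filter_upwards [Ioo_mem_nhdsGT (zero_lt_one' ℝ)] with ε hε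
  obtain ⟨he0, he1⟩ := hε
  refine ⟨⟨γ ε, by simp only [γ]; linarith⟩, ⟨?_, ?_, ?_⟩, rfl⟩
  · have h3 : 1 < Complex.normSq (γ ε) := by
      rw [Complex.normSq_apply]
      simp only [γ]
      nlinarith [mul_pos he0 (by nlinarith : 0 < z.im + z.re * (1 / 4 - z.re)),
        sq_nonneg (ε * (1 / 4 - z.re)), sq_nonneg ε]
    rw [UpperHalfPlane.coe_mk, Complex.norm_def]
    exact Real.lt_sqrt_of_sq_lt (by simpa using h3)
  · show 0 < z.re + ε * (1 / 4 - z.re)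
    nlinarith [mul_nonneg hx.1 (sub_nonneg.mpr he1.le)]
  · show z.re + ε * (1 / 4 - z.re) < 1 / 2
    nlinarith [mul_nonneg (sub_nonneg.mpr hx.2) (sub_nonneg.mpr he1.le)]

theorem exists_mem_Gamma_forall_M_le {α : ℝ} (hα : 0 < α) (hα1 : α ≤ 1) :
    ∃ z₀ ∈ Gamma, ∀ z : ℍ, M α z₀ ≤ M α z := by
  obtain ⟨x₀, y₀, hg, hmin⟩ := exists_min_onGamma hα
  refine ⟨⟨⟨x₀, y₀⟩, hg.im_pos⟩, (mem_Gamma_iff _).mpr hg, fun z => ?_⟩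
  obtain ⟨g, h1, h2⟩ := ModularGroup.exists_smul_mem_fd z
  rw [← M_smul α g z, M_eq_energy, M_eq_energy, ← energy_abs α (g • z).re]
  rw [Complex.normSq_apply] at h1
  obtain ⟨x', y', hg', hle⟩ := exists_onGamma_le hα hα1 (abs_nonneg (g • z).re) h2 (g • z).im_pos
    (by rw [sq_abs, sq, sq]; exact h1)
  exact (hmin x' y' hg').trans hle

end LatticeEnergy

/-- For `0 < α ≤ 1` the series defining `M(α, ·)` converges on `ℍ`, and the minima of `M(α, ·)` over
`ℍ`, over the closed half fundamental domain and over `Γ` are all attained and equal. -/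
theorem theorem4p1 (α : ℝ) (hα : α ∈ Set.Ioc (0 : ℝ) 1) :
    (∀ z : UpperHalfPlane, Summable fun p : ℤ × ℤ =>
      LatticeEnergy.normSqPt z p * Real.exp (-Real.pi * α * LatticeEnergy.normSqPt z p)) ∧
    ∃ v : ℝ,
      IsLeast (Set.range (LatticeEnergy.M α)) v ∧
      IsLeast (LatticeEnergy.M α '' closure LatticeEnergy.halfDomain) v ∧
      IsLeast (LatticeEnergy.M α '' LatticeEnergy.Gamma) v := by
  refine ⟨fun z => ?_, ?_⟩
  · simp_rw [LatticeEnergy.normSqPt_eq_quadForm]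
    exact LatticeEnergy.summable_energy hα.1 z.im_pos
  · obtain ⟨z₀, hz₀, hmin⟩ := LatticeEnergy.exists_mem_Gamma_forall_M_le hα.1 hα.2
    refine ⟨LatticeEnergy.M α z₀, ⟨⟨z₀, rfl⟩, ?_⟩,
      ⟨⟨z₀, LatticeEnergy.Gamma_subset_closure_halfDomain hz₀, rfl⟩, ?_⟩, ⟨⟨z₀, hz₀, rfl⟩, ?_⟩⟩
    · rintro _ ⟨z, rfl⟩
      exact hmin z
    · rintro _ ⟨z, -, rfl⟩
      exact hmin z
    · rintro _ ⟨z, -, rfl⟩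
      exact hmin z
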